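/- Let $N\ge 3$, let $\mathbb S^N\subset\mathbb R^{N+1}$ be the round unit sphere with geodesic distance $d$, Riemannian measure $\mu$ and Laplace–Beltrami operator $\Delta_{\mathbb S^N}$, let $o\in\mathbb S^N$, and for $\delta\in(0,\pi)$ put $$\Omega_\delta=\{\delta<d(o,x)<\pi\},\quad \overline{\Omega_\delta}^{\,\pi}=\{\delta\le d(o,x)<\pi\},\quad \Gamma_\delta=\{d(o,x)=\delta\},\quad Q=(0,\infty)\times\overline{\Omega_\delta}^{\,\pi}.$$ Let $\lambda^*=\left(\frac{N-2}{2}\right)^2$, $0<\lambda\le\lambda^*$ and $\lambda_N=\frac{N-2}{2}-\sqrt{\left(\frac{N-2}{2}\right)^2-\lambda}$. For $\alpha\in\mathbb R$, $p>1$ and a function $f$ on $\overline{\Omega_\delta}^{\,\pi}$ consider, with $r=d(o,x)$, the problem $$(P)\qquad \partial_t u-\Delta_{\mathbb S^N}u-\frac{\lambda}{\sin^2 r}u\ge(\sin r)^\alpha|u|^p+f(x)\ \text{ in }(0,\infty)\times\Omega_\delta,\qquad u\ge0\ \text{ on }(0,\infty)\times\Gamma_\delta .$$ A weak solution of $(P)$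 is a function $u\in L^p_{\rm loc}(Q)$ such that $$\int_Q(\sin r)^\alpha|u|^p\xi\,d\mu\,dt+\int_Q f\xi\,d\mu\,dt\le-\int_Q u\,\partial_t\xi\,d\mu\,dt-\int_Q u\Big(\Delta_{\mathbb S^N}\xi+\frac{\lambda}{\sin^2 r}\xi\Big)d\mu\,dt$$ for every $\xi\ge0$ that is of class $C^{1,2}$ (that is, $C^1$ in $t$ and $C^2$ in $x$, up to $\Gamma_\delta$) with compact support in $Q$, and satisfies $\xi=0$ and $\partial_\nu\xi\le0$ on $(0,\infty)\times\Gamma_\delta$, where $\nu$ is the unit normal to $\Gamma_\delta$ pointing out of $\Omega_\delta$. (i) There is $a_\lambda\in[0,\pi)$, depending only on $N$ and $\lambda$, such that for all $\delta\in(a_\lambda,\pi)$ and $\alpha\in\mathbb R$: (a) if $p>\max\{1,\,1+\frac{\alpha+2}{\lambda_N}\}$, then $(P)$ has no weak solution for any $f\in L^1_{\rm loc}(\overline{\Omega_\delta}^{\,\pi})$ with $f\ge0$, $f\not\equiv0$; in particular, if $\alpha\le-2$, this holds for every $p>1$; (b) if either $\alpha>-2$ and $\lambda<\lambda^*$, or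 $-2<\alpha<\frac{N-6}{2}$ and $\lambda=\lambda^*$, then the same nonexistence holds for $p=1+\frac{\alpha+2}{\lambda_N}$. (ii) Let $\alpha>-2$ and $1<p<1+\frac{\alpha+2}{\lambda_N}$. Then there is $b\in[0,\pi)$ such that for every $\delta\in(b,\pi)$ there are a continuous function $f>0$ on $\overline{\Omega_\delta}^{\,\pi}$ and a classical solution $u\in C^\infty((0,\infty)\times\Omega_\delta)\cap C(Q)$ of $(P)$, with $u>0$ on $Q$, of the form $u(t,x)=\left(1-\tfrac12e^{-t}\right)\varepsilon\,G(d(o,x))$ on $Q$, where $\varepsilon>0$ and - if $\lambda<\lambda^*$: $G(r)=(\sin r)^q$ for some $q$ with $\max\{-(N-2)+\lambda_N,\,-\frac{\alpha+2}{p-1}\}<q<-\lambda_N$; - if $\lambda=\lambda^*$: $G(r)=(\sin r)^{-\lambda_N}(-\ln\sin r)^\gamma$ for some $\gamma\in(0,1)$. -/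

import Mathlib

open MeasureTheory Set
open scoped Manifold ContDiff

noncomputable section

namespace HardySphere

/-- The ambient Euclidean space `ℝ^{N+1}`. -/
abbrev Amb (N : ℕ) : Type := EuclideanSpace ℝ (Fin (N + 1))

/-- The unit sphere `S^N ⊂ ℝ^{N+1}`. -/
abbrev Sph (N : ℕ) : Type := Metric.sphere (0 : Amb N) 1

instance finrankFact (N : ℕ) : Fact (Module.finrank ℝ (Amb N) = N + 1) :=
  ⟨by simp⟩

/-- The Riemannian (surface) measure of the round sphere. -/
def sphMeasure (N : ℕ) : Measure (Sph N) :=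
  (volume : Measure (Amb N)).toSphere

/-- The geodesic distance of the round unit sphere: `d(o, x) = arccos ⟨o, x⟩ ∈ [0, π]`. -/
def gdist {N : ℕ} (o x : Sph N) : ℝ :=
  InnerProductGeometry.angle (o : Amb N) (x : Amb N)

theorem normalize_mem {N : ℕ} {y : Amb N} (hy : y ≠ 0) :
    ‖y‖⁻¹ • y ∈ Metric.sphere (0 : Amb N) 1 := by
  have h : ‖y‖ ≠ 0 := norm_ne_zero_iff.mpr hy
  simp [norm_smul, h]

open Classical in
/-- The extension of a function on `S^N` to `ℝ^{N+1} \ {0}` that is constant along rays,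
`y ↦ g (y / |y|)` (value `0` at the origin). -/
def homExt {N : ℕ} (g : Sph N → ℝ) (y : Amb N) : ℝ :=
  if hy : y = 0 then 0 else g ⟨‖y‖⁻¹ • y, normalize_mem hy⟩

/-- The Riemannian gradient on `S^N`, as a tangent vector in `ℝ^{N+1}`: the Euclidean gradient
of the extension that is constant along rays. -/
def sphGrad {N : ℕ} (g : Sph N → ℝ) (x : Sph N) : Amb N :=
  gradient (homExt g) (x : Amb N)

/-- The Laplace–Beltrami operator of the round sphere:
`Δ_{S^N} g (x) = Δ_{ℝ^{N+1}} (y ↦ g (y / |y|)) (x)` for `|x| = 1`. -/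
def sphLaplacian {N : ℕ} (g : Sph N → ℝ) (x : Sph N) : ℝ :=
  Laplacian.laplacian (homExt g) (x : Amb N)

/-- The exterior geodesic domain `Ω_δ = {δ < d(o, x) < π}`. -/
def Omega {N : ℕ} (o : Sph N) (δ : ℝ) : Set (Sph N) :=
  {x | δ < gdist o x ∧ gdist o x < Real.pi}

/-- The partial closure `{δ ≤ d(o, x) < π}` of `Ω_δ`. -/
def OmegaBar {N : ℕ} (o : Sph N) (δ : ℝ) : Set (Sph N) :=
  {x | δ ≤ gdist o x ∧ gdist o x < Real.pi}

/-- The regular boundary `Γ_δ = {d(o, x) = δ}`. -/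
def Gam {N : ℕ} (o : Sph N) (δ : ℝ) : Set (Sph N) :=
  {x | gdist o x = δ}

/-- `Q = (0, ∞) × {δ ≤ d(o, x) < π}`. -/
def Q {N : ℕ} (o : Sph N) (δ : ℝ) : Set (ℝ × Sph N) :=
  Ioi (0 : ℝ) ×ˢ OmegaBar o δ

/-- The measure `dμ dt` on `ℝ × S^N`. -/
def spaceTimeMeasure (N : ℕ) : Measure (ℝ × Sph N) :=
  (volume : Measure ℝ).prod (sphMeasure N)

/-- The unit normal to `Γ_δ` at `x` (with `d(o, x) = δ ∈ (0, π)`) pointing out of `Ω_δ`, that is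
`-∂_r`: the unit tangent vector at `x` of the geodesic from `x` to `o`. -/
def outerNormal {N : ℕ} (o x : Sph N) : Amb N :=
  (Real.sin (gdist o x))⁻¹ • ((o : Amb N) - Real.cos (gdist o x) • (x : Amb N))

/-- The outward normal derivative `⟨∇g, ν⟩` on `Γ_δ`. -/
def normalDeriv {N : ℕ} (o : Sph N) (g : Sph N → ℝ) (x : Sph N) : ℝ :=
  inner ℝ (sphGrad g x) (outerNormal o x)

/-- The time derivative. -/
def timeDeriv {N : ℕ} (v : ℝ × Sph N → ℝ) (z : ℝ × Sph N) : ℝ :=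
  deriv (fun s => v (s, z.2)) z.1

/-- The time slice `v(t, ·)`. -/
def slice {N : ℕ} (v : ℝ × Sph N → ℝ) (t : ℝ) : Sph N → ℝ :=
  fun x => v (t, x)

/-- `v` is of class `C^{1,2}` on the open set `U ⊂ ℝ × S^N`: once differentiable in time, of class
`C²` in space, with `v`, `∂_t v` and the space derivatives of order one and two jointly
continuous on `U`. -/
structure IsC12On {N : ℕ} (v : ℝ × Sph N → ℝ) (U : Set (ℝ × Sph N)) : Prop where
  cont : ContinuousOn v U
  diff_time : ∀ z ∈ U, DifferentiableAt ℝ (fun s => v (s, z.2)) z.1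
  cont_time : ContinuousOn (timeDeriv v) U
  contDiff_space : ∀ z ∈ U, ContDiffAt ℝ 2 (homExt (slice v z.1)) (z.2 : Amb N)
  cont_space_one :
    ContinuousOn (fun z => iteratedFDeriv ℝ 1 (homExt (slice v z.1)) (z.2 : Amb N)) U
  cont_space_two :
    ContinuousOn (fun z => iteratedFDeriv ℝ 2 (homExt (slice v z.1)) (z.2 : Amb N)) U

/-- The admissible test functions: `ξ ∈ C_c^{1,2}(Q)` (regularity up to `Γ_δ`, that is on an open
neighbourhood of `Q`; support compact in `Q`) with `ξ ≥ 0`, and `ξ = 0`, `∂_ν ξ ≤ 0` on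
`(0, ∞) × Γ_δ`. Only the values of `ξ` on `Q` enter the weak formulation. -/
structure IsTestFunction {N : ℕ} (o : Sph N) (δ : ℝ) (ξ : ℝ × Sph N → ℝ) : Prop where
  regular : ∃ U : Set (ℝ × Sph N), IsOpen U ∧ Q o δ ⊆ U ∧ IsC12On ξ U
  compactSupport : ∃ K : Set (ℝ × Sph N), IsCompact K ∧ K ⊆ Q o δ ∧ ∀ z ∈ Q o δ \ K, ξ z = 0
  nonneg : ∀ z ∈ Q o δ, 0 ≤ ξ z
  boundary_zero : ∀ t > 0, ∀ x ∈ Gam o δ, ξ (t, x) = 0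
  boundary_normal : ∀ t > 0, ∀ x ∈ Gam o δ, normalDeriv o (slice ξ t) x ≤ 0

/-- `g ∈ L^p_loc(A)`: `g` is in `L^p(K)` for every compact `K ⊆ A`. -/
def LpLocOn {X : Type*} [TopologicalSpace X] [MeasurableSpace X] (g : X → ℝ) (p : ℝ)
    (A : Set X) (m : Measure X) : Prop :=
  ∀ K : Set X, IsCompact K → K ⊆ A → MemLp g (ENNReal.ofReal p) (m.restrict K)

/-- Weak solutions of `∂_t u - Δu - λ u / sin² d(o,x) ≥ (sin d(o,x))^α |u|^p + f` in
`(0, ∞) × Ω_δ`, `u ≥ 0` on `(0, ∞) × Γ_δ`. -/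
structure IsWeakSolution {N : ℕ} (o : Sph N) (δ lam α p : ℝ) (f : Sph N → ℝ)
    (u : ℝ × Sph N → ℝ) : Prop where
  memLpLoc : LpLocOn u p (Q o δ) (spaceTimeMeasure N)
  weak_ineq : ∀ ξ : ℝ × Sph N → ℝ, IsTestFunction o δ ξ →
    (∫ z in Q o δ, Real.sin (gdist o z.2) ^ α * |u z| ^ p * ξ z ∂(spaceTimeMeasure N))
      + (∫ z in Q o δ, f z.2 * ξ z ∂(spaceTimeMeasure N))
    ≤ -(∫ z in Q o δ, u z * timeDeriv ξ z ∂(spaceTimeMeasure N))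
      - ∫ z in Q o δ, u z * (sphLaplacian (slice ξ z.1) z.2
          + lam / Real.sin (gdist o z.2) ^ 2 * ξ z) ∂(spaceTimeMeasure N)

/-- Classical solutions `u ∈ C^∞((0, ∞) × Ω_δ) ∩ C(Q)` of the same problem. -/
structure IsClassicalSolution {N : ℕ} (o : Sph N) (δ lam α p : ℝ) (f : Sph N → ℝ)
    (u : ℝ × Sph N → ℝ) : Prop where
  smooth : ContMDiffOn (𝓘(ℝ, ℝ).prod (𝓡 N)) 𝓘(ℝ, ℝ) ∞ u (Ioi (0 : ℝ) ×ˢ Omega o δ)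
  cont : ContinuousOn u (Q o δ)
  ineq : ∀ t > 0, ∀ x ∈ Omega o δ,
    timeDeriv u (t, x) - sphLaplacian (slice u t) x
        - lam / Real.sin (gdist o x) ^ 2 * u (t, x)
      ≥ Real.sin (gdist o x) ^ α * |u (t, x)| ^ p + f x
  boundary : ∀ t > 0, ∀ x ∈ Gam o δ, 0 ≤ u (t, x)

/-- There is no weak solution for any `f ∈ L^1_loc({δ ≤ d(o, x) < π})` with `f ≥ 0`, `f ≢ 0`. -/
def NoWeakSolution {N : ℕ} (o : Sph N) (δ lam α p : ℝ) : Prop :=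
  ∀ f : Sph N → ℝ, LpLocOn f 1 (OmegaBar o δ) (sphMeasure N) →
    (∀ᵐ x ∂((sphMeasure N).restrict (OmegaBar o δ)), 0 ≤ f x) →
    ¬ (∀ᵐ x ∂((sphMeasure N).restrict (OmegaBar o δ)), f x = 0) →
    ¬ ∃ u : ℝ × Sph N → ℝ, IsWeakSolution o δ lam α p f u

/-- The Hardy constant `λ* = ((N-2)/2)²`. -/
def lamStar (N : ℕ) : ℝ := (((N : ℝ) - 2) / 2) ^ 2

/-- `λ_N = (N-2)/2 - √(((N-2)/2)² - λ)`. -/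
def lamN (N : ℕ) (lam : ℝ) : ℝ :=
  ((N : ℝ) - 2) / 2 - Real.sqrt ((((N : ℝ) - 2) / 2) ^ 2 - lam)

/-- The radial profiles `g` of the explicit solutions: `g(r) = (sin r)^q` with
`max {-(N-2) + λ_N, -(α+2)/(p-1)} < q < -λ_N` if `λ < λ*`, and
`g(r) = (sin r)^{-λ_N} (-ln sin r)^γ` with `0 < γ < 1` if `λ = λ*`. -/
def IsProfile (N : ℕ) (lam α p : ℝ) (g : ℝ → ℝ) : Prop :=
  (lam < lamStar N ∧ ∃ q : ℝ,
      max (-((N : ℝ) - 2) + lamN N lam) (-(α + 2) / (p - 1)) < q ∧ q < -lamN N lam ∧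
      ∀ r, g r = Real.sin r ^ q) ∨
  (lam = lamStar N ∧ ∃ γ : ℝ, 0 < γ ∧ γ < 1 ∧
      ∀ r, g r = Real.sin r ^ (-lamN N lam) * (-Real.log (Real.sin r)) ^ γ)

end HardySphere

end

/-! Everything reduces to radial functions. In the variable `c = ⟨o, x⟩ = cos r`, or in `s = 1 - c²
= sin² r`, the Laplacian of a zonal function is an ordinary differential operator
(`sphLaplacian_zonal`, `sphLaplacian_zonal_sinSq`), and taking `δ` close to `π` confines the problem
to small `s`, near the antipode of `o`. Write `m = λ_N` and `L = Δ + λ / sin² r`.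

Nonexistence. Let `φ ≈ s^(-m/2)` be the less singular positive radial solution of `Lφ = 0`
(`exists_frobenius_solution`), and let `φ I` be the second solution that vanishes on `Γ_δ`, obtained
by reduction of order. Formally, testing with `φ I` gives `∫ f φ I ≤ 0`, hence `f = 0`. Since `φ I`
is not compactly supported in `Q`, the test function is `E(t/T) φ k(I)`, where `k(t) = t` for `t ≤
R` and `k` vanishes for large `t`. The identity `L(φ k(I)) = s^(1-N) φ⁻³ k''(I)`
(`RadialData.sphLaplacian_mul_comp`) shows that only `k''` contributes an error. Young's inequality
absorbs the term in `|u|^p` (`IsWeakSolution.integral_source_le`) and leaves a term of order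
`T^(-q)` together with `R^(-q) ∫ s^(-N/2)` over `s ≥ e^(-CR)`. The exponent `-N/2` is exact when `α
+ 2 = (p - 1) m` and is an upper bound when `α + 2 ≤ (p - 1) m` (`RadialData.laplacian_bound`);
every case of (i) satisfies this inequality. A polar cap of radius `ρ` has measure `O(ρ^N)`, so that
integral grows only like `R`, and the error is `O(R^(1-q))` with `q > 1`. One sends `T → ∞` at fixed
`R`, and then `R → ∞`.

The critical exponent is reached because the truncation is logarithmic in the distance to the pole:
it is linear in `log I` when `λ < λ*`, where `I` is a power, and linear in `I` when `λ = λ*`, where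
`I` is itself a logarithm.

Existence. The factor `1 - e^(-t)/2` is increasing with values in `[1/2, 1]`, so it suffices to find
a stationary `G` with `-LG ≥ 2 f₀ > 0` and `s^(α/2) G^p ≤ M f₀`; a small amplitude `ε` then makes
the nonlinear term harmless (`exists_classicalSolution_of_profile`). A power strictly between the
two indicial exponents, or the double-root power times the square root of a logarithm, has this
property. -/

noncomputable section

namespace HardySphere

open Filter Topology

/-! ### Gradient, normal derivative and Laplacian of zonal functions. -/

section ZonalCalculus

theorem hasFDerivAt_norm_inv {E : Type*} [NormedAddCommGroup E] [InnerProductSpace ℝ E]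
    {y : E} (hy : y ≠ 0) :
    HasFDerivAt (fun z : E => ‖z‖⁻¹) (-(‖y‖⁻¹ ^ 3) • innerSL ℝ y) y := by
  have hn : ‖y‖ ≠ 0 := norm_ne_zero_iff.mpr hy
  have h1 : HasFDerivAt (fun z : E => ‖z‖ ^ 2) (2 • innerSL ℝ y) y :=
    (hasStrictFDerivAt_norm_sq y).hasFDerivAt
  have h2 : HasDerivAt (fun s : ℝ => (√s)⁻¹) (-(1 / (2 * √(‖y‖ ^ 2))) / (√(‖y‖ ^ 2)) ^ 2)
      (‖y‖ ^ 2) :=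
    (Real.hasDerivAt_sqrt (by positivity)).inv (by positivity)
  have h3 := h2.comp_hasFDerivAt y h1
  have he : ((fun s : ℝ => (√s)⁻¹) ∘ fun z : E => ‖z‖ ^ 2) = fun z : E => ‖z‖⁻¹ := by
    ext z; simp [Real.sqrt_sq (norm_nonneg z)]
  rw [he] at h3
  refine h3.congr_fderiv ?_
  rw [Real.sqrt_sq (norm_nonneg y)]
  ext v
  simp
  field_simp

variable {N : ℕ}

/-- The cosine of the angle between `o` and `y`, as a function on the ambient space. -/
def cosExt (o : Amb N) (y : Amb N) : ℝ := inner ℝ o y * ‖y‖⁻¹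

/-- The zonal function `x ↦ Φ ⟨o, x⟩`. -/
def zonal (o : Sph N) (Φ : ℝ → ℝ) (x : Sph N) : ℝ := Φ (inner ℝ (o : Amb N) (x : Amb N))

theorem ne_zero_of_sph (x : Sph N) : (x : Amb N) ≠ 0 := by
  intro h
  have := norm_eq_of_mem_sphere x
  rw [h] at this
  simp at this

theorem homExt_zonal (o : Sph N) (Φ : ℝ → ℝ) {y : Amb N} (hy : y ≠ 0) :
    homExt (zonal o Φ) y = Φ (cosExt o y) := by
  simp [homExt, zonal, cosExt, hy, inner_smul_right, mul_comm]

theorem homExt_zonal_eventuallyEq (o : Sph N) (Φ : ℝ → ℝ) {y : Amb N} (hy : y ≠ 0) :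
    homExt (zonal o Φ) =ᶠ[𝓝 y] fun z => Φ (cosExt o z) := by
  filter_upwards [isOpen_ne.mem_nhds hy] with z hz using homExt_zonal o Φ hz

theorem cosExt_coe (o : Amb N) (x : Sph N) : cosExt o (x : Amb N) = inner ℝ o (x : Amb N) := by
  simp [cosExt]

theorem contDiffAt_cosExt (o : Amb N) {y : Amb N} (hy : y ≠ 0) {n : WithTop ℕ∞} :
    ContDiffAt ℝ n (cosExt o) y := by
  unfold cosExt
  exact (contDiffAt_const.inner ℝ contDiffAt_id).mul
    ((contDiffAt_id.norm ℝ hy).inv (norm_ne_zero_iff.mpr hy))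

theorem hasFDerivAt_cosExt (o : Amb N) {y : Amb N} (hy : y ≠ 0) :
    HasFDerivAt (cosExt o)
      (‖y‖⁻¹ • innerSL ℝ o - (inner ℝ o y * ‖y‖⁻¹ ^ 3) • innerSL ℝ y) y := by
  have h1 : HasFDerivAt (fun z : Amb N => inner ℝ o z) (innerSL ℝ o) y :=
    (innerSL ℝ o).hasFDerivAt
  have := h1.mul (hasFDerivAt_norm_inv hy)
  refine this.congr_fderiv ?_
  ext v
  simp
  ring

theorem contDiffAt_homExt_zonal (o : Sph N) {Φ : ℝ → ℝ} (x : Sph N) {n : WithTop ℕ∞}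
    (hΦ : ContDiffAt ℝ n Φ (inner ℝ (o : Amb N) (x : Amb N))) :
    ContDiffAt ℝ n (homExt (zonal o Φ)) (x : Amb N) := by
  refine ContDiffAt.congr_of_eventuallyEq ?_ (homExt_zonal_eventuallyEq o Φ (ne_zero_of_sph x))
  rw [← cosExt_coe] at hΦ
  exact hΦ.comp _ (contDiffAt_cosExt _ (ne_zero_of_sph x))

theorem hasFDerivAt_homExt_zonal (o : Sph N) {Φ : ℝ → ℝ} {Φ' : ℝ} {y : Amb N} (hy : y ≠ 0)
    (hΦ : HasDerivAt Φ Φ' (cosExt o y)) :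
    HasFDerivAt (homExt (zonal o Φ))
      (Φ' • (‖y‖⁻¹ • innerSL ℝ (o : Amb N) -
        (inner ℝ (o : Amb N) y * ‖y‖⁻¹ ^ 3) • innerSL ℝ y)) y :=
  (hΦ.comp_hasFDerivAt y (hasFDerivAt_cosExt (o : Amb N) hy)).congr_of_eventuallyEq
    (homExt_zonal_eventuallyEq o Φ hy)

theorem sphGrad_zonal (o x : Sph N) {Φ : ℝ → ℝ} {Φ' : ℝ}
    (hΦ : HasDerivAt Φ Φ' (inner ℝ (o : Amb N) (x : Amb N))) :
    sphGrad (zonal o Φ) x =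
      Φ' • ((o : Amb N) - (inner ℝ (o : Amb N) (x : Amb N) : ℝ) • (x : Amb N)) := by
  rw [← cosExt_coe] at hΦ
  have h := hasFDerivAt_homExt_zonal o (ne_zero_of_sph x) hΦ
  unfold sphGrad
  refine HasGradientAt.gradient ?_
  rw [hasGradientAt_iff_hasFDerivAt]
  refine h.congr_fderiv ?_
  ext v
  simp

/-- The extension is `Φ (⟨o, y⟩ / ‖y‖)`, so the Laplacian is the trace of an explicit Hessian over
an orthonormal basis of the ambient space; no charts are involved. -/
theorem sphLaplacian_zonal (o x : Sph N) {Φ Φ₁ : ℝ → ℝ} {Φ₂ : ℝ}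
    (hC : ContDiffAt ℝ 2 Φ (inner ℝ (o : Amb N) (x : Amb N)))
    (h₁ : ∀ᶠ c in 𝓝 (inner ℝ (o : Amb N) (x : Amb N)), HasDerivAt Φ (Φ₁ c) c)
    (h₂ : HasDerivAt Φ₁ Φ₂ (inner ℝ (o : Amb N) (x : Amb N))) :
    sphLaplacian (zonal o Φ) x =
      (1 - (inner ℝ (o : Amb N) (x : Amb N)) ^ 2) * Φ₂
        - N * (inner ℝ (o : Amb N) (x : Amb N)) * Φ₁ (inner ℝ (o : Amb N) (x : Amb N)) := by
  have hx0 := ne_zero_of_sph x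
  have hnx : ‖(x : Amb N)‖ = 1 := norm_eq_of_mem_sphere x
  have hno : ‖(o : Amb N)‖ = 1 := norm_eq_of_mem_sphere o
  have hCf := contDiffAt_homExt_zonal o x hC
  set f := homExt (zonal o Φ) with hf
  -- Second derivative along one unit direction. Summed over a basis, Parseval turns the quadratic
  -- terms into `⟨o, o⟩ = 1`, `⟨o, x⟩` and `⟨x, x⟩ = 1`.
  have key : ∀ e : Amb N, ‖e‖ = 1 → iteratedFDeriv ℝ 2 f (x : Amb N) ![e, e] =
      Φ₂ * (inner ℝ (o : Amb N) e - (inner ℝ (o : Amb N) (x : Amb N)) * inner ℝ (x : Amb N) e) ^ 2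
      + Φ₁ (inner ℝ (o : Amb N) (x : Amb N)) *
        ((inner ℝ (o : Amb N) (x : Amb N)) * (3 * (inner ℝ (x : Amb N) e) ^ 2 - 1)
          - 2 * inner ℝ (o : Amb N) e * inner ℝ (x : Amb N) e) := by
    intro e he
    rw [iteratedFDeriv_two_apply]
    simp only [Fin.isValue, Matrix.cons_val_zero, Matrix.cons_val_one]
    have hev : ∀ᶠ y in 𝓝 (x : Amb N), HasFDerivAt f (Φ₁ (cosExt o y) • (‖y‖⁻¹ •
        innerSL ℝ (o : Amb N) - (inner ℝ (o : Amb N) y * ‖y‖⁻¹ ^ 3) • innerSL ℝ y)) y := by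
      have hc : ContinuousAt (cosExt (o : Amb N)) x :=
        (contDiffAt_cosExt (n := 0) (o : Amb N) hx0).continuousAt
      rw [← cosExt_coe] at h₁
      filter_upwards [hc.eventually h₁, isOpen_ne.mem_nhds hx0] with y hy hy0
      exact hasFDerivAt_homExt_zonal o hy0 hy
    have hd : HasFDerivAt (fderiv ℝ f) (fderiv ℝ (fderiv ℝ f) x) (x : Amb N) := by
      have : ContDiffAt ℝ 1 (fderiv ℝ f) (x : Amb N) := hCf.fderiv_right (by norm_num)
      exact (this.differentiableAt (by norm_num)).hasFDerivAt
    have hd' : HasFDerivAt (fun y => fderiv ℝ f y e)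
        ((ContinuousLinearMap.apply ℝ ℝ e).comp (fderiv ℝ (fderiv ℝ f) x)) (x : Amb N) :=
      (ContinuousLinearMap.apply ℝ ℝ e).hasFDerivAt.comp (x : Amb N) hd
    have hd2 : HasFDerivAt (fun y : Amb N => Φ₁ (cosExt o y) * (‖y‖⁻¹ *
        inner ℝ (o : Amb N) e - (inner ℝ (o : Amb N) y * ‖y‖⁻¹ ^ 3) * inner ℝ y e))
        ((ContinuousLinearMap.apply ℝ ℝ e).comp (fderiv ℝ (fderiv ℝ f) x)) (x : Amb N) := by
      refine hd'.congr_of_eventuallyEq ?_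
      filter_upwards [hev] with y hy
      rw [hy.fderiv]
      simp
    have hg : HasFDerivAt (fun y : Amb N => inner ℝ y e) (innerSL ℝ e) (x : Amb N) := by
      have : (fun y : Amb N => inner ℝ y e) = fun y => innerSL ℝ e y := by
        ext y; simp [real_inner_comm]
      rw [this]
      exact (innerSL ℝ e).hasFDerivAt
    have hi : HasFDerivAt (fun z : Amb N => inner ℝ (o : Amb N) z) (innerSL ℝ (o : Amb N))
      (x : Amb N) := (innerSL ℝ (o : Amb N)).hasFDerivAt
    have hn := hasFDerivAt_norm_inv hx0
    rw [← cosExt_coe] at h₂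
    have h3 := (h₂.comp_hasFDerivAt (x : Amb N) (hasFDerivAt_cosExt (o : Amb N) hx0)).mul
      ((hn.mul_const (inner ℝ (o : Amb N) e)).sub ((hi.mul (hn.pow 3)).mul hg))
    have h4 := congrArg (fun A : Amb N →L[ℝ] ℝ => A e) (hd2.unique h3)
    simp only [ContinuousLinearMap.comp_apply, ContinuousLinearMap.apply_apply] at h4
    rw [h4]
    simp [hnx, he, cosExt_coe]
    rw [real_inner_comm e o, real_inner_comm e x]
    ring
  have hlap : sphLaplacian (zonal o Φ) x = ∑ i, iteratedFDeriv ℝ 2 f (x : Amb N)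
      ![(EuclideanSpace.basisFun (Fin (N+1)) ℝ) i, (EuclideanSpace.basisFun (Fin (N+1)) ℝ) i] := by
    unfold sphLaplacian
    rw [InnerProductSpace.laplacian_eq_iteratedFDeriv_orthonormalBasis _
      (EuclideanSpace.basisFun (Fin (N+1)) ℝ)]
  rw [hlap]
  set b := EuclideanSpace.basisFun (Fin (N+1)) ℝ with hb
  have hsum : ∀ u v : Amb N, ∑ i, inner ℝ u (b i) * inner ℝ v (b i) = inner ℝ u v := by
    intro u v
    rw [← b.sum_inner_mul_inner u v]
    exact Finset.sum_congr rfl fun i _ => by rw [real_inner_comm v (b i)]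
  have hoo := hsum (o : Amb N) o
  have hox := hsum (o : Amb N) x
  have hxx := hsum (x : Amb N) x
  rw [real_inner_self_eq_norm_sq, hno] at hoo
  rw [real_inner_self_eq_norm_sq, hnx] at hxx
  rw [Finset.sum_congr rfl fun i _ => key (b i) (b.orthonormal.1 i)]
  set c : ℝ := inner ℝ (o : Amb N) (x : Amb N)
  have hexp : ∀ i, Φ₂ * (inner ℝ (o : Amb N) (b i) - c * inner ℝ (x : Amb N) (b i)) ^ 2
      + Φ₁ c * (c * (3 * (inner ℝ (x : Amb N) (b i)) ^ 2 - 1)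
          - 2 * inner ℝ (o : Amb N) (b i) * inner ℝ (x : Amb N) (b i)) =
      Φ₂ * (inner ℝ (o : Amb N) (b i) * inner ℝ (o : Amb N) (b i))
      + (-2 * c * Φ₂ - 2 * Φ₁ c) * (inner ℝ (o : Amb N) (b i) * inner ℝ (x : Amb N) (b i))
      + (Φ₂ * c ^ 2 + 3 * c * Φ₁ c) * (inner ℝ (x : Amb N) (b i) * inner ℝ (x : Amb N) (b i))
      - c * Φ₁ c := fun i => by ring
  rw [Finset.sum_congr rfl fun i _ => hexp i, Finset.sum_sub_distrib, Finset.sum_add_distrib,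
    Finset.sum_add_distrib, ← Finset.mul_sum, ← Finset.mul_sum, ← Finset.mul_sum, hoo, hox, hxx]
  simp
  ring

theorem gdist_eq_arccos (o x : Sph N) :
    gdist o x = Real.arccos (inner ℝ (o : Amb N) (x : Amb N)) := by
  simp [gdist, InnerProductGeometry.angle]

theorem abs_inner_le_one (o x : Sph N) : |inner ℝ (o : Amb N) (x : Amb N)| ≤ 1 := by
  simpa using abs_real_inner_le_norm (o : Amb N) (x : Amb N)

theorem cos_gdist (o x : Sph N) :
    Real.cos (gdist o x) = inner ℝ (o : Amb N) (x : Amb N) := by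
  have := abs_le.mp (abs_inner_le_one o x)
  rw [gdist_eq_arccos, Real.cos_arccos this.1 this.2]

theorem sin_gdist (o x : Sph N) :
    Real.sin (gdist o x) = √(1 - (inner ℝ (o : Amb N) (x : Amb N)) ^ 2) := by
  rw [gdist_eq_arccos, Real.sin_arccos]

theorem gdist_mem_Icc (o x : Sph N) : gdist o x ∈ Icc 0 Real.pi := by
  rw [gdist_eq_arccos]
  exact ⟨Real.arccos_nonneg _, Real.arccos_le_pi _⟩

theorem continuous_gdist (o : Sph N) : Continuous (gdist o) := by
  have : gdist o = fun x : Sph N => Real.arccos (inner ℝ (o : Amb N) (x : Amb N)) :=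
    funext (gdist_eq_arccos o)
  rw [this]
  fun_prop

theorem gdist_lt_pi_iff (o x : Sph N) :
    gdist o x < Real.pi ↔ -1 < inner ℝ (o : Amb N) (x : Amb N) := by
  rw [← cos_gdist, ← Real.cos_pi]
  exact (Real.strictAntiOn_cos.lt_iff_gt (right_mem_Icc.mpr Real.pi_pos.le)
    (gdist_mem_Icc o x)).symm

theorem le_gdist_iff (o x : Sph N) {δ : ℝ} (h0 : 0 ≤ δ) (h1 : δ ≤ Real.pi) :
    δ ≤ gdist o x ↔ inner ℝ (o : Amb N) (x : Amb N) ≤ Real.cos δ := by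
  rw [← cos_gdist]
  exact (Real.strictAntiOn_cos.le_iff_ge (gdist_mem_Icc o x) ⟨h0, h1⟩).symm

theorem normalDeriv_zonal (o x : Sph N) {Φ : ℝ → ℝ} {Φ' : ℝ}
    (hΦ : HasDerivAt Φ Φ' (inner ℝ (o : Amb N) (x : Amb N))) :
    normalDeriv o (zonal o Φ) x = Φ' * Real.sin (gdist o x) := by
  have hnx : ‖(x : Amb N)‖ = 1 := norm_eq_of_mem_sphere x
  have hno : ‖(o : Amb N)‖ = 1 := norm_eq_of_mem_sphere o
  unfold normalDeriv outerNormal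
  rw [sphGrad_zonal o x hΦ, cos_gdist]
  set c : ℝ := inner ℝ (o : Amb N) (x : Amb N) with hc
  have hs : inner ℝ ((o : Amb N) - c • (x : Amb N)) ((o : Amb N) - c • (x : Amb N)) =
      Real.sin (gdist o x) ^ 2 := by
    rw [Real.sin_sq, cos_gdist, inner_sub_left, inner_sub_right, inner_sub_right]
    simp only [inner_smul_left, inner_smul_right, real_inner_self_eq_norm_sq, hnx, hno,
      real_inner_comm (o : Amb N) (x : Amb N), ← hc]
    simp
    ring
  rw [inner_smul_left, inner_smul_right, hs]
  simp
  -- At a pole the convention `0⁻¹ = 0` makes the normal zero, and both sides vanish.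
  rcases eq_or_ne (Real.sin (gdist o x)) 0 with h | h
  · simp [h]
  · field_simp
    simp

end ZonalCalculus

/-! ### Measure of latitudes and polar caps, and the logarithmic integral. -/

section CapMeasure

open scoped Pointwise

variable {N : ℕ}

theorem measurable_inner_sph (o : Sph N) :
    Measurable fun x : Sph N => inner ℝ (o : Amb N) (x : Amb N) := by
  have : Continuous fun x : Sph N => inner ℝ (o : Amb N) (x : Amb N) := by fun_prop
  exact this.measurable

instance isFiniteMeasure_sphMeasure : IsFiniteMeasure (sphMeasure N) := by
  unfold sphMeasure; infer_instance

theorem sphMeasure_apply {s : Set (Sph N)} (hs : MeasurableSet s) :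
    sphMeasure N s =
      (N + 1 : ℕ) * (volume : Measure (Amb N)) (Ioo (0 : ℝ) 1 • ((fun x : Sph N => (x : Amb N)) '' s)) := by
  have := (volume : Measure (Amb N)).toSphere_apply' hs
  rw [sphMeasure, this]
  simp

/-- Latitude circles in the open half-sphere opposite to `o` are null sets. -/
theorem sphMeasure_latitude_eq_zero (o : Sph N) {c : ℝ} (hc : -1 < c) (hc0 : c < 0) :
    sphMeasure N {x | inner ℝ (o : Amb N) (x : Amb N) = c} = 0 := by
  have hms : MeasurableSet {x : Sph N | inner ℝ (o : Amb N) (x : Amb N) = c} :=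
    measurableSet_eq_fun (measurable_inner_sph o) measurable_const
  have hno : ‖(o : Amb N)‖ = 1 := norm_eq_of_mem_sphere o
  rw [sphMeasure_apply hms]
  -- A cone, convex because `-c > 0`. The cone over the latitude lies on its frontier, and the
  -- frontier of a convex set is null.
  set K : Set (Amb N) := {y | (-c) * ‖y‖ + inner ℝ (o : Amb N) y ≤ 0} with hK
  have hconv : Convex ℝ K := by
    have h1 : ConvexOn ℝ univ (fun y : Amb N => (-c) * ‖y‖ + inner ℝ (o : Amb N) y) := by
      refine ConvexOn.add ?_ ?_
      · have := (convexOn_norm (E := Amb N) convex_univ).smul (c := -c) (by linarith)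
        simpa using this
      · exact (innerSL ℝ (o : Amb N)).toLinearMap.convexOn convex_univ
    have := h1.convex_le 0
    simpa [hK] using this
  have hsub : Ioo (0 : ℝ) 1 • ((fun x : Sph N => (x : Amb N)) ''
      {x | inner ℝ (o : Amb N) (x : Amb N) = c}) ⊆ frontier K := by
    rintro _ ⟨t, ht, _, ⟨x, hx, rfl⟩, rfl⟩
    have hnx : ‖(x : Amb N)‖ = 1 := norm_eq_of_mem_sphere x
    simp only [mem_ofPred_eq] at hx
    set y : Amb N := t • (x : Amb N) with hy
    have hny : ‖y‖ = t := by rw [hy, norm_smul, hnx, Real.norm_of_nonneg ht.1.le, mul_one]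
    have hoy : inner ℝ (o : Amb N) y = t * c := by rw [hy, inner_smul_right, hx]
    refine ⟨subset_closure ?_, ?_⟩
    · change -c * ‖y‖ + inner ℝ (o : Amb N) y ≤ 0
      rw [hny, hoy]; linarith
    -- Moving from `y` towards `o` leaves the cone at once, because `c > -1`.
    · intro hint
      rw [mem_interior_iff_mem_nhds] at hint
      have hcont : Tendsto (fun s : ℝ => y + s • (o : Amb N)) (𝓝[>] 0) (𝓝 y) := by
        have : Continuous fun s : ℝ => y + s • (o : Amb N) := by fun_prop
        have h := this.tendsto 0
        simp only [zero_smul, add_zero] at h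
        exact h.mono_left nhdsWithin_le_nhds
      obtain ⟨s, hs, hs0⟩ := ((hcont.eventually hint).and self_mem_nhdsWithin).exists
      replace hs0 : 0 < s := hs0
      have h2 : ‖y‖ ≤ ‖y + s • (o : Amb N)‖ + s := by
        have := norm_sub_le (y + s • (o : Amb N)) (s • (o : Amb N))
        rw [add_sub_cancel_right, norm_smul s (o : Amb N), hno, Real.norm_of_nonneg hs0.le, mul_one] at this
        exact this
      have h3 : (-c) * ‖y + s • (o : Amb N)‖ + inner ℝ (o : Amb N) (y + s • (o : Amb N)) ≤ 0 := hs
      rw [inner_add_right, inner_smul_right (o : Amb N) (o : Amb N) s,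
        real_inner_self_eq_norm_sq, hno, hoy] at h3
      rw [hny] at h2
      nlinarith
  rw [measure_mono_null hsub (hconv.addHaar_frontier volume), mul_zero]

/-- The compression of `ℝ^{N+1}` by the factor `ρ` in the directions orthogonal to `o`. -/
def axialCompression (o : Amb N) (ρ : ℝ) : Amb N →ₗ[ℝ] Amb N :=
  ρ • LinearMap.transvection (innerSL ℝ o).toLinearMap ((ρ⁻¹ - 1) • o)

theorem axialCompression_apply (o : Amb N) {ρ : ℝ} (hρ : ρ ≠ 0) (v : Amb N) :
    axialCompression o ρ v = ρ • v + ((1 - ρ) * inner ℝ o v) • o := by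
  simp only [axialCompression, LinearMap.smul_apply, LinearMap.transvection.apply,
    ContinuousLinearMap.coe_coe, innerSL_apply_apply, smul_add, smul_smul]
  congr 2
  field_simp

/-- The transvection has determinant `1 + (ρ⁻¹ - 1) = ρ⁻¹`, and the scaling contributes `ρ ^ (N +
1)`. -/
theorem det_axialCompression {o : Amb N} (ho : ‖o‖ = 1) {ρ : ℝ} (hρ : ρ ≠ 0) :
    LinearMap.det (axialCompression o ρ) = ρ ^ N := by
  rw [axialCompression, LinearMap.det_smul, LinearMap.transvection.det]
  simp [ho]
  field_simp
  ring

/-- The solid cone over both caps fits into the image of a fixed ball under the axial compression,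
which multiplies volume by `ρ ^ N`. -/
theorem sphMeasure_polar_caps_le (N : ℕ) : ∃ C : ℝ, 0 < C ∧ ∀ (o : Sph N) (ρ : ℝ), 0 < ρ →
    sphMeasure N {x | 1 - (inner ℝ (o : Amb N) (x : Amb N)) ^ 2 ≤ ρ ^ 2} ≤
      ENNReal.ofReal (C * ρ ^ N) := by
  set V : ENNReal := (volume : Measure (Amb N)) (Metric.closedBall 0 2) with hV
  have hVtop : V ≠ ⊤ := measure_closedBall_lt_top.ne
  have hVpos : 0 < V := Metric.measure_closedBall_pos _ _ (by norm_num)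
  refine ⟨(N + 1) * V.toReal, by have := ENNReal.toReal_pos hVpos.ne' hVtop; positivity,
    fun o ρ hρ => ?_⟩
  have hno : ‖(o : Amb N)‖ = 1 := norm_eq_of_mem_sphere o
  have hms : MeasurableSet {x : Sph N | 1 - (inner ℝ (o : Amb N) (x : Amb N)) ^ 2 ≤ ρ ^ 2} :=
    measurableSet_le (measurable_const.sub ((measurable_inner_sph o).pow_const 2)) measurable_const
  rw [sphMeasure_apply hms]
  have hsub : Ioo (0 : ℝ) 1 • ((fun x : Sph N => (x : Amb N)) ''
      {x | 1 - (inner ℝ (o : Amb N) (x : Amb N)) ^ 2 ≤ ρ ^ 2}) ⊆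
      axialCompression (o : Amb N) ρ '' Metric.closedBall 0 2 := by
    rintro _ ⟨t, ht, _, ⟨x, hx, rfl⟩, rfl⟩
    have hnx : ‖(x : Amb N)‖ = 1 := norm_eq_of_mem_sphere x
    simp only [mem_ofPred_eq] at hx
    set c : ℝ := inner ℝ (o : Amb N) (x : Amb N) with hc
    have hc1 := abs_inner_le_one o x
    rw [← hc] at hc1
    refine ⟨(t * ρ⁻¹) • (x : Amb N) + (t * c * (1 - ρ⁻¹)) • (o : Amb N), ?_, ?_⟩
    · rw [mem_closedBall_zero_iff]
      have hsq : ‖(t * ρ⁻¹) • (x : Amb N) + (t * c * (1 - ρ⁻¹)) • (o : Amb N)‖ ^ 2 =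
          t ^ 2 * (ρ⁻¹ ^ 2 * (1 - c ^ 2) + c ^ 2) := by
        rw [norm_add_sq_real, norm_smul, norm_smul, inner_smul_left, inner_smul_right,
          real_inner_comm, ← hc, hnx, hno]
        simp only [mul_one, Real.norm_eq_abs, sq_abs, conj_trivial]
        ring
      have h1 : ρ⁻¹ ^ 2 * (1 - c ^ 2) ≤ 1 := by
        rw [inv_pow, inv_mul_le_iff₀ (by positivity)]; linarith
      have h2 : c ^ 2 ≤ 1 := by rw [← sq_abs]; exact pow_le_one₀ (abs_nonneg c) hc1
      have h3 : t ^ 2 ≤ 1 := pow_le_one₀ ht.1.le ht.2.le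
      have h4 : t ^ 2 * (ρ⁻¹ ^ 2 * (1 - c ^ 2) + c ^ 2) ≤ 1 * 2 := by
        refine mul_le_mul h3 (by linarith) ?_ (by norm_num)
        have : 0 ≤ 1 - c ^ 2 := by linarith
        positivity
      refine abs_le_of_sq_le_sq' ?_ (by norm_num) |>.2
      rw [hsq]; linarith
    · rw [axialCompression_apply _ hρ.ne', inner_add_right, inner_smul_right, inner_smul_right,
        ← hc, real_inner_self_eq_norm_sq, hno, smul_add, smul_smul, smul_smul, add_assoc,
        ← add_smul]
      have e1 : ρ * (t * ρ⁻¹) = t := by field_simp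
      have e2 : ρ * (t * c * (1 - ρ⁻¹)) +
          (1 - ρ) * (t * ρ⁻¹ * c + t * c * (1 - ρ⁻¹) * 1 ^ 2) = 0 := by
        field_simp; ring
      rw [e1, e2, zero_smul, add_zero]
  calc ((N + 1 : ℕ) : ENNReal) * _ ≤ ((N + 1 : ℕ) : ENNReal) *
        (volume : Measure (Amb N)) (axialCompression (o : Amb N) ρ '' Metric.closedBall 0 2) := by
        gcongr
    _ = ENNReal.ofReal ((N + 1) * V.toReal * ρ ^ N) := by
        rw [Measure.addHaar_image_linearMap, det_axialCompression hno hρ.ne',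
          abs_of_pos (by positivity), ← hV, ENNReal.ofReal_mul (by positivity),
          ENNReal.ofReal_mul (by positivity), ENNReal.ofReal_toReal hVtop]
        have : ENNReal.ofReal ((N : ℝ) + 1) = ((N + 1 : ℕ) : ENNReal) := by
          rw [← ENNReal.ofReal_natCast]; push_cast; rfl
        rw [this]
        ring

theorem measurableSet_sinSq_ge (o : Sph N) (a : ℝ) :
    MeasurableSet {x : Sph N | a ≤ 1 - (inner ℝ (o : Amb N) (x : Amb N)) ^ 2} :=
  measurableSet_le measurable_const (measurable_const.sub ((measurable_inner_sph o).pow_const 2))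

/-- The integral of `sin^{-N}` diverges only logarithmically at the poles. -/
theorem lintegral_sinSq_rpow_le (N : ℕ) : ∃ C : ℝ, 0 < C ∧ ∀ (o : Sph N) (ℓ : ℝ), 0 ≤ ℓ →
    ∫⁻ x in {x | Real.exp (-ℓ) ≤ 1 - (inner ℝ (o : Amb N) (x : Amb N)) ^ 2},
      ENNReal.ofReal ((1 - (inner ℝ (o : Amb N) (x : Amb N)) ^ 2) ^ (-(N : ℝ) / 2))
        ∂(sphMeasure N) ≤ ENNReal.ofReal (C * (1 + ℓ)) := by
  obtain ⟨C, hC, hcap⟩ := sphMeasure_polar_caps_le N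
  refine ⟨Real.exp (N / 2) * C, by positivity, fun o ℓ hℓ => ?_⟩
  set σ : Sph N → ℝ := fun x => 1 - (inner ℝ (o : Amb N) (x : Amb N)) ^ 2 with hσ
  set J := ⌊ℓ⌋₊ + 1 with hJ
  -- Split into shells `e^(-(j+1)) < σ ≤ e^(-j)`. The integrand is at most `e^((j+1)N/2)` there and
  -- the cap has measure at most `C e^(-jN/2)`, so each shell contributes a constant; at most `1 +
  -- ℓ` shells occur.
  have hpt : ∀ x ∈ {x : Sph N | Real.exp (-ℓ) ≤ σ x}, ENNReal.ofReal (σ x ^ (-(N : ℝ) / 2)) ≤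
      ∑ j ∈ Finset.range J, {x : Sph N | σ x ≤ Real.exp (-(j : ℝ) / 2) ^ 2}.indicator
        (fun _ => ENNReal.ofReal (Real.exp ((j + 1) * N / 2))) x := by
    intro x hx
    simp only [mem_ofPred_eq] at hx
    have hpos : 0 < σ x := (Real.exp_pos _).trans_le hx
    have hle : σ x ≤ 1 := by simp only [hσ]; nlinarith [sq_nonneg (inner ℝ (o : Amb N) (x : Amb N))]
    have hlog : 0 ≤ -Real.log (σ x) := by
      have := Real.log_nonpos hpos.le hle; linarith
    have hlog2 : -Real.log (σ x) ≤ ℓ := by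
      have := Real.log_le_log (Real.exp_pos _) hx
      rw [Real.log_exp] at this; linarith
    set j := ⌊-Real.log (σ x)⌋₊ with hj
    have hj1 : (j : ℝ) ≤ -Real.log (σ x) := Nat.floor_le hlog
    have hj2 : -Real.log (σ x) < j + 1 := Nat.lt_floor_add_one _
    have hjJ : j ∈ Finset.range J := by
      rw [Finset.mem_range, hJ]; exact Nat.lt_succ_of_le (Nat.floor_le_floor hlog2)
    refine le_trans ?_ (Finset.single_le_sum
      (f := fun j : ℕ => {x : Sph N | σ x ≤ Real.exp (-(j : ℝ) / 2) ^ 2}.indicator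
        (fun _ => ENNReal.ofReal (Real.exp ((j + 1) * N / 2))) x) (fun i _ => zero_le) hjJ)
    have hmem : x ∈ {x : Sph N | σ x ≤ Real.exp (-(j : ℝ) / 2) ^ 2} := by
      simp only [mem_ofPred_eq]
      rw [← Real.exp_nat_mul, ← Real.exp_log hpos]
      apply Real.exp_le_exp.mpr
      push_cast
      linarith
    simp only [indicator_of_mem hmem]
    apply ENNReal.ofReal_le_ofReal
    rw [Real.rpow_def_of_pos hpos]
    apply Real.exp_le_exp.mpr
    have : (0 : ℝ) ≤ N := Nat.cast_nonneg N
    nlinarith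
  have hmeas : ∀ j : ℕ, MeasurableSet {x : Sph N | σ x ≤ Real.exp (-(j : ℝ) / 2) ^ 2} := fun j =>
    measurableSet_le (measurable_const.sub ((measurable_inner_sph o).pow_const 2)) measurable_const
  calc ∫⁻ x in {x : Sph N | Real.exp (-ℓ) ≤ σ x}, ENNReal.ofReal (σ x ^ (-(N : ℝ) / 2)) ∂(sphMeasure N)
      ≤ ∫⁻ x in {x : Sph N | Real.exp (-ℓ) ≤ σ x},
        ∑ j ∈ Finset.range J, {x : Sph N | σ x ≤ Real.exp (-(j : ℝ) / 2) ^ 2}.indicator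
        (fun _ => ENNReal.ofReal (Real.exp ((j + 1) * N / 2))) x ∂(sphMeasure N) :=
        setLIntegral_mono' (measurableSet_sinSq_ge o _) hpt
    _ ≤ ∫⁻ x, ∑ j ∈ Finset.range J, {x : Sph N | σ x ≤ Real.exp (-(j : ℝ) / 2) ^ 2}.indicator
        (fun _ => ENNReal.ofReal (Real.exp ((j + 1) * N / 2))) x ∂(sphMeasure N) :=
        setLIntegral_le_lintegral _ _
    _ = ∑ j ∈ Finset.range J, ENNReal.ofReal (Real.exp ((j + 1) * N / 2)) *
        sphMeasure N {x : Sph N | σ x ≤ Real.exp (-(j : ℝ) / 2) ^ 2} := by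
        rw [lintegral_finsetSum _ fun j _ => measurable_const.indicator (hmeas j)]
        exact Finset.sum_congr rfl fun j _ => lintegral_indicator_const (hmeas j) _
    _ ≤ ∑ j ∈ Finset.range J, ENNReal.ofReal (Real.exp (N / 2) * C) := by
        refine Finset.sum_le_sum fun j _ => ?_
        refine (mul_le_mul_right (hcap o _ (Real.exp_pos _)) _).trans ?_
        rw [← ENNReal.ofReal_mul (Real.exp_pos _).le]
        apply ENNReal.ofReal_le_ofReal
        rw [← Real.exp_nat_mul, mul_left_comm, ← Real.exp_add, mul_comm C]
        apply le_of_eq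
        congr 2
        ring
    _ ≤ ENNReal.ofReal (Real.exp (N / 2) * C * (1 + ℓ)) := by
        rw [Finset.sum_const, Finset.card_range, ← ENNReal.ofReal_nsmul]
        apply ENNReal.ofReal_le_ofReal
        rw [nsmul_eq_mul, mul_comm]
        have h1 : ((J : ℕ) : ℝ) ≤ 1 + ℓ := by
          rw [hJ]; push_cast; linarith [Nat.floor_le hℓ]
        exact mul_le_mul_of_nonneg_left h1 (by positivity)

end CapMeasure

/-! ### The radial operator in the variable `s = sin² r`. -/

section ZonalSinSq

variable {N : ℕ}

theorem sphLaplacian_zonal_sinSq (o x : Sph N) {G G₁ : ℝ → ℝ} {G₂ : ℝ}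
    (hC : ContDiffAt ℝ 2 G (1 - (inner ℝ (o : Amb N) (x : Amb N)) ^ 2))
    (h₁ : ∀ᶠ s in 𝓝 (1 - (inner ℝ (o : Amb N) (x : Amb N)) ^ 2), HasDerivAt G (G₁ s) s)
    (h₂ : HasDerivAt G₁ G₂ (1 - (inner ℝ (o : Amb N) (x : Amb N)) ^ 2))
    {s : ℝ} (hs : s = 1 - (inner ℝ (o : Amb N) (x : Amb N)) ^ 2) :
    sphLaplacian (zonal o fun c => G (1 - c ^ 2)) x =
      4 * s * (1 - s) * G₂ + (2 * N * (1 - s) - 2 * s) * G₁ s := by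
  set c₀ : ℝ := inner ℝ (o : Amb N) (x : Amb N) with hc₀
  have hpoly : ∀ c : ℝ, HasDerivAt (fun c : ℝ => 1 - c ^ 2) (-2 * c) c := fun c => by
    simpa using ((hasDerivAt_id c).pow 2).const_sub 1
  have hcont : Tendsto (fun c : ℝ => 1 - c ^ 2) (𝓝 c₀) (𝓝 (1 - c₀ ^ 2)) :=
    (hpoly c₀).continuousAt
  have hΦ₁ : ∀ᶠ c in 𝓝 c₀, HasDerivAt (fun c => G (1 - c ^ 2)) (-2 * c * G₁ (1 - c ^ 2)) c := by
    filter_upwards [hcont.eventually h₁] with c hc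
    exact (hc.comp c (hpoly c)).congr_deriv (by ring)
  have hΦ₂ : HasDerivAt (fun c => -2 * c * G₁ (1 - c ^ 2))
      (4 * c₀ ^ 2 * G₂ - 2 * G₁ (1 - c₀ ^ 2)) c₀ := by
    have h := ((hasDerivAt_id c₀).const_mul (-2)).mul (h₂.comp c₀ (hpoly c₀))
    refine h.congr_deriv ?_
    simp
    ring
  have hCΦ : ContDiffAt ℝ 2 (fun c => G (1 - c ^ 2)) c₀ :=
    hC.comp c₀ (contDiffAt_const.sub (contDiffAt_id.pow 2))
  rw [sphLaplacian_zonal o x hCΦ hΦ₁ hΦ₂, ← hc₀, hs]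
  ring

/-- Converts smallness of `sin² r` into a condition on `δ`: beyond this angle the cosine is below
`-√(1 - s₁)`, so only the neighbourhood of the antipode remains. -/
theorem sinSq_mem_Ioo (o x : Sph N) {s₁ δ : ℝ} (hs₁ : s₁ ≤ 1)
    (hδ : Real.arccos (-√(1 - s₁)) < δ) (hδπ : δ < Real.pi) (hx : x ∈ OmegaBar o δ) :
    inner ℝ (o : Amb N) (x : Amb N) < 0 ∧
      1 - (inner ℝ (o : Amb N) (x : Amb N)) ^ 2 ∈ Ioo 0 s₁ := by
  have hδ0 : 0 ≤ δ := (Real.arccos_nonneg _).trans hδ.le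
  have h1 := (gdist_lt_pi_iff o x).mp hx.2
  have h2 := (le_gdist_iff o x hδ0 hδπ.le).mp hx.1
  have hle := (abs_le.mp (abs_inner_le_one o x)).2
  have h3 : Real.cos δ < -√(1 - s₁) := by
    by_contra! hcon
    have h5 := Real.arccos_le_arccos hcon
    rw [Real.arccos_cos hδ0 hδπ.le] at h5
    linarith
  set c : ℝ := inner ℝ (o : Amb N) (x : Amb N)
  have h4 : 0 ≤ √(1 - s₁) := Real.sqrt_nonneg _
  have h5 : √(1 - s₁) ^ 2 = 1 - s₁ := Real.sq_sqrt (by linarith)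
  refine ⟨by linarith, ?_, ?_⟩
  · nlinarith
  · nlinarith

theorem sin_gdist_rpow (o x : Sph N) (a : ℝ) :
    Real.sin (gdist o x) ^ a = (1 - (inner ℝ (o : Amb N) (x : Amb N)) ^ 2) ^ (a / 2) := by
  have h : 0 ≤ 1 - (inner ℝ (o : Amb N) (x : Amb N)) ^ 2 := by
    have := abs_inner_le_one o x
    rw [← sq_abs]
    nlinarith [abs_nonneg (inner ℝ (o : Amb N) (x : Amb N))]
  rw [sin_gdist, Real.sqrt_eq_rpow, ← Real.rpow_mul h]
  congr 1; ring

theorem sin_gdist_sq (o x : Sph N) :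
    Real.sin (gdist o x) ^ 2 = 1 - (inner ℝ (o : Amb N) (x : Amb N)) ^ 2 := by
  rw [Real.sin_sq, cos_gdist]

theorem omega_subset_omegaBar (o : Sph N) (δ : ℝ) : Omega o δ ⊆ OmegaBar o δ :=
  fun _ hx => ⟨hx.1.le, hx.2⟩

theorem sphLaplacian_const_mul (a : ℝ) (v : Sph N → ℝ) (x : Sph N)
    (hv : ContDiffAt ℝ 2 (homExt v) (x : Amb N)) :
    sphLaplacian (fun y => a * v y) x = a * sphLaplacian v x := by
  have h : homExt (fun y => a * v y) = a • homExt v := by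
    ext y
    simp only [homExt, Pi.smul_apply, smul_eq_mul]
    split_ifs <;> simp
  unfold sphLaplacian
  rw [h, InnerProductSpace.laplacian_smul a hv]
  simp

end ZonalSinSq

/-! ### Classical solutions from a stationary supersolution. -/

section Supersolution

variable {N : ℕ}

/-- The source is `ε f₀ / 2`. The surplus `2 f₀` of the supersolution, weakened by the time factor
to `ε f₀`, is shared equally between this source and the nonlinear term, and the time derivative is
nonnegative. -/
theorem exists_classicalSolution_of_profile {lam α p s₁ M : ℝ} (hp : 1 < p)
    {g G G₁ G₂ f₀ : ℝ → ℝ} (hs₁ : 0 < s₁) (hs₁' : s₁ ≤ 1)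
    (hg : IsProfile N lam α p g)
    (hgG : ∀ r, 0 ≤ Real.sin r → g r = G (Real.sin r ^ 2))
    (hG : ContDiffOn ℝ ∞ G (Ioo 0 s₁)) (hGpos : ∀ s ∈ Ioo 0 s₁, 0 < G s)
    (hf₀ : ContinuousOn f₀ (Ioo 0 s₁)) (hf₀pos : ∀ s ∈ Ioo 0 s₁, 0 < f₀ s)
    (hG₁ : ∀ s ∈ Ioo 0 s₁, HasDerivAt G (G₁ s) s)
    (hG₂ : ∀ s ∈ Ioo 0 s₁, HasDerivAt G₁ (G₂ s) s)
    (hsup : ∀ s ∈ Ioo 0 s₁, 2 * f₀ s ≤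
      -(4 * s * (1 - s) * G₂ s + (2 * N * (1 - s) - 2 * s) * G₁ s + lam / s * G s))
    (hM : 0 < M) (hGp : ∀ s ∈ Ioo 0 s₁, s ^ (α / 2) * G s ^ p ≤ M * f₀ s) :
    ∃ b : ℝ, 0 ≤ b ∧ b < Real.pi ∧ ∀ δ : ℝ, b < δ → δ < Real.pi → ∀ o : Sph N,
      ∃ (f : Sph N → ℝ) (u : ℝ × Sph N → ℝ),
        ContinuousOn f (OmegaBar o δ) ∧ (∀ x ∈ OmegaBar o δ, 0 < f x) ∧
        IsClassicalSolution o δ lam α p f u ∧ (∀ z ∈ Q o δ, 0 < u z) ∧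
        ∃ (ε : ℝ) (g : ℝ → ℝ), 0 < ε ∧ IsProfile N lam α p g ∧
          ∀ z ∈ Q o δ, u z = (1 - Real.exp (-z.1) / 2) * (ε * g (gdist o z.2)) := by
  refine ⟨Real.arccos (-√(1 - s₁)), Real.arccos_nonneg _, ?_, ?_⟩
  · refine lt_of_le_of_ne (Real.arccos_le_pi _) fun h => ?_
    rw [Real.arccos_eq_pi] at h
    have : √(1 - s₁) < 1 := by
      rw [Real.sqrt_lt' one_pos]; linarith
    linarith
  intro δ hδ hδπ o
  set σ : Sph N → ℝ := fun x => 1 - (inner ℝ (o : Amb N) (x : Amb N)) ^ 2 with hσ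
  have hσmem : ∀ x ∈ OmegaBar o δ, σ x ∈ Ioo 0 s₁ := fun x hx =>
    (sinSq_mem_Ioo o x hs₁' hδ hδπ hx).2
  have hσc : Continuous σ := by simp only [hσ]; fun_prop
  have hgσ : ∀ x : Sph N, g (gdist o x) = G (σ x) := fun x => by
    rw [hgG _ (by rw [sin_gdist]; exact Real.sqrt_nonneg _), sin_gdist_sq]
  -- the amplitude
  obtain ⟨ε, hε, hεM⟩ : ∃ ε : ℝ, 0 < ε ∧ ε ^ (p - 1) * M ≤ 1 / 2 := by
    refine ⟨(1 / (2 * M)) ^ (1 / (p - 1)), by positivity, ?_⟩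
    rw [← Real.rpow_mul (by positivity), one_div_mul_cancel (by linarith), Real.rpow_one]
    apply le_of_eq; field_simp
  set u : ℝ × Sph N → ℝ := fun z => (1 - Real.exp (-z.1) / 2) * (ε * g (gdist o z.2)) with hu
  have hexp : ∀ t : ℝ, 0 < t → Real.exp (-t) < 1 := fun t ht => by
    rw [Real.exp_lt_one_iff]; linarith
  have huslice : ∀ t, slice u t =
      fun x => ((1 - Real.exp (-t) / 2) * ε) * zonal o (fun c => G (1 - c ^ 2)) x := by
    intro t; ext x
    simp only [slice, hu, hgσ, zonal, hσ]; ring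
  have hcd : ∀ s ∈ Ioo 0 s₁, ContDiffAt ℝ ∞ G s := fun s hs =>
    hG.contDiffAt (isOpen_Ioo.mem_nhds hs)
  refine ⟨fun x => ε / 2 * f₀ (σ x), u, ?_, ?_, ⟨?_, ?_, ?_, ?_⟩, ?_,
    ε, g, hε, hg, fun z _ => rfl⟩
  · exact continuousOn_const.mul (hf₀.comp hσc.continuousOn hσmem)
  · intro x hx
    have := hf₀pos _ (hσmem x hx)
    positivity
  · intro z hz
    apply ContMDiffAt.contMDiffWithinAt
    have hz2 := hσmem z.2 (omega_subset_omegaBar o δ hz.2)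
    have hu' : u = fun z => (1 - Real.exp (-z.1) / 2) • (ε * G (σ z.2)) := by
      ext z; simp [hu, hgσ]
    rw [hu']
    have hinner : ContMDiff (𝓡 N) 𝓘(ℝ, ℝ) ∞ σ := by
      have h1 : ContMDiff (𝓡 N) 𝓘(ℝ, Amb N) ∞ ((↑) : Sph N → Amb N) := contMDiff_coe_sphere
      have h2 : ContDiff ℝ ∞ (fun y : Amb N => 1 - (inner ℝ (o : Amb N) y) ^ 2) :=
        contDiff_const.sub ((contDiff_const.inner ℝ contDiff_id).pow 2)
      exact h2.contMDiff.comp h1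
    have h1 : ContMDiffAt (𝓘(ℝ, ℝ).prod (𝓡 N)) 𝓘(ℝ, ℝ) ∞
        (fun z : ℝ × Sph N => 1 - Real.exp (-z.1) / 2) z := by
      have h2 : ContDiff ℝ ∞ (fun t : ℝ => 1 - Real.exp (-t) / 2) := by fun_prop
      exact (h2.contMDiff.comp contMDiff_fst).contMDiffAt
    have h3 : ContMDiffAt (𝓘(ℝ, ℝ).prod (𝓡 N)) 𝓘(ℝ, ℝ) ∞
        (fun z : ℝ × Sph N => ε * G (σ z.2)) z := by
      have h4 : ContDiffAt ℝ ∞ (fun s => ε * G s) (σ z.2) := contDiffAt_const.mul (hcd _ hz2)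
      exact ContMDiffAt.comp (x := z) (g := fun s => ε * G s) (f := fun z : ℝ × Sph N => σ z.2)
        h4.contMDiffAt ((hinner.comp contMDiff_snd).contMDiffAt)
    exact h1.smul h3
  · have hu' : u = fun z => (1 - Real.exp (-z.1) / 2) * (ε * G (σ z.2)) := by
      ext z; simp [hu, hgσ]
    rw [hu']
    refine ContinuousOn.mul (by fun_prop) (continuousOn_const.mul ?_)
    exact hG.continuousOn.comp (hσc.comp continuous_snd).continuousOn fun z hz => hσmem _ hz.2
  · intro t ht x hx
    have hxm := hσmem x (omega_subset_omegaBar o δ hx)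
    have hlap : sphLaplacian (slice u t) x = ((1 - Real.exp (-t) / 2) * ε) *
        (4 * σ x * (1 - σ x) * G₂ (σ x) + (2 * N * (1 - σ x) - 2 * σ x) * G₁ (σ x)) := by
      have hC2 : ContDiffAt ℝ 2 G (σ x) := (hcd _ hxm).of_le (WithTop.coe_le_coe.mpr (le_top : (2 : ℕ∞) ≤ ⊤))
      rw [huslice, sphLaplacian_const_mul]
      · rw [sphLaplacian_zonal_sinSq o x hC2 ?_ (hG₂ _ hxm) rfl]
        filter_upwards [isOpen_Ioo.mem_nhds hxm] with s hs using hG₁ s hs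
      · refine contDiffAt_homExt_zonal o x ?_
        exact ContDiffAt.comp (g := G) _ hC2 (contDiffAt_const.sub (contDiffAt_id.pow 2))
    have htd : timeDeriv u (t, x) = Real.exp (-t) / 2 * (ε * G (σ x)) := by
      simp only [timeDeriv, hu, hgσ]
      have h1 : HasDerivAt (fun s : ℝ => (1 - Real.exp (-s) / 2) * (ε * G (σ x)))
          (Real.exp (-t) / 2 * (ε * G (σ x))) t := by
        have := ((((hasDerivAt_id t).neg.exp).div_const 2).const_sub 1).mul_const (ε * G (σ x))
        refine this.congr_deriv ?_
        simp
        ring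
      exact h1.deriv
    have hGx := hGpos _ hxm
    have hux : u (t, x) = ((1 - Real.exp (-t) / 2) * ε) * G (σ x) := by
      simp only [hu, hgσ]; ring
    have he := hexp t ht
    have he0 := Real.exp_pos (-t)
    -- The lower bound on the amplitude serves the linear part, the upper bound the nonlinear term.
    have hA1 : ε / 2 ≤ (1 - Real.exp (-t) / 2) * ε := by nlinarith
    have hA2 : (1 - Real.exp (-t) / 2) * ε ≤ ε := by nlinarith
    set A := (1 - Real.exp (-t) / 2) * ε with hA
    have hA0 : 0 < A := by linarith
    have habs : Real.sin (gdist o x) ^ α * |u (t, x)| ^ p ≤ ε / 2 * f₀ (σ x) := by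
      rw [hux, abs_of_pos (by positivity), sin_gdist_rpow, Real.mul_rpow hA0.le hGx.le]
      have h1 : A ^ p ≤ ε * ε ^ (p - 1) := by
        calc A ^ p ≤ ε ^ p := Real.rpow_le_rpow hA0.le hA2 (by linarith)
          _ = ε * ε ^ (p - 1) := by
            rw [Real.rpow_sub_one hε.ne']; field_simp
      have h2 := hGp _ hxm
      have hf := hf₀pos _ hxm
      calc σ x ^ (α / 2) * (A ^ p * G (σ x) ^ p)
          = A ^ p * (σ x ^ (α / 2) * G (σ x) ^ p) := by ring
        _ ≤ (ε * ε ^ (p - 1)) * (M * f₀ (σ x)) := by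
          refine mul_le_mul h1 h2 ?_ (by positivity)
          have := hxm.1
          positivity
        _ = ε * (ε ^ (p - 1) * M) * f₀ (σ x) := by ring
        _ ≤ ε * (1 / 2) * f₀ (σ x) := by gcongr
        _ = ε / 2 * f₀ (σ x) := by ring
    have hs := hsup _ hxm
    have hf := hf₀pos _ hxm
    rw [hlap, htd, hux, sin_gdist_sq] at *
    have h3 : A * (2 * f₀ (σ x)) ≤ A * -(4 * σ x * (1 - σ x) * G₂ (σ x) +
        (2 * N * (1 - σ x) - 2 * σ x) * G₁ (σ x) + lam / σ x * G (σ x)) :=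
      mul_le_mul_of_nonneg_left hs hA0.le
    have h4 : ε / 2 * (2 * f₀ (σ x)) ≤ A * (2 * f₀ (σ x)) :=
      mul_le_mul_of_nonneg_right hA1 (by positivity)
    have h5 : 0 ≤ Real.exp (-t) / 2 * (ε * G (σ x)) := by positivity
    simp only [hσ] at *
    linarith
  · intro t ht x hx
    have hx0 : 0 ≤ δ := (Real.arccos_nonneg _).trans hδ.le
    have hxm := hσmem x ⟨le_of_eq (Eq.symm hx), by rw [show gdist o x = δ from hx]; exact hδπ⟩
    have := hGpos _ hxm
    have he := hexp t ht
    simp only [hu, hgσ]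
    have : 0 < 1 - Real.exp (-t) / 2 := by linarith
    positivity
  · intro z hz
    have hxm := hσmem z.2 hz.2
    have := hGpos _ hxm
    have he := hexp z.1 hz.1
    simp only [hu, hgσ]
    have : 0 < 1 - Real.exp (-z.1) / 2 := by linarith
    positivity

end Supersolution

/-! ### The explicit profiles below and at the Hardy constant. -/

section Profiles

variable {N : ℕ} {lam : ℝ}

theorem lamN_root (hlam_le : lam ≤ lamStar N) :
    lamN N lam ^ 2 - ((N : ℝ) - 2) * lamN N lam + lam = 0 := by
  have h := Real.sq_sqrt (show 0 ≤ (((N : ℝ) - 2) / 2) ^ 2 - lam by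
    unfold lamStar at hlam_le; linarith)
  unfold lamN
  linear_combination h

theorem lamN_pos (hN : 3 ≤ N) (hlam_pos : 0 < lam) : 0 < lamN N lam := by
  have h3 : (3 : ℝ) ≤ N := by exact_mod_cast hN
  have : √((((N : ℝ) - 2) / 2) ^ 2 - lam) < ((N : ℝ) - 2) / 2 := by
    rw [Real.sqrt_lt' (by linarith)]; linarith
  unfold lamN; linarith

theorem lamN_le : lamN N lam ≤ ((N : ℝ) - 2) / 2 := by
  unfold lamN; linarith [Real.sqrt_nonneg ((((N : ℝ) - 2) / 2) ^ 2 - lam)]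

theorem lamN_lt (h : lam < lamStar N) : lamN N lam < ((N : ℝ) - 2) / 2 := by
  have : 0 < √((((N : ℝ) - 2) / 2) ^ 2 - lam) := Real.sqrt_pos.mpr (by unfold lamStar at h; linarith)
  unfold lamN; linarith

theorem lamN_eq (h : lam = lamStar N) : lamN N lam = ((N : ℝ) - 2) / 2 := by
  unfold lamN; rw [h, lamStar]; simp

theorem neg_div_lt_neg_lamN {α p : ℝ} (hm : 0 < lamN N lam) (hp : 1 < p)
    (hp' : p < 1 + (α + 2) / lamN N lam) : -(α + 2) / (p - 1) < -lamN N lam := by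
  rw [div_lt_iff₀ (by linarith)]
  have : p - 1 < (α + 2) / lamN N lam := by linarith
  rw [lt_div_iff₀ hm] at this
  linarith

/-- For a power `(sin r)^q` the leading coefficient of `-LG` is minus the indicial polynomial at
`q`, which is positive between the roots. The bound `q > -(α+2)/(p-1)` makes the nonlinear term of
lower order. -/
theorem exists_classicalSolution_of_lt (hN : 3 ≤ N) (hlam_pos : 0 < lam) (hlam : lam < lamStar N)
    {α p : ℝ} (hp : 1 < p) (hp' : p < 1 + (α + 2) / lamN N lam) :
    ∃ b : ℝ, 0 ≤ b ∧ b < Real.pi ∧ ∀ δ : ℝ, b < δ → δ < Real.pi → ∀ o : Sph N,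
      ∃ (f : Sph N → ℝ) (u : ℝ × Sph N → ℝ),
        ContinuousOn f (OmegaBar o δ) ∧ (∀ x ∈ OmegaBar o δ, 0 < f x) ∧
        IsClassicalSolution o δ lam α p f u ∧ (∀ z ∈ Q o δ, 0 < u z) ∧
        ∃ (ε : ℝ) (g : ℝ → ℝ), 0 < ε ∧ IsProfile N lam α p g ∧
          ∀ z ∈ Q o δ, u z = (1 - Real.exp (-z.1) / 2) * (ε * g (gdist o z.2)) := by
  have hm := lamN_pos hN hlam_pos
  have hroot := lamN_root hlam.le
  have hlt := lamN_lt hlam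
  set m := lamN N lam with hmdef
  obtain ⟨q, hq1, hq2⟩ := exists_between (show max (-((N : ℝ) - 2) + m) (-(α + 2) / (p - 1)) < -m
    from max_lt (by linarith) (neg_div_lt_neg_lamN hm hp hp'))
  have hq3 := (max_lt_iff.mp hq1).1
  have hq4 := (max_lt_iff.mp hq1).2
  rw [div_lt_iff₀ (by linarith)] at hq4
  -- The roots of the indicial polynomial are `-m` and `-(N-2) + m`.
  have hP : 0 < -(q ^ 2 + ((N : ℝ) - 2) * q + lam) := by nlinarith
  set P := -(q ^ 2 + ((N : ℝ) - 2) * q + lam) with hPdef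
  set K := |q ^ 2 + ((N : ℝ) - 1) * q| with hK
  have hK0 : 0 ≤ K := abs_nonneg _
  -- In fact `-LG = s^(q/2-1) (P + s (q² + (N-1) q))`. This `s₁` keeps the correction below `P/2` in
  -- size, whence the constant `P/4` in `f₀`.
  refine exists_classicalSolution_of_profile (s₁ := min 1 (P / (2 * (K + 1)))) (M := 4 / P) hp
    (g := fun r => Real.sin r ^ q) (G := fun s => s ^ (q / 2))
    (G₁ := fun s => q / 2 * s ^ (q / 2 - 1))
    (G₂ := fun s => q / 2 * ((q / 2 - 1) * s ^ (q / 2 - 1 - 1)))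
    (f₀ := fun s => P / 4 * s ^ (q / 2 - 1))
    (by positivity) (min_le_left _ _) (Or.inl ⟨hlam, q, hq1, hq2, fun _ => rfl⟩)
    ?_ ?_ ?_ ?_ ?_ ?_ ?_ ?_ (by positivity) ?_
  · intro r hr
    rw [← Real.rpow_natCast, ← Real.rpow_mul hr]
    congr 1; push_cast; ring
  · intro s hs
    exact (Real.contDiffAt_rpow_const_of_ne hs.1.ne').contDiffWithinAt
  · intro s hs; exact Real.rpow_pos_of_pos hs.1 _
  · intro s hs
    exact (continuousAt_const.mul
      (Real.continuousAt_rpow_const _ _ (Or.inl hs.1.ne'))).continuousWithinAt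
  · intro s hs
    have := Real.rpow_pos_of_pos hs.1 (q / 2 - 1)
    positivity
  · intro s hs; exact Real.hasDerivAt_rpow_const (Or.inl hs.1.ne')
  · intro s hs; exact (Real.hasDerivAt_rpow_const (Or.inl hs.1.ne')).const_mul _
  · intro s hs
    have hs0 : 0 < s := hs.1
    have hs2 : s * (K + 1) < P / 2 := by
      have := hs.2.trans_le (min_le_right _ _)
      rw [lt_div_iff₀ (by positivity)] at this
      linarith
    have e1 : s ^ (q / 2) = s * s ^ (q / 2 - 1) := by
      rw [Real.rpow_sub_one hs0.ne']; field_simp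
    have e2 : s ^ (q / 2 - 1 - 1) = s⁻¹ * s ^ (q / 2 - 1) := by
      rw [Real.rpow_sub_one hs0.ne' (q / 2 - 1)]; field_simp
    have hX := Real.rpow_pos_of_pos hs0 (q / 2 - 1)
    simp only [e1, e2]
    set X := s ^ (q / 2 - 1)
    have e3 : -(4 * s * (1 - s) * (q / 2 * ((q / 2 - 1) * (s⁻¹ * X))) +
        (2 * N * (1 - s) - 2 * s) * (q / 2 * X) + lam / s * (s * X)) =
        X * (P + s * (q ^ 2 + ((N : ℝ) - 1) * q)) := by
      rw [hPdef]; field_simp; ring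
    rw [e3]
    have h4 : -(P / 2) ≤ s * (q ^ 2 + ((N : ℝ) - 1) * q) := by
      have := neg_abs_le (q ^ 2 + ((N : ℝ) - 1) * q)
      rw [← hK] at this
      nlinarith
    nlinarith
  · intro s hs
    have hs0 : 0 < s := hs.1
    have hs1 : s ≤ 1 := hs.2.le.trans (min_le_left _ _)
    rw [← Real.rpow_mul hs0.le, ← Real.rpow_add hs0]
    have : 4 / P * (P / 4 * s ^ (q / 2 - 1)) = s ^ (q / 2 - 1) := by field_simp
    rw [this]
    apply Real.rpow_le_rpow_of_exponent_ge hs0 hs1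
    linarith

theorem tendsto_rpow_mul_neg_log_rpow {a : ℝ} (ha : 0 < a) (κ : ℝ) :
    Tendsto (fun s : ℝ => s ^ a * (-(1 / 2) * Real.log s) ^ κ) (𝓝[>] 0) (𝓝 0) := by
  have h1 : Tendsto (fun x : ℝ => x ^ κ * Real.exp (-(2 * a) * x)) atTop (𝓝 0) :=
    tendsto_rpow_mul_exp_neg_mul_atTop_nhds_zero κ (2 * a) (by positivity)
  have h2 : Tendsto (fun s : ℝ => -(1 / 2) * Real.log s) (𝓝[>] 0) atTop := by
    have := Real.tendsto_log_nhdsGT_zero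
    exact this.const_mul_atBot_of_neg (by norm_num)
  refine (h1.comp h2).congr' ?_
  filter_upwards [self_mem_nhdsWithin] with s hs
  replace hs : 0 < s := hs
  simp only [Function.comp]
  rw [mul_comm, Real.rpow_def_of_pos hs]
  congr 2
  ring

theorem rpow_mul_mul_rpow {s l : ℝ} (hs : 0 < s) (hl : 0 < l) (a b c p d e : ℝ) :
    s ^ a * (s ^ b * l ^ c) ^ p =
      s ^ d * l ^ e * (s ^ (a + b * p - d) * l ^ (c * p - e)) := by
  have e1 : s ^ (a + b * p - d) = s ^ a * (s ^ b) ^ p / s ^ d := by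
    rw [Real.rpow_sub hs, Real.rpow_add hs, Real.rpow_mul hs.le]
  have e2 : l ^ (c * p - e) = (l ^ c) ^ p / l ^ e := by
    rw [Real.rpow_sub hl, Real.rpow_mul hl.le]
  have h1 := Real.rpow_pos_of_pos hs d
  have h2 := Real.rpow_pos_of_pos hl e
  rw [e1, e2, Real.mul_rpow (by positivity) (by positivity)]
  field_simp

set_option maxHeartbeats 400000 in
-- At a double indicial root a pure power leaves no surplus. A factor `(-ln sin r)^γ` produces one
-- of size `γ(1-γ) (-ln sin r)^(γ-2)` relative to `(sin r)^(-m-2)`; the choice is `γ = 1/2`. The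
-- nonlinear term is smaller by a positive power of `s`, which beats every power of the logarithm.
theorem exists_classicalSolution_of_eq (hN : 3 ≤ N) (hlam_pos : 0 < lam) (hlam : lam = lamStar N)
    {α p : ℝ} (hp : 1 < p) (hp' : p < 1 + (α + 2) / lamN N lam) :
    ∃ b : ℝ, 0 ≤ b ∧ b < Real.pi ∧ ∀ δ : ℝ, b < δ → δ < Real.pi → ∀ o : Sph N,
      ∃ (f : Sph N → ℝ) (u : ℝ × Sph N → ℝ),
        ContinuousOn f (OmegaBar o δ) ∧ (∀ x ∈ OmegaBar o δ, 0 < f x) ∧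
        IsClassicalSolution o δ lam α p f u ∧ (∀ z ∈ Q o δ, 0 < u z) ∧
        ∃ (ε : ℝ) (g : ℝ → ℝ), 0 < ε ∧ IsProfile N lam α p g ∧
          ∀ z ∈ Q o δ, u z = (1 - Real.exp (-z.1) / 2) * (ε * g (gdist o z.2)) := by
  have hm := lamN_pos hN hlam_pos
  have hroot := lamN_root hlam.le
  have hmeq := lamN_eq hlam
  have hpα := neg_div_lt_neg_lamN hm hp hp'
  set m := lamN N lam with hmdef
  have hN2 : (N : ℝ) = 2 * m + 2 := by linarith
  have hlam2 : lam = m ^ 2 := by rw [hN2] at hroot; linear_combination hroot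
  set ℓ : ℝ → ℝ := fun s => -(1 / 2) * Real.log s with hℓ
  rw [div_lt_iff₀ (by linarith)] at hpα
  have hlim1 := tendsto_rpow_mul_neg_log_rpow one_pos 2
  have hlim2 := tendsto_rpow_mul_neg_log_rpow
    (show 0 < α / 2 + -m / 2 * p - (-m / 2 - 1) by linarith) (1 / 2 * p - (1 / 2 - 2))
  obtain ⟨s₀, hs₀, hs₀'⟩ : ∃ s₀ > 0, ∀ s ∈ Ioo 0 s₀, s ^ (1 : ℝ) * ℓ s ^ (2 : ℝ) <
        1 / (16 * (2 + m * (m + 1))) ∧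
      s ^ (α / 2 + -m / 2 * p - (-m / 2 - 1)) * ℓ s ^ (1 / 2 * p - (1 / 2 - 2)) < 1 := by
    have := (hlim1.eventually (gt_mem_nhds
      (show (0 : ℝ) < 1 / (16 * (2 + m * (m + 1))) by positivity))).and
      (hlim2.eventually (gt_mem_nhds one_pos))
    obtain ⟨s₀, h0, h1⟩ := mem_nhdsGT_iff_exists_Ioo_subset.mp this
    exact ⟨s₀, h0, fun s hs => h1 hs⟩
  have hℓd : ∀ s, 0 < s → HasDerivAt ℓ (-(1 / 2) * s⁻¹) s := fun s hs =>
    (Real.hasDerivAt_log hs.ne').const_mul _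
  -- The bound `e^(-2)` is exactly where `ℓ = 1`, and it lies below `1/4`.
  have hsmall : ∀ s, s ∈ Ioo 0 (min s₀ (Real.exp (-2))) → 0 < s ∧ s < s₀ ∧ s < 1 / 4 ∧ 1 ≤ ℓ s := by
    intro s hs
    have h2 : s < Real.exp (-2) := hs.2.trans_le (min_le_right _ _)
    refine ⟨hs.1, hs.2.trans_le (min_le_left _ _), h2.trans ?_, ?_⟩
    · rw [show (-2 : ℝ) = -(1 + 1) by norm_num, Real.exp_neg, Real.exp_add]
      have := Real.exp_one_gt_d9
      rw [inv_lt_comm₀ (by positivity) (by norm_num)]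
      nlinarith
    · have := Real.log_lt_log hs.1 h2
      rw [Real.log_exp] at this
      simp only [hℓ]; linarith
  refine exists_classicalSolution_of_profile (s₁ := min s₀ (Real.exp (-2))) (M := 16) hp
    (g := fun r => Real.sin r ^ (-m) * (-Real.log (Real.sin r)) ^ (1 / 2 : ℝ))
    (G := fun s => s ^ (-m / 2) * ℓ s ^ (1 / 2 : ℝ))
    (G₁ := fun s => s ^ (-m / 2 - 1) *
      (-m / 2 * ℓ s ^ (1 / 2 : ℝ) - 1 / 4 * ℓ s ^ (1 / 2 - 1 : ℝ)))
    (G₂ := fun s => s ^ (-m / 2 - 1 - 1) * (-m / 2 * (-m / 2 - 1) * ℓ s ^ (1 / 2 : ℝ)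
      - 1 / 4 * (-m - 1) * ℓ s ^ (1 / 2 - 1 : ℝ) - 1 / 16 * ℓ s ^ (1 / 2 - 1 - 1 : ℝ)))
    (f₀ := fun s => 1 / 16 * (s ^ (-m / 2 - 1) * ℓ s ^ (1 / 2 - 2 : ℝ)))
    (lt_min hs₀ (Real.exp_pos _)) ((min_le_right _ _).trans (by simp))
    (Or.inr ⟨hlam, 1 / 2, by norm_num, by norm_num, fun _ => rfl⟩)
    ?_ ?_ ?_ ?_ ?_ ?_ ?_ ?_ (by positivity) ?_
  · intro r hr
    rw [← Real.rpow_natCast, ← Real.rpow_mul hr]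
    simp only [hℓ]
    congr 2
    · push_cast; ring
    · rw [Real.rpow_natCast, Real.log_pow]; push_cast; ring
  · intro s hs
    obtain ⟨h0, -, -, h1⟩ := hsmall s hs
    have hc : ContDiffAt ℝ ∞ ℓ s := contDiffAt_const.mul (Real.contDiffAt_log.mpr h0.ne')
    exact ((Real.contDiffAt_rpow_const_of_ne h0.ne').mul
      (hc.rpow_const_of_ne (by linarith))).contDiffWithinAt
  · intro s hs
    obtain ⟨h0, -, -, h1⟩ := hsmall s hs
    have : 0 < ℓ s := by linarith
    positivity
  · intro s hs
    obtain ⟨h0, -, -, h1⟩ := hsmall s hs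
    have hc : ContinuousAt ℓ s := (hℓd s h0).continuousAt
    exact (continuousAt_const.mul ((Real.continuousAt_rpow_const _ _ (Or.inl h0.ne')).mul
      (hc.rpow_const (Or.inl (by linarith))))).continuousWithinAt
  · intro s hs
    obtain ⟨h0, -, -, h1⟩ := hsmall s hs
    have : 0 < ℓ s := by linarith
    positivity
  · intro s hs
    obtain ⟨h0, -, -, h1⟩ := hsmall s hs
    have h2 := (Real.hasDerivAt_rpow_const (p := -m / 2) (Or.inl h0.ne')).mul
      ((hℓd s h0).rpow_const (p := 1 / 2) (Or.inl (by linarith)))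
    refine h2.congr_deriv ?_
    have e1 : s ^ (-m / 2) = s * s ^ (-m / 2 - 1) := by
      rw [Real.rpow_sub_one h0.ne']; field_simp
    rw [e1]
    field_simp
    ring
  · intro s hs
    obtain ⟨h0, -, -, h1⟩ := hsmall s hs
    have hl := hℓd s h0
    have h2 := (Real.hasDerivAt_rpow_const (p := -m / 2 - 1) (Or.inl h0.ne')).mul
      (((hl.rpow_const (p := 1 / 2) (Or.inl (by linarith))).const_mul (-m / 2)).sub
        ((hl.rpow_const (p := 1 / 2 - 1) (Or.inl (by linarith))).const_mul (1 / 4)))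
    refine h2.congr_deriv ?_
    have e1 : s ^ (-m / 2 - 1) = s * s ^ (-m / 2 - 1 - 1) := by
      rw [Real.rpow_sub_one h0.ne' (-m / 2 - 1)]; field_simp
    simp only [e1, Pi.sub_apply]
    field_simp
    ring
  · intro s hs
    obtain ⟨h0, h2, h4, h1⟩ := hsmall s hs
    have hl0 : 0 < ℓ s := by linarith
    have h5 := (hs₀' s ⟨h0, h2⟩).1
    rw [Real.rpow_one, Real.rpow_two, lt_div_iff₀ (by positivity)] at h5
    have e1 : s ^ (-m / 2) = s ^ 2 * s ^ (-m / 2 - 2) := by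
      rw [← Real.rpow_natCast s 2, ← Real.rpow_add h0]; congr 1; push_cast; ring
    have e2 : s ^ (-m / 2 - 1) = s * s ^ (-m / 2 - 2) := by
      nth_rewrite 2 [← Real.rpow_one s]
      rw [← Real.rpow_add h0]; congr 1; ring
    have e3 : s ^ (-m / 2 - 1 - 1) = s ^ (-m / 2 - 2) := by congr 1; ring
    have f1 : ℓ s ^ (1 / 2 : ℝ) = ℓ s ^ 2 * ℓ s ^ (1 / 2 - 2 : ℝ) := by
      rw [← Real.rpow_natCast _ 2, ← Real.rpow_add hl0]; congr 1; push_cast; ring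
    have f2 : ℓ s ^ (1 / 2 - 1 : ℝ) = ℓ s * ℓ s ^ (1 / 2 - 2 : ℝ) := by
      nth_rewrite 2 [← Real.rpow_one (ℓ s)]
      rw [← Real.rpow_add hl0]; congr 1; ring
    have f3 : ℓ s ^ (1 / 2 - 1 - 1 : ℝ) = ℓ s ^ (1 / 2 - 2 : ℝ) := by congr 1; ring
    simp only [e1, e2, e3, f1, f2, f3]
    have hX := Real.rpow_pos_of_pos h0 (-m / 2 - 2)
    have hY := Real.rpow_pos_of_pos hl0 (1 / 2 - 2)
    set X := s ^ (-m / 2 - 2)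
    set Y := ℓ s ^ (1 / 2 - 2 : ℝ)
    set l := ℓ s
    -- The terms without a spare factor `s` in `l²` and `l` cancel because the root is double. What
    -- survives is `γ(1-γ) = 1/4`; for these `s` the bracket is at least `3/16 - 1/16 = 1/8`.
    have e4 : -(4 * s * (1 - s) * (X * (-m / 2 * (-m / 2 - 1) * (l ^ 2 * Y)
          - 1 / 4 * (-m - 1) * (l * Y) - 1 / 16 * Y)) +
        (2 * N * (1 - s) - 2 * s) * (s * X * (-m / 2 * (l ^ 2 * Y) - 1 / 4 * (l * Y))) +
        lam / s * (s ^ 2 * X * (l ^ 2 * Y))) =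
        s * X * Y * (1 / 4 * (1 - s) - s * (1 / 2 * l + m * (m + 1) * l ^ 2)) := by
      rw [hN2, hlam2]; field_simp; ring
    rw [e4]
    have h6 : s * (1 / 2 * l + m * (m + 1) * l ^ 2) ≤ 1 / 16 := by
      have : s * l ≤ s * l ^ 2 := by
        apply mul_le_mul_of_nonneg_left _ h0.le; nlinarith
      have : 0 ≤ s * l ^ 2 * (m * (m + 1)) := by positivity
      nlinarith
    have h7 : 1 / 8 ≤ 1 / 4 * (1 - s) - s * (1 / 2 * l + m * (m + 1) * l ^ 2) := by linarith
    have h8 : 0 < s * X * Y := by positivity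
    nlinarith
  · intro s hs
    obtain ⟨h0, h2, -, h1⟩ := hsmall s hs
    have hl0 : 0 < ℓ s := by linarith
    have h5 := (hs₀' s ⟨h0, h2⟩).2
    have e1 := rpow_mul_mul_rpow h0 hl0 (α / 2) (-m / 2) (1 / 2) p (-m / 2 - 1) (1 / 2 - 2)
    rw [e1]
    have hX := Real.rpow_pos_of_pos h0 (-m / 2 - 1)
    have hY := Real.rpow_pos_of_pos hl0 (1 / 2 - 2)
    have h6 := mul_le_mul_of_nonneg_left h5.le (mul_pos hX hY).le
    linarith

end Profiles

/-! ### Power series and the Frobenius solution at the pole. -/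

section PowerSeriesODE

theorem contDiffOn_succ_of_hasDerivAt {f f' : ℝ → ℝ} {s : Set ℝ} (hs : IsOpen s) {n : ℕ}
    (h : ∀ x ∈ s, HasDerivAt f (f' x) x) (h' : ContDiffOn ℝ n f' s) :
    ContDiffOn ℝ (n + 1 : ℕ) f s := by
  have := (contDiffOn_succ_iff_deriv_of_isOpen (𝕜 := ℝ) (n := (n : WithTop ℕ∞)) hs).mpr
    ⟨fun x hx => (h x hx).differentiableAt.differentiableWithinAt, by simp,
      h'.congr fun x hx => (h x hx).deriv⟩
  exact_mod_cast this

variable {a : ℕ → ℝ} {C K : ℝ}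

/-- The coefficients of the termwise derivative of a power series. -/
def derivCoeff (a : ℕ → ℝ) (n : ℕ) : ℝ := (n + 1) * a (n + 1)

/-- Since `n + 1 ≤ 2 ^ n`, one termwise derivative costs only a factor two in the geometric ratio.
-/
theorem abs_derivCoeff_le (ha : ∀ n, |a n| ≤ C * K ^ n) (n : ℕ) :
    |derivCoeff a n| ≤ (C * K) * (2 * K) ^ n := by
  have h1 : ((n : ℝ) + 1) ≤ 2 ^ n := by
    exact_mod_cast Nat.lt_two_pow_self
  rw [derivCoeff, abs_mul, abs_of_nonneg (by positivity : (0 : ℝ) ≤ n + 1)]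
  calc ((n : ℝ) + 1) * |a (n + 1)| ≤ 2 ^ n * (C * K ^ (n + 1)) := by
        gcongr
        exact ha _
    _ = (C * K) * (2 * K) ^ n := by rw [mul_pow]; ring

theorem summable_coeff_mul_pow (hK : 0 < K) (ha : ∀ n, |a n| ≤ C * K ^ n) {s : ℝ}
    (hs : |s| < 1 / K) : Summable fun n => a n * s ^ n := by
  have hr : K * |s| < 1 := by rw [lt_div_iff₀ hK] at hs; linarith
  refine Summable.of_norm_bounded
    ((summable_geometric_of_lt_one (by positivity) hr).mul_left C) fun n => ?_
  rw [Real.norm_eq_abs, abs_mul, abs_pow, mul_pow, ← mul_assoc]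
  exact mul_le_mul_of_nonneg_right (ha n) (by positivity)

theorem abs_coeff_mul_deriv_pow_le (hC : 0 ≤ C) (hK : 0 < K) (ha : ∀ n, |a n| ≤ C * K ^ n)
    (n : ℕ) {y : ℝ} (hy : |y| < 1 / (2 * K)) :
    |a n * (n * y ^ (n - 1))| ≤ C * (2 * K) * ((n : ℝ) ^ 1 * (1 / 2) ^ n) := by
  cases n with
  | zero => simp
  | succ k =>
    rw [abs_mul, abs_mul, abs_pow, Nat.abs_cast, Nat.add_sub_cancel, pow_one]
    have h1 : |y| ^ k ≤ (1 / (2 * K)) ^ k := pow_le_pow_left₀ (abs_nonneg y) hy.le k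
    have h2 : (1 / (2 * K)) ^ k * K ^ k = (1 / 2) ^ k := by
      rw [← mul_pow]; congr 1; field_simp
    calc |a (k + 1)| * (((k + 1 : ℕ) : ℝ) * |y| ^ k)
        ≤ (C * K ^ (k + 1)) * (((k + 1 : ℕ) : ℝ) * (1 / (2 * K)) ^ k) :=
          mul_le_mul (ha _) (mul_le_mul_of_nonneg_left h1 (Nat.cast_nonneg _))
            (by positivity) (by positivity)
      _ = C * K * (((k + 1 : ℕ) : ℝ) * ((1 / (2 * K)) ^ k * K ^ k)) := by rw [pow_succ]; ring
      _ = C * (2 * K) * (((k + 1 : ℕ) : ℝ) * (1 / 2) ^ (k + 1)) := by rw [h2, pow_succ]; ring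

/-- On half the disc the differentiated terms are dominated by a multiple of `n 2^(-n)`, which
justifies differentiating under the sum. -/
theorem hasDerivAt_tsum_coeff_mul_pow (hC : 0 ≤ C) (hK : 0 < K) (ha : ∀ n, |a n| ≤ C * K ^ n)
    {s : ℝ} (hs : |s| < 1 / (2 * K)) :
    HasDerivAt (fun s => ∑' n, a n * s ^ n) (∑' n, derivCoeff a n * s ^ n) s := by
  have hr0 : 0 < 1 / (2 * K) := by positivity
  have hu : Summable fun n : ℕ => C * (2 * K) * ((n : ℝ) ^ 1 * (1 / 2) ^ n) := by
    have h2 : ‖(1 / 2 : ℝ)‖ < 1 := by norm_num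
    exact (summable_pow_mul_geometric_of_norm_lt_one 1 h2).mul_left (C * (2 * K))
  have hderiv : ∀ (n : ℕ) (y : ℝ), y ∈ Metric.ball (0 : ℝ) (1 / (2 * K)) →
      HasDerivAt (fun y => a n * y ^ n) (a n * (n * y ^ (n - 1))) y :=
    fun n y _ => (hasDerivAt_pow n y).const_mul (a n)
  have hzero : Summable fun n => a n * (0 : ℝ) ^ n :=
    summable_coeff_mul_pow hK ha (by simpa using hK)
  have hsum : Summable fun n : ℕ => a n * (n * s ^ (n - 1)) := by
    rw [← summable_nat_add_iff 1]
    have := summable_coeff_mul_pow (by positivity) (abs_derivCoeff_le ha) hs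
    refine this.congr fun n => ?_
    simp only [derivCoeff, Nat.add_sub_cancel]; push_cast; ring
  have heq : ∑' n, derivCoeff a n * s ^ n = ∑' n : ℕ, a n * (n * s ^ (n - 1)) := by
    rw [hsum.tsum_eq_zero_add]
    simp only [CharP.cast_eq_zero, zero_mul, mul_zero, zero_add]
    refine tsum_congr fun n => ?_
    simp only [derivCoeff, Nat.add_sub_cancel]; push_cast; ring
  rw [heq]
  refine hasDerivAt_tsum_of_isPreconnected (g := fun n (y : ℝ) => a n * y ^ n)
    (g' := fun n y => a n * (n * y ^ (n - 1))) hu Metric.isOpen_ball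
    (convex_ball (0 : ℝ) (1 / (2 * K))).isPreconnected hderiv (fun n y hy => ?_)
    (Metric.mem_ball_self hr0) hzero (by simpa using hs)
  exact abs_coeff_mul_deriv_pow_le hC hK ha n (by simpa using hy)

theorem hasSum_shift {A s : ℝ} {b : ℕ → ℝ} (h : HasSum (fun n => a n * s ^ n) A) (h0 : b 0 = 0)
    (hb : ∀ n, b (n + 1) = a n) : HasSum (fun n => b n * s ^ n) (s * A) := by
  rw [← hasSum_nat_add_iff' 1]
  simp only [Finset.range_one, Finset.sum_singleton, h0, zero_mul, sub_zero]
  refine (h.mul_left s).congr_fun fun n => ?_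
  rw [hb]; ring

/-- The coefficients of the Frobenius series at the singular point `sin = 0`, with exponent
`sin^{-m}`. -/
def frobeniusCoeff (m d : ℝ) : ℕ → ℝ
  | 0 => 1
  | n + 1 => frobeniusCoeff m d n * ((2 * n - m) * (2 * n - m + d - 1)) /
      ((2 * n + 2) * (2 * n + d - 2 * m))

variable {m d lam : ℝ}

/-- The hypothesis gives `2n + d - 2m ≥ 2n + 2`: there is no resonance at this exponent, even at a
double root, and the ratio of consecutive coefficients is bounded. -/
theorem abs_frobeniusCoeff_le (hm : 0 ≤ m) (hmd : 2 * m ≤ d - 2) (n : ℕ) :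
    |frobeniusCoeff m d n| ≤ 1 * ((1 + m) * (1 + m + d)) ^ n := by
  induction n with
  | zero => simp [frobeniusCoeff]
  | succ n ih =>
    have hn : (0 : ℝ) ≤ n := Nat.cast_nonneg n
    have hd : 0 ≤ d := by linarith
    have hden : 0 < (2 * (n : ℝ) + 2) * (2 * n + d - 2 * m) :=
      mul_pos (by linarith) (by linarith)
    rw [frobeniusCoeff, abs_div, abs_mul, abs_of_pos hden, div_le_iff₀ hden]
    have h1 : |2 * (n : ℝ) - m| ≤ (1 + m) * (2 * n + 2) := by
      rw [abs_le]; constructor <;> nlinarith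
    have h2 : |2 * (n : ℝ) - m + d - 1| ≤ (1 + m + d) * (2 * n + d - 2 * m) := by
      have h3 : 2 * (n : ℝ) + 2 ≤ 2 * n + d - 2 * m := by linarith
      have h4 : (1 + m + d) * (2 * (n : ℝ) + 2) ≤ (1 + m + d) * (2 * n + d - 2 * m) := by gcongr
      refine le_trans ?_ h4
      rw [abs_le]; constructor <;> nlinarith
    rw [abs_mul]
    calc |frobeniusCoeff m d n| * (|2 * (n : ℝ) - m| * |2 * (n : ℝ) - m + d - 1|)
        ≤ (1 * ((1 + m) * (1 + m + d)) ^ n) *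
          (((1 + m) * (2 * n + 2)) * ((1 + m + d) * (2 * n + d - 2 * m))) := by gcongr
      _ = _ := by ring

/-- Existence of the less singular solution of the radial equation near the pole. -/
theorem exists_frobenius_solution (hm : 0 ≤ m) (hmd : 2 * m ≤ d - 2)
    (hroot : m ^ 2 - (d - 2) * m + lam = 0) :
    ∃ s₁ : ℝ, 0 < s₁ ∧ s₁ < 1 ∧ ∃ G G₁ G₂ : ℝ → ℝ, ContDiffOn ℝ 2 G (Ioo 0 s₁) ∧
      ∀ s ∈ Ioo 0 s₁, HasDerivAt G (G₁ s) s ∧ HasDerivAt G₁ (G₂ s) s ∧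
        4 * s * (1 - s) * G₂ s + (2 * d * (1 - s) - 2 * s) * G₁ s + lam / s * G s = 0 ∧
        s ^ (-m / 2) / 2 ≤ G s ∧ G s ≤ 2 * s ^ (-m / 2) := by
  set a := frobeniusCoeff m d with ha_def
  set K := (1 + m) * (1 + m + d) with hK_def
  have hK : 0 < K := by have : 0 ≤ d := by linarith
                        positivity
  have ha : ∀ n, |a n| ≤ 1 * K ^ n := abs_frobeniusCoeff_le hm hmd
  have ha1 := abs_derivCoeff_le ha
  have ha2 := abs_derivCoeff_le ha1
  set F : ℝ → ℝ := fun s => ∑' n, a n * s ^ n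
  set F₁ : ℝ → ℝ := fun s => ∑' n, derivCoeff a n * s ^ n
  set F₂ : ℝ → ℝ := fun s => ∑' n, derivCoeff (derivCoeff a) n * s ^ n
  -- Each differentiation halves the disc. The derivative of `F₂` is needed only for the continuity
  -- of `F₂`.
  set ρ := 1 / (2 * (2 * (2 * K))) with hρ
  have hρ0 : 0 < ρ := by positivity
  have hρ2 : ρ ≤ 1 / (2 * (2 * K)) := by rw [hρ]; gcongr; linarith
  have hρ1 : ρ ≤ 1 / (2 * K) := hρ2.trans (by gcongr; linarith)
  have hρK : ρ ≤ 1 / K := hρ1.trans (by gcongr; linarith)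
  have hF : ∀ s, |s| < ρ → HasDerivAt F (F₁ s) s := fun s hs =>
    hasDerivAt_tsum_coeff_mul_pow zero_le_one hK ha (hs.trans_le hρ1)
  have hF₁ : ∀ s, |s| < ρ → HasDerivAt F₁ (F₂ s) s := fun s hs =>
    hasDerivAt_tsum_coeff_mul_pow (by positivity) (by positivity) ha1 (hs.trans_le hρ2)
  have hF₂ : ∀ s, |s| < ρ → HasDerivAt F₂ _ s := fun s hs =>
    hasDerivAt_tsum_coeff_mul_pow (by positivity) (by positivity) ha2 hs
  have hF0 : F 0 = 1 := by
    have : F 0 = a 0 := by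
      simp only [F]
      rw [tsum_eq_single 0 fun n hn => by simp [hn]]
      simp
    rw [this]; simp [ha_def, frobeniusCoeff]
  -- The equation left for `F` once `s^(-m/2)` is divided out; its `1/s` term disappears by the
  -- indicial equation. Comparing coefficients gives the recurrence.
  have hFODE : ∀ s, |s| < ρ → 4 * s * (1 - s) * F₂ s
      + ((-4 * m + 2 * d) * (1 - s) - 2 * s) * F₁ s - (m ^ 2 + m - d * m) * F s = 0 := by
    intro s hs
    have h0 : HasSum (fun n => a n * s ^ n) (F s) :=
      (summable_coeff_mul_pow hK ha (hs.trans_le hρK)).hasSum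
    have h1 : HasSum (fun n => derivCoeff a n * s ^ n) (F₁ s) :=
      (summable_coeff_mul_pow (by positivity) ha1 (hs.trans_le hρ1)).hasSum
    have h2 : HasSum (fun n => derivCoeff (derivCoeff a) n * s ^ n) (F₂ s) :=
      (summable_coeff_mul_pow (by positivity) ha2 (hs.trans_le hρ2)).hasSum
    have h3 := hasSum_shift (b := fun n => n * a n) h1 (by simp) (fun n => by simp [derivCoeff])
    have h4 := hasSum_shift (b := fun n => n * derivCoeff a n) h2 (by simp)
      (fun n => by simp [derivCoeff])
    have h5 := hasSum_shift (b := fun n => (n - 1) * (n * a n)) h4 (by simp)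
      (fun n => by simp [derivCoeff])
    have h6 := ((h4.mul_left 4).sub (h5.mul_left 4)).add
      (((h1.mul_left (-4 * m + 2 * d)).sub (h3.mul_left (-4 * m + 2 * d + 2))).sub
        (h0.mul_left (m ^ 2 + m - d * m)))
    have h7 := h6.unique (by
      refine (hasSum_zero (α := ℝ) (β := ℕ)).congr_fun fun n => ?_
      have hden : (2 * (n : ℝ) + 2) * (2 * n + d - 2 * m) ≠ 0 := by
        have hn : (0 : ℝ) ≤ n := Nat.cast_nonneg n
        exact (mul_pos (by linarith) (by linarith)).ne'
      have hrec : a (n + 1) * ((2 * n + 2) * (2 * n + d - 2 * m)) =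
          a n * ((2 * n - m) * (2 * n - m + d - 1)) := by
        rw [ha_def, frobeniusCoeff, div_mul_cancel₀ _ hden]
      simp only [derivCoeff]
      linear_combination (s ^ n) * hrec)
    linear_combination h7
  have hcont : ContinuousAt F 0 := (hF 0 (by simpa using hρ0)).continuousAt
  -- As `F 0 = 1`, staying within `1/2` of it yields the two-sided bounds on `G`.
  obtain ⟨ε, hε, hεF⟩ := Metric.continuousAt_iff.mp hcont (1 / 2) (by norm_num)
  refine ⟨min (1 / 2) (min ρ ε), by positivity,
    (min_le_left _ _).trans_lt (by norm_num), fun s => s ^ (-m / 2) * F s,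
    fun s => s ^ (-m / 2 - 1) * (-m / 2 * F s + s * F₁ s),
    fun s => s ^ (-m / 2 - 2) * (-m / 2 * (-m / 2 - 1) * F s - m * (s * F₁ s) + s ^ 2 * F₂ s),
    ?_, fun s hs => ?_⟩
  · have hsub : ∀ s ∈ Ioo 0 (min (1 / 2) (min ρ ε)), |s| < ρ := fun s hs => by
      rw [abs_of_pos hs.1]
      exact hs.2.trans_le ((min_le_right _ _).trans (min_le_left _ _))
    refine ContDiffOn.mul (fun s hs =>
      (Real.contDiffAt_rpow_const_of_ne hs.1.ne').contDiffWithinAt) ?_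
    have c0 : ContDiffOn ℝ (0 : ℕ) F₂ (Ioo 0 (min (1 / 2) (min ρ ε))) := by
      have : ContinuousOn F₂ (Ioo 0 (min (1 / 2) (min ρ ε))) := fun s hs =>
        (hF₂ s (hsub s hs)).continuousAt.continuousWithinAt
      exact_mod_cast contDiffOn_zero.mpr this
    exact contDiffOn_succ_of_hasDerivAt isOpen_Ioo (fun s hs => hF s (hsub s hs))
      (contDiffOn_succ_of_hasDerivAt isOpen_Ioo (fun s hs => hF₁ s (hsub s hs)) c0)
  · have hs0 : 0 < s := hs.1
    have hsρ : |s| < ρ := by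
      rw [abs_of_pos hs0]
      exact hs.2.trans_le ((min_le_right _ _).trans (min_le_left _ _))
    have hsε : |s| < ε := by
      rw [abs_of_pos hs0]
      exact hs.2.trans_le ((min_le_right _ _).trans (min_le_right _ _))
    have e1 : s ^ (-m / 2) = s ^ 2 * s ^ (-m / 2 - 2) := by
      rw [← Real.rpow_natCast s 2, ← Real.rpow_add hs0]; congr 1; push_cast; ring
    have e2 : s ^ (-m / 2 - 1) = s * s ^ (-m / 2 - 2) := by
      nth_rewrite 2 [← Real.rpow_one s]
      rw [← Real.rpow_add hs0]; congr 1; ring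
    have e3 : s ^ (-m / 2 - 1 - 1) = s ^ (-m / 2 - 2) := by congr 1; ring
    have hX := Real.rpow_pos_of_pos hs0 (-m / 2 - 2)
    refine ⟨?_, ?_, ?_, ?_, ?_⟩
    · refine ((Real.hasDerivAt_rpow_const (Or.inl hs0.ne')).mul (hF s hsρ)).congr_deriv ?_
      simp only [e1, e2]; ring
    · refine ((Real.hasDerivAt_rpow_const (Or.inl hs0.ne')).mul (((hF s hsρ).const_mul _).add
        ((hasDerivAt_id s).mul (hF₁ s hsρ)))).congr_deriv ?_
      simp only [e2, e3, Pi.add_apply, Pi.mul_apply, id]; ring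
    · have h := hFODE s hsρ
      simp only [e1, e2]
      set X := s ^ (-m / 2 - 2)
      have hl : lam = (d - 2) * m - m ^ 2 := by linarith
      rw [hl]
      field_simp
      linear_combination (4 * s ^ 2 * X) * h
    · have h := (hεF (x := s) (by simpa using hsε))
      rw [hF0, Real.dist_eq, abs_lt] at h
      have hY := Real.rpow_pos_of_pos hs0 (-m / 2)
      nlinarith
    · have h := (hεF (x := s) (by simpa using hsε))
      rw [hF0, Real.dist_eq, abs_lt] at h
      have hY := Real.rpow_pos_of_pos hs0 (-m / 2)
      simp only []
      nlinarith

end PowerSeriesODE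

/-! ### The second radial solution and its growth at the pole. -/

section RadialSolutions

/-- The data of a positive radial solution `φ` (as a function of `c = cos r`) of the homogeneous
equation near `c = -1`, together with the ratio `I` of the solution vanishing at `c₀` to `φ`. -/
structure RadialData (N : ℕ) (lam m c₁ c₀ : ℝ) (φ φ₁ φ₂ I : ℝ → ℝ) : Prop where
  c₁_neg : c₁ < 0
  c₀_mem : c₀ ∈ Ioo (-1) c₁
  contDiffOn_φ : ContDiffOn ℝ 2 φ (Ioo (-1) c₁)
  contDiffOn_I : ContDiffOn ℝ 2 I (Ioo (-1) c₁)
  hasDerivAt_φ : ∀ c ∈ Ioo (-1) c₁, HasDerivAt φ (φ₁ c) c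
  hasDerivAt_φ₁ : ∀ c ∈ Ioo (-1) c₁, HasDerivAt φ₁ (φ₂ c) c
  ode : ∀ c ∈ Ioo (-1) c₁, (1 - c ^ 2) * φ₂ c - N * c * φ₁ c + lam / (1 - c ^ 2) * φ c = 0
  le_φ : ∀ c ∈ Ioo (-1) c₁, (1 - c ^ 2) ^ (-m / 2) / 2 ≤ φ c
  φ_le : ∀ c ∈ Ioo (-1) c₁, φ c ≤ 2 * (1 - c ^ 2) ^ (-m / 2)
  hasDerivAt_I : ∀ c ∈ Ioo (-1) c₁, HasDerivAt I (-((1 - c ^ 2) ^ (-(N : ℝ) / 2) / φ c ^ 2)) c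
  I_c₀ : I c₀ = 0

theorem hasDerivAt_one_sub_sq (c : ℝ) : HasDerivAt (fun c : ℝ => 1 - c ^ 2) (-2 * c) c := by
  simpa using ((hasDerivAt_id c).pow 2).const_sub 1

theorem one_sub_sq_pos {c₁ c : ℝ} (h₁ : c₁ < 0) (hc : c ∈ Ioo (-1) c₁) : 0 < 1 - c ^ 2 := by
  nlinarith [hc.1, hc.2]

/-- Reduction of order. In divergence form the radial Laplacian is `(1-c²)^(1-N/2) ((1-c²)^(N/2)
Φ')'`, so `φ ∫ (1-c²)^(-N/2) φ⁻²` is a second solution, normalized here to vanish at `c₀`. -/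
theorem exists_radialData {N : ℕ} {lam m : ℝ} (hm : 0 ≤ m) (hmN : 2 * m ≤ (N : ℝ) - 2)
    (hroot : m ^ 2 - ((N : ℝ) - 2) * m + lam = 0) :
    ∃ c₁ : ℝ, -1 < c₁ ∧ c₁ < 0 ∧ ∀ c₀ ∈ Ioo (-1) c₁, ∃ φ φ₁ φ₂ I : ℝ → ℝ,
      RadialData N lam m c₁ c₀ φ φ₁ φ₂ I := by
  obtain ⟨s₁, hs₁, hs₁', G, G₁, G₂, hGC, hG⟩ := exists_frobenius_solution hm hmN hroot
  have hsq : √(1 - s₁) ^ 2 = 1 - s₁ := Real.sq_sqrt (by linarith)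
  have hsq0 : 0 < √(1 - s₁) := Real.sqrt_pos.mpr (by linarith)
  have hc₁ : -√(1 - s₁) < 0 := by linarith
  have hmaps : ∀ c ∈ Ioo (-1) (-√(1 - s₁)), 1 - c ^ 2 ∈ Ioo 0 s₁ := fun c hc =>
    ⟨one_sub_sq_pos hc₁ hc, by nlinarith [hc.2]⟩
  refine ⟨-√(1 - s₁), by nlinarith, hc₁, fun c₀ hc₀ => ?_⟩
  have hφpos : ∀ c ∈ Ioo (-1) (-√(1 - s₁)), 0 < G (1 - c ^ 2) := fun c hc =>
    (half_pos (Real.rpow_pos_of_pos (hmaps c hc).1 _)).trans_le (hG _ (hmaps c hc)).2.2.2.1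
  have hφC : ContDiffOn ℝ 2 (fun c => G (1 - c ^ 2)) (Ioo (-1) (-√(1 - s₁))) :=
    hGC.comp (by fun_prop) hmaps
  set W : ℝ → ℝ := fun c => (1 - c ^ 2) ^ (-(N : ℝ) / 2) / G (1 - c ^ 2) ^ 2 with hW
  have hWC : ContDiffOn ℝ 2 W (Ioo (-1) (-√(1 - s₁))) := by
    refine ContDiffOn.div (ContDiffOn.rpow_const_of_ne (by fun_prop) fun c hc => ?_)
      (hφC.pow 2) fun c hc => ?_
    · exact (hmaps c hc).1.ne'
    · exact (pow_pos (hφpos c hc) 2).ne'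
  have hI : ∀ c ∈ Ioo (-1) (-√(1 - s₁)), HasDerivAt (fun c => ∫ x in c..c₀, W x) (-W c) c := by
    intro c hc
    have hsub : uIcc c c₀ ⊆ Ioo (-1) (-√(1 - s₁)) := ordConnected_Ioo.uIcc_subset hc hc₀
    exact intervalIntegral.integral_hasDerivAt_left
      (hWC.continuousOn.mono hsub).intervalIntegrable
      (hWC.continuousOn.stronglyMeasurableAtFilter isOpen_Ioo c hc)
      (hWC.continuousOn.continuousAt (isOpen_Ioo.mem_nhds hc))
  refine ⟨fun c => G (1 - c ^ 2), fun c => -2 * c * G₁ (1 - c ^ 2),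
    fun c => 4 * c ^ 2 * G₂ (1 - c ^ 2) - 2 * G₁ (1 - c ^ 2), fun c => ∫ x in c..c₀, W x,
    hc₁, hc₀, hφC, ?_, ?_, ?_, ?_, ?_, ?_, hI, by simp⟩
  · have h1 : ContDiffOn ℝ (1 : ℕ) (fun c => -W c) (Ioo (-1) (-√(1 - s₁))) :=
      hWC.neg.of_le (by norm_num)
    exact_mod_cast contDiffOn_succ_of_hasDerivAt isOpen_Ioo hI h1
  · intro c hc
    exact ((hG _ (hmaps c hc)).1.comp c (hasDerivAt_one_sub_sq c)).congr_deriv (by ring)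
  · intro c hc
    have h := ((hasDerivAt_id c).const_mul (-2)).mul
      ((hG _ (hmaps c hc)).2.1.comp c (hasDerivAt_one_sub_sq c))
    refine h.congr_deriv ?_
    simp
    ring
  · intro c hc
    have h := (hG _ (hmaps c hc)).2.2.1
    linear_combination h
  · intro c hc; exact (hG _ (hmaps c hc)).2.2.2.1
  · intro c hc; exact (hG _ (hmaps c hc)).2.2.2.2

namespace RadialData

variable {N : ℕ} {lam m c₁ c₀ : ℝ} {φ φ₁ φ₂ I : ℝ → ℝ}

theorem φ_pos (h : RadialData N lam m c₁ c₀ φ φ₁ φ₂ I) {c : ℝ} (hc : c ∈ Ioo (-1) c₁) :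
    0 < φ c :=
  (half_pos (Real.rpow_pos_of_pos (one_sub_sq_pos h.c₁_neg hc) _)).trans_le (h.le_φ c hc)

theorem continuousOn_I (h : RadialData N lam m c₁ c₀ φ φ₁ φ₂ I) : ContinuousOn I (Ioo (-1) c₁) :=
  h.contDiffOn_I.continuousOn

theorem hasDerivAt_mul_comp (h : RadialData N lam m c₁ c₀ φ φ₁ φ₂ I) {k k₁ : ℝ → ℝ}
    (hk : ∀ t, HasDerivAt k (k₁ t) t) {c : ℝ} (hc : c ∈ Ioo (-1) c₁) :
    HasDerivAt (fun c => φ c * k (I c))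
      (φ₁ c * k (I c) + φ c * (k₁ (I c) * -((1 - c ^ 2) ^ (-(N : ℝ) / 2) / φ c ^ 2))) c :=
  (h.hasDerivAt_φ c hc).mul ((hk _).comp c (h.hasDerivAt_I c hc))

/-- The Hardy operator applied to `φ · k(I)` only sees the second derivative of `k`. -/
theorem sphLaplacian_mul_comp (h : RadialData N lam m c₁ c₀ φ φ₁ φ₂ I) {k k₁ k₂ : ℝ → ℝ}
    (hkC : ContDiff ℝ 2 k) (hk : ∀ t, HasDerivAt k (k₁ t) t) (hk₁ : ∀ t, HasDerivAt k₁ (k₂ t) t)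
    (o x : Sph N) {c : ℝ} (hcx : inner ℝ (o : Amb N) (x : Amb N) = c) (hc : c ∈ Ioo (-1) c₁) :
    sphLaplacian (zonal o fun c => φ c * k (I c)) x + lam / (1 - c ^ 2) * (φ c * k (I c)) =
      (1 - c ^ 2) ^ (1 - (N : ℝ)) * (φ c ^ 3)⁻¹ * k₂ (I c) := by
  have hJ : Ioo (-1) c₁ ∈ 𝓝 c := isOpen_Ioo.mem_nhds hc
  have hσ := one_sub_sq_pos h.c₁_neg hc
  have hφ := h.φ_pos hc
  have hC : ContDiffAt ℝ 2 (fun c => φ c * k (I c)) c :=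
    (h.contDiffOn_φ.contDiffAt hJ).mul (hkC.contDiffAt.comp c (h.contDiffOn_I.contDiffAt hJ))
  have h₁ : ∀ᶠ c in 𝓝 c, HasDerivAt (fun c => φ c * k (I c))
      (φ₁ c * k (I c) + φ c * (k₁ (I c) * -((1 - c ^ 2) ^ (-(N : ℝ) / 2) / φ c ^ 2))) c := by
    filter_upwards [hJ] with c hc using h.hasDerivAt_mul_comp hk hc
  have hI := h.hasDerivAt_I c hc
  have hW := ((hasDerivAt_one_sub_sq c).rpow_const (p := -(N : ℝ) / 2) (Or.inl hσ.ne')).div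
    ((h.hasDerivAt_φ c hc).pow 2) (pow_pos hφ 2).ne'
  have h₂ := ((h.hasDerivAt_φ₁ c hc).mul ((hk _).comp c hI)).add
    ((h.hasDerivAt_φ c hc).mul (((hk₁ _).comp c hI).mul hW.neg))
  rw [← hcx] at hC h₁ h₂
  rw [sphLaplacian_zonal o x hC h₁ h₂, hcx]
  have hode := h.ode c hc
  have e1 : (1 - c ^ 2) ^ (-(N : ℝ) / 2 - 1) = (1 - c ^ 2) ^ (-(N : ℝ) / 2) / (1 - c ^ 2) :=
    Real.rpow_sub_one hσ.ne' _
  have e2 : (1 - c ^ 2) ^ (1 - (N : ℝ)) =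
      (1 - c ^ 2) * ((1 - c ^ 2) ^ (-(N : ℝ) / 2)) ^ 2 := by
    nth_rewrite 2 [← Real.rpow_one (1 - c ^ 2)]
    rw [← Real.rpow_natCast ((1 - c ^ 2) ^ (-(N : ℝ) / 2)) 2, ← Real.rpow_mul hσ.le,
      ← Real.rpow_add hσ]
    congr 1; push_cast; ring
  simp only [e2, e1, Function.comp, Pi.neg_apply, Pi.div_apply, Pi.mul_apply, Pi.pow_apply]
  have hX := Real.rpow_pos_of_pos hσ (-(N : ℝ) / 2)
  set X := (1 - c ^ 2) ^ (-(N : ℝ) / 2)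
  set σ := 1 - c ^ 2
  -- The terms in `k` vanish by the equation for `φ`, and those in `k'` by the formula for `I'`;
  -- what remains is `(1-c²) φ (I')² k''(I)`.
  have hode' : σ * (σ * φ₂ c) = σ * (N * c * φ₁ c) - lam * φ c := by
    field_simp at hode; linear_combination hode
  field_simp
  push_cast
  linear_combination (φ c ^ 3 * k (I c)) * hode'

/-- Comparison of derivatives: `v - A I` is nondecreasing and `I` vanishes at `c₀`. It yields lower
bounds on the growth of `I` at the pole without integrating. -/
theorem monotoneOn_sub_I (h : RadialData N lam m c₁ c₀ φ φ₁ φ₂ I) {v v' : ℝ → ℝ} {A : ℝ}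
    (hv : ∀ c ∈ Ioo (-1) c₁, HasDerivAt v (v' c) c)
    (hv' : ∀ c ∈ Ioo (-1) c₁, 0 ≤ v' c + A * ((1 - c ^ 2) ^ (-(N : ℝ) / 2) / φ c ^ 2)) :
    ∀ c ∈ Ioc (-1) c₀, v c ≤ v c₀ + A * I c := by
  have hd : ∀ c ∈ Ioo (-1) c₁, HasDerivAt (fun c => v c - A * I c)
      (v' c - A * -((1 - c ^ 2) ^ (-(N : ℝ) / 2) / φ c ^ 2)) c := fun c hc =>
    (hv c hc).sub ((h.hasDerivAt_I c hc).const_mul A)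
  have hmono : MonotoneOn (fun c => v c - A * I c) (Ioo (-1) c₁) := by
    refine monotoneOn_of_deriv_nonneg (convex_Ioo _ _)
      (fun c hc => (hd c hc).continuousAt.continuousWithinAt) ?_ ?_
    · rw [interior_Ioo]
      exact fun c hc => (hd c hc).differentiableAt.differentiableWithinAt
    · rw [interior_Ioo]
      intro c hc
      rw [(hd c hc).deriv]
      have := hv' c hc
      linarith
  intro c hc
  have := hmono ⟨hc.1, hc.2.trans_lt h.c₀_mem.2⟩ h.c₀_mem hc.2
  simp only [h.I_c₀, mul_zero, sub_zero] at this
  linarith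

theorem le_wronskian (h : RadialData N lam m c₁ c₀ φ φ₁ φ₂ I) {c : ℝ} (hc : c ∈ Ioo (-1) c₁) :
    (1 - c ^ 2) ^ (-((N : ℝ) / 2 - m)) / 4 ≤ (1 - c ^ 2) ^ (-(N : ℝ) / 2) / φ c ^ 2 := by
  have hσ := one_sub_sq_pos h.c₁_neg hc
  have hφ := h.φ_pos hc
  have hX := Real.rpow_pos_of_pos hσ (-m / 2)
  have h1 : φ c ^ 2 ≤ (2 * (1 - c ^ 2) ^ (-m / 2)) ^ 2 := pow_le_pow_left₀ hφ.le (h.φ_le c hc) 2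
  rw [div_le_div_iff₀ (by norm_num) (by positivity)]
  have h2 : (1 - c ^ 2) ^ (-(N : ℝ) / 2) =
      (1 - c ^ 2) ^ (-((N : ℝ) / 2 - m)) * ((1 - c ^ 2) ^ (-m / 2)) ^ 2 := by
    rw [← Real.rpow_natCast ((1 - c ^ 2) ^ (-m / 2)) 2, ← Real.rpow_mul hσ.le,
      ← Real.rpow_add hσ]
    congr 1; push_cast; ring
  rw [h2]
  have hY := Real.rpow_pos_of_pos hσ (-((N : ℝ) / 2 - m))
  nlinarith

theorem I_nonneg (h : RadialData N lam m c₁ c₀ φ φ₁ φ₂ I) : ∀ c ∈ Ioc (-1) c₀, 0 ≤ I c := by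
  have := h.monotoneOn_sub_I (v := fun _ => 0) (v' := fun _ => 0) (A := 1)
    (fun c _ => hasDerivAt_const c 0) (fun c hc => by
      have := (one_sub_sq_pos h.c₁_neg hc)
      have := h.φ_pos hc
      positivity)
  intro c hc
  have := this c hc
  simpa using this

theorem I_pos (h : RadialData N lam m c₁ c₀ φ φ₁ φ₂ I) : ∀ c ∈ Ioo (-1) c₀, 0 < I c := by
  have hanti : StrictAntiOn I (Ioo (-1) c₁) := by
    refine strictAntiOn_of_deriv_neg (convex_Ioo _ _) h.continuousOn_I ?_
    rw [interior_Ioo]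
    intro c hc
    rw [(h.hasDerivAt_I c hc).deriv]
    have := (one_sub_sq_pos h.c₁_neg hc)
    have := h.φ_pos hc
    simp only [Left.neg_neg_iff]
    positivity
  intro c hc
  have := hanti ⟨hc.1, hc.2.trans h.c₀_mem.2⟩ h.c₀_mem hc.2
  rwa [h.I_c₀] at this

/-- Here `-I' ≥ s^(-μ-1)/4`, while the derivative of `s^(-μ)` is at least `-2μ s^(-μ-1)`; hence the
factor `8μ`. -/
theorem rpow_le (h : RadialData N lam m c₁ c₀ φ φ₁ φ₂ I) {μ : ℝ} (hμ : 0 ≤ μ)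
    (hμm : μ = ((N : ℝ) - 2) / 2 - m) : ∃ C : ℝ, 0 < C ∧
      ∀ c ∈ Ioc (-1) c₀, (1 - c ^ 2) ^ (-μ) ≤ C * (1 + I c) := by
  have key := h.monotoneOn_sub_I (v := fun c => (1 - c ^ 2) ^ (-μ))
    (v' := fun c => -2 * c * -μ * (1 - c ^ 2) ^ (-μ - 1)) (A := 8 * μ)
    (fun c hc => (hasDerivAt_one_sub_sq c).rpow_const (Or.inl (one_sub_sq_pos h.c₁_neg hc).ne'))
    (fun c hc => by
      have h1 := h.le_wronskian hc
      have hσ := one_sub_sq_pos h.c₁_neg hc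
      have h2 : -((N : ℝ) / 2 - m) = -μ - 1 := by rw [hμm]; ring
      rw [h2] at h1
      have hY := Real.rpow_pos_of_pos hσ (-μ - 1)
      have h3 : 0 ≤ μ * (1 - c ^ 2) ^ (-μ - 1) * (1 + c) := by
        have := hc.1
        have : 0 ≤ 1 + c := by linarith
        positivity
      nlinarith [mul_le_mul_of_nonneg_left h1 hμ])
  have h0 := one_sub_sq_pos h.c₁_neg h.c₀_mem
  have hX := Real.rpow_pos_of_pos h0 (-μ)
  refine ⟨(1 - c₀ ^ 2) ^ (-μ) + 8 * μ, by positivity, fun c hc => ?_⟩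
  have h1 := key c hc
  have h2 := h.I_nonneg c hc
  nlinarith [mul_nonneg hX.le h2]

/-- The same comparison with a logarithm, valid also at `μ = 0`, where `-I'` is still at least
`s⁻¹/4`. -/
theorem neg_log_le (h : RadialData N lam m c₁ c₀ φ φ₁ φ₂ I) (hmN : 2 * m ≤ (N : ℝ) - 2) :
    ∃ C : ℝ, 0 < C ∧ ∀ c ∈ Ioc (-1) c₀, -Real.log (1 - c ^ 2) ≤ C * (1 + I c) := by
  have key := h.monotoneOn_sub_I (v := fun c => -Real.log (1 - c ^ 2))
    (v' := fun c => -(-2 * c / (1 - c ^ 2))) (A := 8)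
    (fun c hc => ((hasDerivAt_one_sub_sq c).log (one_sub_sq_pos h.c₁_neg hc).ne').neg)
    (fun c hc => by
      have h1 := h.le_wronskian hc
      have hσ := one_sub_sq_pos h.c₁_neg hc
      have h2 : (1 - c ^ 2)⁻¹ ≤ (1 - c ^ 2) ^ (-((N : ℝ) / 2 - m)) := by
        rw [← Real.rpow_neg_one]
        refine Real.rpow_le_rpow_of_exponent_ge hσ (by nlinarith) (by linarith)
      have h3 : 0 ≤ (1 + c) * (1 - c ^ 2)⁻¹ := by
        have := hc.1
        have : 0 ≤ 1 + c := by linarith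
        positivity
      rw [div_eq_mul_inv]
      linarith)
  have h0 := one_sub_sq_pos h.c₁_neg h.c₀_mem
  have hl : 0 ≤ -Real.log (1 - c₀ ^ 2) := by
    have := Real.log_nonpos h0.le (by nlinarith); linarith
  refine ⟨-Real.log (1 - c₀ ^ 2) + 8, by positivity, fun c hc => ?_⟩
  have h1 := key c hc
  have h2 := h.I_nonneg c hc
  nlinarith [mul_nonneg hl h2]

end RadialData

end RadialSolutions

/-! ### Cutoff profiles and the truncation of `I` at scale `R`. -/

section Cutoffs

/-- A cutoff profile equal to `1` on `(-∞, 1]` and to `0` on `[2, ∞)`, whose derivatives are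
controlled by the power `1/p` of the profile. -/
structure CutoffProfile (p C : ℝ) (X X₁ X₂ : ℝ → ℝ) : Prop where
  C_pos : 0 < C
  contDiff : ContDiff ℝ 2 X
  hasDerivAt : ∀ t, HasDerivAt X (X₁ t) t
  hasDerivAt₁ : ∀ t, HasDerivAt X₁ (X₂ t) t
  nonneg : ∀ t, 0 ≤ X t
  le_one : ∀ t, X t ≤ 1
  eq_one : ∀ t ≤ 1, X t = 1
  eq_zero : ∀ t, 2 ≤ t → X t = 0
  deriv_eq_zero : ∀ t, t ∉ Ioo 1 2 → X₁ t = 0 ∧ X₂ t = 0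
  deriv_le : ∀ t, |X₁ t| ≤ C * X t ^ (1 / p)
  deriv₂_le : ∀ t, |X₂ t| ≤ C * X t ^ (1 / p)

theorem exists_bound_of_eq_zero_outside {g : ℝ → ℝ} (hg : Continuous g)
    (h0 : ∀ t, t ∉ Icc (1 : ℝ) 2 → g t = 0) : ∃ B : ℝ, 0 ≤ B ∧ ∀ t, |g t| ≤ B := by
  obtain ⟨B, hB⟩ := isCompact_Icc.exists_bound_of_continuousOn (s := Icc (1 : ℝ) 2) hg.continuousOn
  refine ⟨max B 0, le_max_right _ _, fun t => ?_⟩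
  by_cases ht : t ∈ Icc (1 : ℝ) 2
  · exact (hB t ht).trans (le_max_left _ _)
  · rw [h0 t ht, abs_zero]; exact le_max_right _ _

/-- The profile is a power `χ^(j+2)` of a smooth step. Two derivatives still leave a factor `χ^j`,
and `j ≥ 2/(p-1)` ensures `(j+2)/p ≤ j`, so `χ^j` is at most the `1/p` power of the profile. -/
theorem exists_cutoffProfile {p : ℝ} (hp : 1 < p) :
    ∃ (C : ℝ) (X X₁ X₂ : ℝ → ℝ), CutoffProfile p C X X₁ X₂ := by
  set χ : ℝ → ℝ := fun t => Real.smoothTransition (2 - t) with hχ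
  have hχC : ContDiff ℝ ∞ χ := Real.smoothTransition.contDiff.comp (by fun_prop)
  have hχ0 : ∀ t, 0 ≤ χ t := fun t => Real.smoothTransition.nonneg _
  have hχ1 : ∀ t, χ t ≤ 1 := fun t => Real.smoothTransition.le_one _
  have hone : ∀ t ≤ 1, χ t = 1 := fun t ht =>
    Real.smoothTransition.one_of_one_le (by linarith)
  have hzero : ∀ t, 2 ≤ t → χ t = 0 := fun t ht =>
    Real.smoothTransition.zero_of_nonpos (by linarith)
  have hC1 : ContDiff ℝ ∞ (deriv χ) := by
    have h := contDiff_infty_iff_deriv.mp hχC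
    exact h.2
  have hC2 : ContDiff ℝ ∞ (deriv (deriv χ)) := (contDiff_infty_iff_deriv.mp hC1).2
  have hd : ∀ t, HasDerivAt χ (deriv χ t) t := fun t =>
    (hχC.differentiable (by simp)).differentiableAt.hasDerivAt
  have hd1 : ∀ t, HasDerivAt (deriv χ) (deriv (deriv χ) t) t := fun t =>
    (hC1.differentiable (by simp)).differentiableAt.hasDerivAt
  have hderiv_out : ∀ {g : ℝ → ℝ} {a b : ℝ}, (∀ t < 1, g t = a) → (∀ t, 2 < t → g t = b) →
      ∀ t, t ∉ Icc (1 : ℝ) 2 → deriv g t = 0 := by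
    intro g a b h1 h2 t ht
    rw [mem_Icc, not_and_or, not_le, not_le] at ht
    rcases ht with ht | ht
    · have : g =ᶠ[𝓝 t] fun _ => a := by
        filter_upwards [Iio_mem_nhds ht] with s hs using h1 s hs
      rw [this.deriv_eq, deriv_const]
    · have : g =ᶠ[𝓝 t] fun _ => b := by
        filter_upwards [Ioi_mem_nhds ht] with s hs using h2 s hs
      rw [this.deriv_eq, deriv_const]
  have hout1 := hderiv_out (fun t ht => hone t ht.le) (fun t ht => hzero t ht.le)
  have hout2 := hderiv_out (a := 0) (b := 0)
    (fun t ht => hout1 t (fun h => absurd h.1 (not_le.mpr ht)))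
    (fun t ht => hout1 t (fun h => absurd h.2 (not_le.mpr ht)))
  -- Continuity extends the vanishing of the derivatives to the endpoints.
  have hclos : ∀ {g : ℝ → ℝ}, Continuous g → (∀ t, t ∉ Icc (1 : ℝ) 2 → g t = 0) →
      ∀ t, t ∉ Ioo (1 : ℝ) 2 → g t = 0 := by
    intro g hg h t ht
    have h1 : closure ((Icc (1 : ℝ) 2)ᶜ) ⊆ g ⁻¹' {0} :=
      closure_minimal (fun s hs => h s hs) (isClosed_singleton.preimage hg)
    rw [closure_compl, interior_Icc] at h1
    exact h1 ht
  have hout1' := hclos hC1.continuous hout1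
  have hout2' := hclos hC2.continuous hout2
  obtain ⟨B₁, hB₁0, hB₁⟩ := exists_bound_of_eq_zero_outside hC1.continuous hout1
  obtain ⟨B₂, hB₂0, hB₂⟩ := exists_bound_of_eq_zero_outside hC2.continuous hout2
  obtain ⟨j, hj⟩ := exists_nat_ge (2 / (p - 1))
  -- the power of the profile
  have hexp : ((j : ℝ) + 2) * (1 / p) ≤ j := by
    rw [div_le_iff₀ (by linarith)] at hj
    rw [mul_one_div, div_le_iff₀ (by linarith)]
    linarith
  have hpow : ∀ t, χ t ^ j ≤ (χ t ^ (j + 2)) ^ (1 / p) := by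
    intro t
    rcases (hχ0 t).eq_or_lt with h | h
    · rw [← h]
      rcases Nat.eq_zero_or_pos j with rfl | hj0
      · have : 0 < 2 / (p - 1) := div_pos two_pos (by linarith)
        norm_num at hj
        linarith
      · rw [zero_pow hj0.ne']; positivity
    · rw [← Real.rpow_natCast, ← Real.rpow_natCast, ← Real.rpow_mul h.le]
      exact Real.rpow_le_rpow_of_exponent_ge h (hχ1 t) (by push_cast; exact hexp)
  have hj1 : ∀ t, χ t ^ (j + 1) ≤ χ t ^ j := fun t =>
    pow_le_pow_of_le_one (hχ0 t) (hχ1 t) (Nat.le_succ j)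
  refine ⟨((j : ℝ) + 2) * B₁ + ((j + 2) * ((j + 1) * B₁ * B₁ + B₂)) + 1, fun t => χ t ^ (j + 2),
    fun t => (j + 2) * χ t ^ (j + 1) * deriv χ t,
    fun t => (j + 2) * ((j + 1) * χ t ^ j * deriv χ t * deriv χ t + χ t ^ (j + 1) *
      deriv (deriv χ) t), ⟨by positivity, ?_, ?_, ?_, ?_, ?_, ?_, ?_, ?_, ?_, ?_⟩⟩
  · exact (hχC.pow _).of_le ENat.LEInfty.out
  · intro t
    refine ((hd t).pow (j + 2)).congr_deriv ?_
    simp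
  · intro t
    refine ((((hd t).pow (j + 1)).const_mul ((j : ℝ) + 2)).mul (hd1 t)).congr_deriv ?_
    simp
    ring
  · intro t; exact pow_nonneg (hχ0 t) _
  · intro t; exact pow_le_one₀ (hχ0 t) (hχ1 t)
  · intro t ht; simp [hone t ht]
  · intro t ht; simp [hzero t ht]
  · intro t ht; simp [hout1' t ht, hout2' t ht]
  · intro t
    rw [abs_mul, abs_mul, abs_of_nonneg (by positivity : (0 : ℝ) ≤ j + 2),
      abs_of_nonneg (pow_nonneg (hχ0 t) _)]
    have h1 := (hj1 t).trans (hpow t)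
    have h2 : 0 ≤ (χ t ^ (j + 2)) ^ (1 / p) := Real.rpow_nonneg (pow_nonneg (hχ0 t) _) _
    set Y := (χ t ^ (j + 2)) ^ (1 / p)
    calc ((j : ℝ) + 2) * χ t ^ (j + 1) * |deriv χ t| ≤ (j + 2) * Y * B₁ := by
          gcongr; exact hB₁ t
      _ = ((j + 2) * B₁) * Y := by ring
      _ ≤ _ := by
        gcongr
        have : 0 ≤ ((j : ℝ) + 2) * ((j + 1) * B₁ * B₁ + B₂) := by positivity
        linarith
  · intro t
    rw [abs_mul, abs_of_nonneg (by positivity : (0 : ℝ) ≤ j + 2)]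
    have h1 := (hj1 t).trans (hpow t)
    have h0 := hpow t
    have h2 : 0 ≤ (χ t ^ (j + 2)) ^ (1 / p) := Real.rpow_nonneg (pow_nonneg (hχ0 t) _) _
    set Y := (χ t ^ (j + 2)) ^ (1 / p)
    have h3 : |((j : ℝ) + 1) * χ t ^ j * deriv χ t * deriv χ t + χ t ^ (j + 1) *
        deriv (deriv χ) t| ≤ ((j : ℝ) + 1) * Y * B₁ * B₁ + Y * B₂ := by
      refine (abs_add_le _ _).trans ?_
      rw [abs_mul, abs_mul, abs_mul, abs_mul (χ t ^ (j + 1)),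
        abs_of_nonneg (by positivity : (0 : ℝ) ≤ (j : ℝ) + 1),
        abs_of_nonneg (pow_nonneg (hχ0 t) _), abs_of_nonneg (pow_nonneg (hχ0 t) _)]
      have := pow_nonneg (hχ0 t) j
      have := pow_nonneg (hχ0 t) (j + 1)
      gcongr
      · exact hB₁ t
      · exact hB₁ t
      · exact hB₂ t
    calc ((j : ℝ) + 2) * _ ≤ ((j : ℝ) + 2) * (((j : ℝ) + 1) * Y * B₁ * B₁ + Y * B₂) := by gcongr
      _ = ((j + 2) * ((j + 1) * B₁ * B₁ + B₂)) * Y := by ring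
      _ ≤ _ := by
        gcongr
        have : 0 ≤ ((j : ℝ) + 2) * B₁ := by positivity
        linarith

/-- The profiles `t ↦ t X(V(t)/R)`. -/
theorem CutoffProfile.mul_comp {p C : ℝ} {X X₁ X₂ : ℝ → ℝ} (h : CutoffProfile p C X X₁ X₂)
    {V V₁ V₂ : ℝ → ℝ} (hVC : ContDiff ℝ 2 V) (hV : ∀ t, HasDerivAt V (V₁ t) t)
    (hV₁ : ∀ t, HasDerivAt V₁ (V₂ t) t) {R : ℝ} (hR : 0 < R) :
    ∃ k k₁ k₂ : ℝ → ℝ, ContDiff ℝ 2 k ∧ (∀ t, HasDerivAt k (k₁ t) t) ∧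
      (∀ t, HasDerivAt k₁ (k₂ t) t) ∧ (∀ t, k t = t * X (V t / R)) ∧
      (∀ t, V t ≤ R → k₁ t = 1) ∧ (∀ t, V t / R ∉ Ioo 1 2 → k₂ t = 0) ∧
      ∀ t, |k₂ t| ≤ C * X (V t / R) ^ (1 / p) *
        (2 * |V₁ t| / R + |t| * (V₁ t) ^ 2 / R ^ 2 + |t| * |V₂ t| / R) := by
  have hVR : ∀ t, HasDerivAt (fun t => V t / R) (V₁ t / R) t := fun t => (hV t).div_const R
  have hVR₁ : ∀ t, HasDerivAt (fun t => V₁ t / R) (V₂ t / R) t := fun t => (hV₁ t).div_const R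
  refine ⟨fun t => t * X (V t / R), fun t => X (V t / R) + t * (X₁ (V t / R) * (V₁ t / R)),
    fun t => 2 * (X₁ (V t / R) * (V₁ t / R)) + t * (X₂ (V t / R) * (V₁ t / R) * (V₁ t / R)
      + X₁ (V t / R) * (V₂ t / R)), ?_, ?_, ?_, fun t => rfl, ?_, ?_, ?_⟩
  · exact contDiff_id.mul (h.contDiff.comp (hVC.div_const R))
  · intro t
    have := (hasDerivAt_id t).mul ((h.hasDerivAt _).comp t (hVR t))
    refine this.congr_deriv ?_
    simp
  · intro t
    have h1 := ((h.hasDerivAt₁ _).comp t (hVR t)).mul (hVR₁ t)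
    have := ((h.hasDerivAt _).comp t (hVR t)).add ((hasDerivAt_id t).mul h1)
    refine this.congr_deriv ?_
    simp
    ring
  · intro t ht
    have h1 : V t / R ≤ 1 := (div_le_one hR).mpr ht
    have h2 := (h.deriv_eq_zero (V t / R) fun hh => absurd hh.1 (not_lt.mpr h1)).1
    simp [h.eq_one _ h1, h2]
  · intro t ht
    obtain ⟨h1, h2⟩ := h.deriv_eq_zero _ ht
    simp [h1, h2]
  · intro t
    have h1 := h.deriv_le (V t / R)
    have h2 := h.deriv₂_le (V t / R)
    have hY : 0 ≤ C * X (V t / R) ^ (1 / p) := (abs_nonneg _).trans h1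
    set Y := C * X (V t / R) ^ (1 / p)
    refine (abs_add_le _ _).trans ?_
    rw [abs_mul, abs_mul, abs_mul t, abs_two, abs_div, abs_of_pos hR]
    have h3 : |X₂ (V t / R) * (V₁ t / R) * (V₁ t / R) + X₁ (V t / R) * (V₂ t / R)| ≤
        Y * (|V₁ t| / R) * (|V₁ t| / R) + Y * (|V₂ t| / R) := by
      refine (abs_add_le _ _).trans ?_
      rw [abs_mul, abs_mul, abs_mul, abs_div, abs_div, abs_of_pos hR]
      gcongr
    calc 2 * (|X₁ (V t / R)| * (|V₁ t| / R)) + |t| * _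
        ≤ 2 * (Y * (|V₁ t| / R)) +
          |t| * (Y * (|V₁ t| / R) * (|V₁ t| / R) + Y * (|V₂ t| / R)) := by gcongr
      _ = Y * (2 * |V₁ t| / R + |t| * |V₁ t| ^ 2 / R ^ 2 + |t| * |V₂ t| / R) := by
        field_simp
        ring
      _ = _ := by rw [sq_abs]

/-- The function cutting `t ↦ t` off at scale `R`, with second derivative controlled along the
radial solution. -/
structure RadialCutoff (p μ C R c₀ : ℝ) (I k k₁ k₂ : ℝ → ℝ) : Prop where
  contDiff : ContDiff ℝ 2 k
  hasDerivAt : ∀ t, HasDerivAt k (k₁ t) t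
  hasDerivAt₁ : ∀ t, HasDerivAt k₁ (k₂ t) t
  nonneg : ∀ t, 0 ≤ t → 0 ≤ k t
  eq_self : ∀ t, |t| ≤ R → k t = t
  deriv_zero : k₁ 0 = 1
  eventually_zero : ∃ E, ∀ t, E ≤ t → k t = 0
  deriv₂_le : ∀ c ∈ Ioc (-1) c₀, |k₂ (I c)| * (1 - c ^ 2) ^ (-(μ * (1 + 1 / p))) ≤
    C / R * k (I c) ^ (1 / p)
  support : ∀ c ∈ Ioc (-1) c₀, k₂ (I c) ≠ 0 → -Real.log (1 - c ^ 2) ≤ C * R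

variable {N : ℕ} {lam m c₁ c₀ : ℝ} {φ φ₁ φ₂ I : ℝ → ℝ}

/-- For `μ = 0` a linear cutoff in `I` suffices: `k''` lives on `R < I < 2R` and is `O(1/R)`, while
`-log s = O(1 + I) = O(R)` there. -/
theorem RadialData.exists_radialCutoff_of_eq_zero (h : RadialData N lam m c₁ c₀ φ φ₁ φ₂ I)
    (hmN : 2 * m ≤ (N : ℝ) - 2) {p : ℝ} (hp : 1 < p) :
    ∃ C : ℝ, 0 < C ∧ ∀ R : ℝ, 1 ≤ R → ∃ k k₁ k₂ : ℝ → ℝ, RadialCutoff p 0 C R c₀ I k k₁ k₂ := by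
  obtain ⟨C, X, X₁, X₂, hX⟩ := exists_cutoffProfile hp
  obtain ⟨D, hD, hlog⟩ := h.neg_log_le hmN
  have hC := hX.C_pos
  refine ⟨4 * C + 3 * D, by positivity, fun R hR => ?_⟩
  have hR0 : 0 < R := by linarith
  obtain ⟨k, k₁, k₂, hkC, hk, hk₁, hkX, hkone, hkz, hk₂⟩ := hX.mul_comp (V := id)
    (V₁ := fun _ => 1) (V₂ := fun _ => 0) contDiff_id hasDerivAt_id
    (fun t => hasDerivAt_const t 1) hR0
  have hshell : ∀ t, k₂ t ≠ 0 → R < t ∧ t < 2 * R := by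
    intro t ht
    have := not_imp_comm.mp (hkz t) ht
    exact ⟨by simpa using (lt_div_iff₀ hR0).mp this.1, (div_lt_iff₀ hR0).mp this.2⟩
  refine ⟨k, k₁, k₂, hkC, hk, hk₁, ?_, ?_, hkone 0 hR0.le, ⟨2 * R, ?_⟩, ?_, ?_⟩
  · intro t ht
    rw [hkX]; exact mul_nonneg ht (hX.nonneg _)
  · intro t ht
    rw [hkX, id, hX.eq_one _ ((div_le_one hR0).mpr ((le_abs_self t).trans ht)), mul_one]
  · intro t ht
    rw [hkX, id, hX.eq_zero _ ((le_div_iff₀ hR0).mpr ht), mul_zero]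
  · intro c hc
    have hI := h.I_nonneg c hc
    simp only [zero_mul, neg_zero, Real.rpow_zero, mul_one]
    by_cases h0 : k₂ (I c) = 0
    · rw [h0, abs_zero, hkX]
      have := hX.nonneg (id (I c) / R)
      positivity
    · obtain ⟨h1, h2⟩ := hshell _ h0
      refine (hk₂ _).trans ?_
      rw [hkX]
      have hXn := hX.nonneg (id (I c) / R)
      rw [Real.mul_rpow hI hXn]
      set Y := X (id (I c) / R) ^ (1 / p) with hY
      have hY0 : 0 ≤ Y := Real.rpow_nonneg hXn _
      have h3 : 1 ≤ I c ^ (1 / p) := Real.one_le_rpow (by linarith) (by positivity)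
      have h4 : 2 * |(1 : ℝ)| / R + |I c| * 1 ^ 2 / R ^ 2 + |I c| * |0| / R ≤ 4 / R := by
        rw [abs_of_nonneg hI]
        simp only [abs_one, mul_one, one_pow, abs_zero, mul_zero, zero_div, add_zero]
        have : I c / R ^ 2 ≤ 2 / R := by
          rw [div_le_div_iff₀ (by positivity) hR0]; nlinarith
        calc 2 / R + I c / R ^ 2 ≤ 2 / R + 2 / R := by linarith
          _ = 4 / R := by ring
      calc C * Y * _ ≤ C * Y * (4 / R) := by gcongr
        _ = 4 * C / R * (1 * Y) := by ring
        _ ≤ (4 * C + 3 * D) / R * (I c ^ (1 / p) * Y) := by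
          gcongr
          linarith
  · intro c hc h0
    obtain ⟨h1, h2⟩ := hshell _ h0
    refine (hlog c hc).trans ?_
    nlinarith

theorem hasDerivAt_half_log_one_add_sq (t : ℝ) :
    HasDerivAt (fun t : ℝ => 1 / 2 * Real.log (1 + t ^ 2)) (t / (1 + t ^ 2)) t := by
  have h0 : 1 + t ^ 2 ≠ 0 := by positivity
  have h1 : HasDerivAt (fun t : ℝ => 1 + t ^ 2) (2 * t) t := by
    simpa using ((hasDerivAt_id t).pow 2).const_add 1
  refine ((h1.log h0).const_mul (1 / 2)).congr_deriv ?_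
  field_simp

/-- For `μ > 0` the cutoff acts on `log I`, so `k''(t)` is of order `1/(tR)`. The factor `1/t`
compensates `s^(-μ)`, which is at most a multiple of `I`, and the gain `1/R` is kept. -/
theorem RadialData.exists_radialCutoff_of_pos (h : RadialData N lam m c₁ c₀ φ φ₁ φ₂ I)
    {p μ : ℝ} (hp : 1 < p) (hμ : 0 < μ) (hμm : μ = ((N : ℝ) - 2) / 2 - m) :
    ∃ C : ℝ, 0 < C ∧ ∀ R : ℝ, 1 ≤ R → ∃ k k₁ k₂ : ℝ → ℝ, RadialCutoff p μ C R c₀ I k k₁ k₂ := by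
  obtain ⟨C, X, X₁, X₂, hX⟩ := exists_cutoffProfile hp
  obtain ⟨D, hD, hpow⟩ := h.rpow_le hμ.le hμm
  have hC := hX.C_pos
  set D' := 2 * D with hD'
  have hA : 0 ≤ 4 * C * D' ^ (1 + 1 / p) := by positivity
  refine ⟨4 * C * D' ^ (1 + 1 / p) + (|Real.log D'| + 2) / μ, by positivity, fun R hR => ?_⟩
  have hR0 : 0 < R := by linarith
  -- A substitute for `log t` that is smooth at `0`; it lies between `log t` and `t` for positive
  -- `t`.
  set V : ℝ → ℝ := fun t => 1 / 2 * Real.log (1 + t ^ 2) with hV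
  have hVC : ContDiff ℝ 2 V := by
    refine contDiff_const.mul (ContDiff.log (by fun_prop) fun t => ?_)
    positivity
  have hV₂ : ∀ t : ℝ, HasDerivAt (fun t : ℝ => t / (1 + t ^ 2)) ((1 - t ^ 2) / (1 + t ^ 2) ^ 2) t := by
    intro t
    have h0 : 1 + t ^ 2 ≠ 0 := by positivity
    have h1 : HasDerivAt (fun t : ℝ => 1 + t ^ 2) (2 * t) t := by
      simpa using ((hasDerivAt_id t).pow 2).const_add 1
    refine ((hasDerivAt_id t).div h1 h0).congr_deriv ?_
    simp
    ring
  have hVabs : ∀ t, V t ≤ |t| := by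
    intro t
    have h1 : Real.log (1 + t ^ 2) ≤ Real.log ((1 + |t|) ^ 2) := by
      apply Real.log_le_log (by positivity)
      nlinarith [abs_nonneg t, sq_abs t]
    rw [Real.log_pow] at h1
    have h2 : Real.log (1 + |t|) ≤ |t| := by
      have := Real.log_le_sub_one_of_pos (show 0 < 1 + |t| by positivity)
      linarith
    simp only [hV]
    push_cast at h1
    linarith
  have hVlog : ∀ t, 0 < t → Real.log t ≤ V t := by
    intro t ht
    have h1 : Real.log (t ^ 2) ≤ Real.log (1 + t ^ 2) :=
      Real.log_le_log (by positivity) (by linarith)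
    rw [Real.log_pow] at h1
    push_cast at h1
    simp only [hV]
    linarith
  obtain ⟨k, k₁, k₂, hkC, hk, hk₁, hkX, hkone, hkz, hk₂⟩ := hX.mul_comp hVC
    hasDerivAt_half_log_one_add_sq hV₂ hR0
  have hshell : ∀ t, k₂ t ≠ 0 → R < V t ∧ V t < 2 * R := by
    intro t ht
    have := not_imp_comm.mp (hkz t) ht
    exact ⟨by simpa using (lt_div_iff₀ hR0).mp this.1, (div_lt_iff₀ hR0).mp this.2⟩
  have hshell1 : ∀ t, 0 ≤ t → k₂ t ≠ 0 → 1 ≤ t := by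
    intro t ht h0
    have := hVabs t
    rw [abs_of_nonneg ht] at this
    linarith [(hshell t h0).1]
  have hpow' : ∀ c ∈ Ioc (-1) c₀, k₂ (I c) ≠ 0 → (1 - c ^ 2) ^ (-μ) ≤ D' * I c := by
    intro c hc h0
    have h1 := hshell1 _ (h.I_nonneg c hc) h0
    refine (hpow c hc).trans ?_
    rw [hD']
    nlinarith
  refine ⟨k, k₁, k₂, hkC, hk, hk₁, ?_, ?_, hkone 0 (by simp [hV, hR0.le]),
    ⟨Real.exp (2 * R), ?_⟩, ?_, ?_⟩
  · intro t ht
    rw [hkX]; exact mul_nonneg ht (hX.nonneg _)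
  · intro t ht
    rw [hkX, hX.eq_one _ ((div_le_one hR0).mpr ((hVabs t).trans ht)), mul_one]
  · intro t ht
    have ht0 : 0 < t := (Real.exp_pos _).trans_le ht
    have h1 := Real.log_le_log (Real.exp_pos _) ht
    rw [Real.log_exp] at h1
    rw [hkX, hX.eq_zero _ ((le_div_iff₀ hR0).mpr (h1.trans (hVlog t ht0))), mul_zero]
  · intro c hc
    have hI := h.I_nonneg c hc
    have hσ := one_sub_sq_pos h.c₁_neg ⟨hc.1, hc.2.trans_lt h.c₀_mem.2⟩
    by_cases h0 : k₂ (I c) = 0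
    · rw [h0, abs_zero, zero_mul, hkX]
      have := hX.nonneg (V (I c) / R)
      positivity
    · have hs := hpow' c hc h0
      have ht1 := hshell1 _ hI h0
      have hk2 := hk₂ (I c)
      rw [hkX]
      set t := I c
      have ht0 : 0 < t := by linarith
      have hXn := hX.nonneg (V t / R)
      rw [Real.mul_rpow hI hXn]
      set Y := X (V t / R) ^ (1 / p) with hY
      have hY0 : 0 ≤ Y := Real.rpow_nonneg hXn _
      have hq : 0 < 1 + t ^ 2 := by positivity
      have hb1 : |t / (1 + t ^ 2)| ≤ 1 / t := by
        rw [abs_of_nonneg (by positivity), div_le_div_iff₀ hq ht0]; nlinarith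
      have hb2 : |(1 - t ^ 2) / (1 + t ^ 2) ^ 2| ≤ 1 / t ^ 2 := by
        rw [abs_div, abs_of_pos (pow_pos hq 2), div_le_div_iff₀ (pow_pos hq 2) (by positivity)]
        have : |1 - t ^ 2| ≤ 1 + t ^ 2 := by
          rw [abs_le]; constructor <;> nlinarith
        nlinarith
      have h4 : 2 * |t / (1 + t ^ 2)| / R + |t| * (t / (1 + t ^ 2)) ^ 2 / R ^ 2 +
          |t| * |(1 - t ^ 2) / (1 + t ^ 2) ^ 2| / R ≤ 4 / (t * R) := by
        rw [abs_of_pos ht0]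
        have e1 : 2 * |t / (1 + t ^ 2)| / R ≤ 2 * (1 / t) / R := by gcongr
        have e2 : t * (t / (1 + t ^ 2)) ^ 2 / R ^ 2 ≤ t * (1 / t) ^ 2 / R := by
          rw [← sq_abs (t / (1 + t ^ 2))]
          have : R ≤ R ^ 2 := by nlinarith
          gcongr
        have e3 : t * |(1 - t ^ 2) / (1 + t ^ 2) ^ 2| / R ≤ t * (1 / t ^ 2) / R := by gcongr
        calc _ ≤ 2 * (1 / t) / R + t * (1 / t) ^ 2 / R + t * (1 / t ^ 2) / R := by linarith
          _ = 4 / (t * R) := by field_simp; norm_num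
      have h5 : |k₂ t| ≤ C * Y * (4 / (t * R)) := hk2.trans (by gcongr)
      have h6 : (1 - c ^ 2) ^ (-(μ * (1 + 1 / p))) ≤ (D' * t) ^ (1 + 1 / p) := by
        rw [← neg_mul, Real.rpow_mul hσ.le]
        exact Real.rpow_le_rpow (by positivity) hs (by positivity)
      calc |k₂ t| * (1 - c ^ 2) ^ (-(μ * (1 + 1 / p)))
          ≤ C * Y * (4 / (t * R)) * (D' * t) ^ (1 + 1 / p) := by gcongr
        _ = 4 * C * D' ^ (1 + 1 / p) / R * (t ^ (1 / p) * Y) := by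
          rw [Real.mul_rpow (by positivity) ht0.le, Real.rpow_add ht0, Real.rpow_one]
          field_simp
        _ ≤ _ := by
          gcongr
          have : 0 ≤ (|Real.log D'| + 2) / μ := by positivity
          linarith
  · intro c hc h0
    have hs := hpow' c hc h0
    have hσ := one_sub_sq_pos h.c₁_neg ⟨hc.1, hc.2.trans_lt h.c₀_mem.2⟩
    have ht1 := hshell1 _ (h.I_nonneg c hc) h0
    -- On the shell `log I ≤ V(I) < 2R`, so the power bound on `s^(-μ)` becomes `-log s = O(R)`.
    have h1 := Real.log_le_log (by positivity) hs
    rw [Real.log_rpow hσ, Real.log_mul (by positivity) (by linarith)] at h1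
    have h2 := hVlog (I c) (by linarith)
    have h3 := (hshell _ h0).2
    have h4 := le_abs_self (Real.log D')
    have h5 : μ * -Real.log (1 - c ^ 2) ≤ (|Real.log D'| + 2) * R := by
      nlinarith [abs_nonneg (Real.log D')]
    have h6 : -Real.log (1 - c ^ 2) ≤ (|Real.log D'| + 2) / μ * R := by
      rw [div_mul_eq_mul_div, le_div_iff₀ hμ]; linarith
    nlinarith

theorem RadialData.exists_radialCutoff (h : RadialData N lam m c₁ c₀ φ φ₁ φ₂ I)
    {p μ : ℝ} (hp : 1 < p) (hμ : 0 ≤ μ) (hμm : μ = ((N : ℝ) - 2) / 2 - m) :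
    ∃ C : ℝ, 0 < C ∧ ∀ R : ℝ, 1 ≤ R → ∃ k k₁ k₂ : ℝ → ℝ, RadialCutoff p μ C R c₀ I k k₁ k₂ := by
  rcases hμ.eq_or_lt with h0 | h0
  · rw [← h0]; exact h.exists_radialCutoff_of_eq_zero (by linarith) hp
  · exact h.exists_radialCutoff_of_pos hp h0 hμm

end Cutoffs

/-! ### Admissibility of products of time cutoffs and zonal functions. -/

section TestFunctions

variable {N : ℕ}

/-- A time cutoff equal to `1` on `[2, 3]` and vanishing outside `[1, 4]`. -/
structure TimeProfile (p B : ℝ) (E E₁ : ℝ → ℝ) : Prop where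
  B_pos : 0 < B
  hasDerivAt : ∀ t, HasDerivAt E (E₁ t) t
  continuous_deriv : Continuous E₁
  nonneg : ∀ t, 0 ≤ E t
  le_one : ∀ t, E t ≤ 1
  eq_one : ∀ t ∈ Icc (2 : ℝ) 3, E t = 1
  eq_zero : ∀ t, t ∉ Icc (1 : ℝ) 4 → E t = 0
  deriv_le : ∀ t, |E₁ t| ≤ B * E t ^ (1 / p)

/-- The factor `X (3 - t)` switches on over `[1, 2]` and `X (t - 2)` switches off over `[3, 4]`. -/
theorem exists_timeProfile {p : ℝ} (hp : 1 < p) :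
    ∃ (B : ℝ) (E E₁ : ℝ → ℝ), TimeProfile p B E E₁ := by
  obtain ⟨C, X, X₁, X₂, hX⟩ := exists_cutoffProfile hp
  have hC := hX.C_pos
  have hd1 : ∀ t, HasDerivAt (fun t => X (3 - t)) (-X₁ (3 - t)) t := fun t => by
    exact ((hX.hasDerivAt (3 - t)).comp t ((hasDerivAt_id t).const_sub 3)).congr_deriv (by simp)
  have hd2 : ∀ t, HasDerivAt (fun t => X (t - 2)) (X₁ (t - 2)) t := fun t => by
    exact ((hX.hasDerivAt (t - 2)).comp t ((hasDerivAt_id t).sub_const 2)).congr_deriv (by simp)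
  have hXc : Continuous X := hX.contDiff.continuous
  have hX₁c : Continuous X₁ := continuous_iff_continuousAt.mpr fun t => (hX.hasDerivAt₁ t).continuousAt
  have hroot : ∀ t, X t ≤ X t ^ (1 / p) := fun t => by
    have h1 := Real.rpow_le_rpow_of_exponent_ge' (hX.nonneg t) (hX.le_one t)
      (show 0 ≤ 1 / p by positivity) (show 1 / p ≤ 1 by rw [div_le_one (by linarith)]; exact hp.le)
    rwa [Real.rpow_one] at h1
  refine ⟨2 * C, fun t => X (3 - t) * X (t - 2),
    fun t => -X₁ (3 - t) * X (t - 2) + X (3 - t) * X₁ (t - 2), by positivity, ?_, ?_, ?_, ?_, ?_,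
    ?_, ?_⟩
  · intro t; exact (hd1 t).mul (hd2 t)
  · fun_prop
  · intro t; exact mul_nonneg (hX.nonneg _) (hX.nonneg _)
  · intro t; exact mul_le_one₀ (hX.le_one _) (hX.nonneg _) (hX.le_one _)
  · intro t ht
    rw [hX.eq_one _ (by linarith [ht.1]), hX.eq_one _ (by linarith [ht.2]), mul_one]
  · intro t ht
    rw [mem_Icc, not_and_or, not_le, not_le] at ht
    rcases ht with ht | ht
    · rw [hX.eq_zero (3 - t) (by linarith), zero_mul]
    · rw [hX.eq_zero (t - 2) (by linarith), mul_zero]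
  · intro t
    refine (abs_add_le _ _).trans ?_
    rw [abs_mul, abs_mul, abs_neg, abs_of_nonneg (hX.nonneg _), abs_of_nonneg (hX.nonneg _),
      Real.mul_rpow (hX.nonneg _) (hX.nonneg _)]
    have h1 := hX.deriv_le (3 - t)
    have h2 := hX.deriv_le (t - 2)
    have h3 := hroot (3 - t)
    have h4 := hroot (t - 2)
    have n1 := hX.nonneg (3 - t)
    have n2 := hX.nonneg (t - 2)
    set Y := X (3 - t) ^ (1 / p)
    set Z := X (t - 2) ^ (1 / p)
    have hY : 0 ≤ Y := n1.trans h3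
    have hZ : 0 ≤ Z := n2.trans h4
    calc |X₁ (3 - t)| * X (t - 2) + X (3 - t) * |X₁ (t - 2)|
        ≤ (C * Y) * Z + Y * (C * Z) := by gcongr
      _ = 2 * C * (Y * Z) := by ring

theorem TimeProfile.continuous {p B : ℝ} {E E₁ : ℝ → ℝ} (h : TimeProfile p B E E₁) :
    Continuous E := continuous_iff_continuousAt.mpr fun t => (h.hasDerivAt t).continuousAt

/-- The product of a dilated time cutoff and a zonal function. -/
def zonalTest (o : Sph N) (E : ℝ → ℝ) (T : ℝ) (H : ℝ → ℝ) (z : ℝ × Sph N) : ℝ :=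
  E (z.1 / T) * zonal o H z.2

theorem homExt_const_mul (a : ℝ) (v : Sph N → ℝ) :
    homExt (fun y => a * v y) = a • homExt v := by
  ext y
  simp only [homExt, Pi.smul_apply, smul_eq_mul]
  split_ifs <;> simp

theorem continuous_inner_sph (o : Sph N) :
    Continuous fun x : Sph N => inner ℝ (o : Amb N) (x : Amb N) := by fun_prop

theorem hasDerivAt_zonalTest (o : Sph N) {E E₁ : ℝ → ℝ} (hE : ∀ t, HasDerivAt E (E₁ t) t)
    (T : ℝ) (H : ℝ → ℝ) (z : ℝ × Sph N) :
    HasDerivAt (fun s => zonalTest o E T H (s, z.2)) (E₁ (z.1 / T) / T * zonal o H z.2) z.1 := by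
  have h1 : HasDerivAt (fun s : ℝ => s / T) (1 / T) z.1 := (hasDerivAt_id z.1).div_const T
  have h2 := ((hE (z.1 / T)).comp z.1 h1).mul_const (zonal o H z.2)
  refine h2.congr_deriv ?_
  ring

theorem timeDeriv_zonalTest (o : Sph N) {E E₁ : ℝ → ℝ} (hE : ∀ t, HasDerivAt E (E₁ t) t)
    (T : ℝ) (H : ℝ → ℝ) (z : ℝ × Sph N) :
    timeDeriv (zonalTest o E T H) z = E₁ (z.1 / T) / T * zonal o H z.2 :=
  (hasDerivAt_zonalTest o hE T H z).deriv

theorem slice_zonalTest (o : Sph N) (E : ℝ → ℝ) (T : ℝ) (H : ℝ → ℝ) (t : ℝ) :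
    slice (zonalTest o E T H) t = fun x => E (t / T) * zonal o H x := rfl

theorem isC12On_zonalTest (o : Sph N) {E E₁ : ℝ → ℝ} (hE : ∀ t, HasDerivAt E (E₁ t) t)
    (hE₁ : Continuous E₁) (T : ℝ) {H : ℝ → ℝ} {J : Set ℝ} (hJ : IsOpen J)
    (hH : ContDiffOn ℝ 2 H J) :
    IsC12On (zonalTest o E T H) (univ ×ˢ {x : Sph N | inner ℝ (o : Amb N) (x : Amb N) ∈ J}) := by
  have hEc : Continuous E := continuous_iff_continuousAt.mpr fun t => (hE t).continuousAt
  have hHc : ContinuousOn (fun z : ℝ × Sph N => zonal o H z.2)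
      (univ ×ˢ {x : Sph N | inner ℝ (o : Amb N) (x : Amb N) ∈ J}) :=
    hH.continuousOn.comp ((continuous_inner_sph o).comp continuous_snd).continuousOn
      fun z hz => hz.2
  have hcd : ∀ x : Sph N, inner ℝ (o : Amb N) (x : Amb N) ∈ J →
      ContDiffAt ℝ 2 (homExt (zonal o H)) (x : Amb N) := fun x hx =>
    contDiffAt_homExt_zonal o x (hH.contDiffAt (hJ.mem_nhds hx))
  have hspace : ∀ i : ℕ, i ≤ 2 → ContinuousOn
      (fun z : ℝ × Sph N => iteratedFDeriv ℝ i (homExt (slice (zonalTest o E T H) z.1)) (z.2 : Amb N))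
      (univ ×ˢ {x : Sph N | inner ℝ (o : Amb N) (x : Amb N) ∈ J}) := by
    intro i hi
    have hi' : (i : WithTop ℕ∞) ≤ 2 := by exact_mod_cast hi
    have h1 : ContinuousOn (fun z : ℝ × Sph N =>
        E (z.1 / T) • iteratedFDeriv ℝ i (homExt (zonal o H)) (z.2 : Amb N))
        (univ ×ˢ {x : Sph N | inner ℝ (o : Amb N) (x : Amb N) ∈ J}) := by
      have hEz : Continuous fun z : ℝ × Sph N => E (z.1 / T) := by fun_prop
      refine hEz.continuousOn.smul fun z hz => ?_
      have h2 : ContinuousAt (iteratedFDeriv ℝ i (homExt (zonal o H))) (z.2 : Amb N) :=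
        ((hcd z.2 hz.2).iteratedFDeriv_right (m := 0) (by simpa using hi')).continuousAt
      exact (ContinuousAt.comp (f := fun z : ℝ × Sph N => (z.2 : Amb N)) h2
        (by fun_prop)).continuousWithinAt
    refine h1.congr fun z hz => ?_
    simp only [slice_zonalTest]
    rw [homExt_const_mul, iteratedFDeriv_const_smul_apply ((hcd z.2 hz.2).of_le hi')]
  refine ⟨?_, ?_, ?_, ?_, hspace 1 one_le_two, hspace 2 le_rfl⟩
  · exact ContinuousOn.mul (by fun_prop) hHc
  · intro z _; exact (hasDerivAt_zonalTest o hE T H z).differentiableAt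
  · have : timeDeriv (zonalTest o E T H) = fun z => E₁ (z.1 / T) / T * zonal o H z.2 :=
      funext (timeDeriv_zonalTest o hE T H)
    rw [this]
    exact ContinuousOn.mul (by fun_prop) hHc
  · intro z hz
    rw [slice_zonalTest, homExt_const_mul]
    exact contDiffAt_const.smul (hcd z.2 hz.2)

theorem mem_omegaBar_iff {o x : Sph N} {δ : ℝ} (h0 : 0 ≤ δ) (h1 : δ ≤ Real.pi) :
    x ∈ OmegaBar o δ ↔ inner ℝ (o : Amb N) (x : Amb N) ∈ Ioc (-1) (Real.cos δ) := by
  rw [OmegaBar, mem_ofPred_eq, le_gdist_iff o x h0 h1, gdist_lt_pi_iff, mem_Ioc, and_comm]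

theorem measurableSet_omegaBar (o : Sph N) (δ : ℝ) : MeasurableSet (OmegaBar o δ) :=
  (measurableSet_le measurable_const (continuous_gdist o).measurable).inter
    (measurableSet_lt (continuous_gdist o).measurable measurable_const)

theorem measurableSet_Q (o : Sph N) (δ : ℝ) : MeasurableSet (Q o δ) :=
  measurableSet_Ioi.prod (measurableSet_omegaBar o δ)

/-- The compact part of the partial closure lying at latitude at least `e`. -/
theorem isCompact_latitudes (o : Sph N) (e c₀ : ℝ) :
    IsCompact {x : Sph N | inner ℝ (o : Amb N) (x : Amb N) ∈ Icc e c₀} :=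
  (isClosed_Icc.preimage (continuous_inner_sph o)).isCompact

/-- Since `-∂_r = sin r · d/dc`, the sign condition on the outward normal derivative is `H' ≤ 0` at
`cos δ`. Vanishing for `c < e` keeps the support away from the antipode. -/
theorem isTestFunction_zonalTest (o : Sph N) {p B : ℝ} {E E₁ : ℝ → ℝ} (hE : TimeProfile p B E E₁)
    {T : ℝ} (hT : 0 < T) {H : ℝ → ℝ} {c₁ H' δ e : ℝ} (hδ0 : 0 ≤ δ) (hδπ : δ < Real.pi)
    (hδc : Real.cos δ < c₁) (hH : ContDiffOn ℝ 2 H (Ioo (-1) c₁))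
    (he : -1 < e) (hHe : ∀ c ∈ Ioo (-1) e, H c = 0)
    (hHnn : ∀ c ∈ Ioc (-1) (Real.cos δ), 0 ≤ H c) (hH0 : H (Real.cos δ) = 0)
    (hH' : HasDerivAt H H' (Real.cos δ)) (hH'le : H' ≤ 0) :
    IsTestFunction o δ (zonalTest o E T H) := by
  have hcos : ∀ x ∈ Gam o δ, inner ℝ (o : Amb N) (x : Amb N) = Real.cos δ := fun x hx => by
    rw [← cos_gdist, show gdist o x = δ from hx]
  refine ⟨⟨univ ×ˢ {x : Sph N | inner ℝ (o : Amb N) (x : Amb N) ∈ Ioo (-1) c₁}, ?_, ?_,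
    isC12On_zonalTest o hE.hasDerivAt hE.continuous_deriv T isOpen_Ioo hH⟩,
    ⟨Icc T (4 * T) ×ˢ {x : Sph N | inner ℝ (o : Amb N) (x : Amb N) ∈ Icc e (Real.cos δ)},
      isCompact_Icc.prod (isCompact_latitudes o e _), ?_, ?_⟩, ?_, ?_, ?_⟩
  · exact isOpen_univ.prod (isOpen_Ioo.preimage (continuous_inner_sph o))
  · intro z hz
    have h1 := (mem_omegaBar_iff hδ0 hδπ.le).mp hz.2
    exact ⟨mem_univ _, h1.1, h1.2.trans_lt hδc⟩
  · intro z hz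
    exact ⟨hT.trans_le hz.1.1, (mem_omegaBar_iff hδ0 hδπ.le).mpr
      ⟨he.trans_le hz.2.1, hz.2.2⟩⟩
  · intro z hz
    have h1 := (mem_omegaBar_iff hδ0 hδπ.le).mp hz.1.2
    by_cases ht : z.1 ∈ Icc T (4 * T)
    · have h2 : inner ℝ (o : Amb N) (z.2 : Amb N) < e := by
        by_contra! hcon
        exact hz.2 ⟨ht, hcon, h1.2⟩
      simp only [zonalTest, zonal]
      rw [hHe _ ⟨h1.1, h2⟩, mul_zero]
    · simp only [zonalTest]
      rw [hE.eq_zero _ fun h => ht ⟨by simpa using (le_div_iff₀ hT).mp h.1,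
        (div_le_iff₀ hT).mp h.2⟩, zero_mul]
  · intro z hz
    exact mul_nonneg (hE.nonneg _) (hHnn _ ((mem_omegaBar_iff hδ0 hδπ.le).mp hz.2))
  · intro t _ x hx
    simp only [zonalTest, zonal]
    rw [hcos x hx, hH0, mul_zero]
  · intro t _ x hx
    have h1 : slice (zonalTest o E T H) t = zonal o (fun c => E (t / T) * H c) := rfl
    rw [h1, normalDeriv_zonal o x (Φ' := E (t / T) * H') (by
      rw [hcos x hx]; exact hH'.const_mul _)]
    have hs : 0 ≤ Real.sin (gdist o x) := by rw [sin_gdist]; exact Real.sqrt_nonneg _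
    exact mul_nonpos_of_nonpos_of_nonneg (mul_nonpos_of_nonneg_of_nonpos (hE.nonneg _) hH'le) hs

end TestFunctions

/-! ### Young's inequality in the weak formulation. -/

section WeakInequality

variable {N : ℕ}

theorem integrableOn_mul_of_compactSupport {X : Type*} [TopologicalSpace X] [T2Space X]
    [MeasurableSpace X] [OpensMeasurableSpace X] [SecondCountableTopology X] {m : Measure X}
    {v g : X → ℝ} {K A : Set X} (hK : IsCompact K) (hA : MeasurableSet A)
    (hv : IntegrableOn v K m) (hg : ContinuousOn g K) (h0 : ∀ z ∈ A \ K, g z = 0) :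
    IntegrableOn (fun z => v z * g z) A m :=
  (hv.mul_continuousOn hg hK).of_forall_sdiff_eq_zero hA fun z hz => by rw [h0 z hz, mul_zero]

instance isFiniteMeasureOnCompacts_spaceTimeMeasure :
    IsFiniteMeasureOnCompacts (spaceTimeMeasure N) := by
  unfold spaceTimeMeasure; infer_instance

/-- Testing a weak solution: the source is controlled by any integrable majorant arising from
Young's inequality. -/
theorem IsWeakSolution.integral_source_le {o : Sph N} {δ lam α p q : ℝ} {f : Sph N → ℝ}
    {u : ℝ × Sph N → ℝ} (hu : IsWeakSolution o δ lam α p f u) (hpq : p.HolderConjugate q)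
    {ξ : ℝ × Sph N → ℝ} (hξ : IsTestFunction o δ ξ) {K : Set (ℝ × Sph N)} (hK : IsCompact K)
    (hKQ : K ⊆ Q o δ) (hw : ContinuousOn (fun z => Real.sin (gdist o z.2) ^ α * ξ z) K)
    (hτ : ContinuousOn (timeDeriv ξ) K)
    (hL : ContinuousOn (fun z => sphLaplacian (slice ξ z.1) z.2
      + lam / Real.sin (gdist o z.2) ^ 2 * ξ z) K)
    (hξ0 : ∀ z ∈ Q o δ \ K, ξ z = 0) (hτ0 : ∀ z ∈ Q o δ \ K, timeDeriv ξ z = 0)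
    (hL0 : ∀ z ∈ Q o δ \ K, sphLaplacian (slice ξ z.1) z.2
      + lam / Real.sin (gdist o z.2) ^ 2 * ξ z = 0)
    {b S : ℝ × Sph N → ℝ} (hb : ∀ z ∈ Q o δ, 0 ≤ b z) (hbS : ∀ z ∈ Q o δ, b z ^ q ≤ S z)
    (hS : IntegrableOn S (Q o δ) (spaceTimeMeasure N))
    (hbound : ∀ z ∈ Q o δ, |timeDeriv ξ z| + |sphLaplacian (slice ξ z.1) z.2
      + lam / Real.sin (gdist o z.2) ^ 2 * ξ z| ≤
        b z * (Real.sin (gdist o z.2) ^ α * ξ z) ^ (1 / p)) :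
    ∫ z in Q o δ, f z.2 * ξ z ∂(spaceTimeMeasure N) ≤ ∫ z in Q o δ, S z ∂(spaceTimeMeasure N) := by
  have hp := hpq.lt
  have hq := hpq.symm.lt
  have hp0 : 0 < p := by linarith
  have hmem := hu.memLpLoc K hK hKQ
  have hQ := measurableSet_Q o δ
  have : IsFiniteMeasure ((spaceTimeMeasure N).restrict K) :=
    ⟨by rw [Measure.restrict_apply_univ]; exact hK.measure_lt_top⟩
  have hu1 : IntegrableOn u K (spaceTimeMeasure N) :=
    hmem.integrable (by rw [← ENNReal.ofReal_one]; exact ENNReal.ofReal_le_ofReal hp.le)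
  have hup : IntegrableOn (fun z => |u z| ^ p) K (spaceTimeMeasure N) := by
    have := hmem.integrable_norm_rpow (by simpa using hp0) ENNReal.ofReal_ne_top
    rw [ENNReal.toReal_ofReal hp0.le] at this
    exact this
  have hA : IntegrableOn (fun z => Real.sin (gdist o z.2) ^ α * |u z| ^ p * ξ z) (Q o δ)
      (spaceTimeMeasure N) := by
    refine (integrableOn_mul_of_compactSupport hK hQ hup hw fun z hz => by
      rw [hξ0 z hz, mul_zero]).congr ?_
    exact Eventually.of_forall fun z => by simp only []; ring
  have hUτ := integrableOn_mul_of_compactSupport hK hQ hu1 hτ hτ0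
  have hUτn : IntegrableOn (fun z => -(u z * timeDeriv ξ z)) (Q o δ) (spaceTimeMeasure N) :=
    hUτ.neg
  have hUL := integrableOn_mul_of_compactSupport hK hQ hu1 hL hL0
  have hweak := hu.weak_ineq ξ hξ
  -- The factors `1/p` and `1/q` of Young's inequality are bounded by `1`; the first term then
  -- cancels exactly against the nonlinear term of the weak inequality.
  have hpt : ∀ z ∈ Q o δ, -(u z * timeDeriv ξ z) - u z * (sphLaplacian (slice ξ z.1) z.2
      + lam / Real.sin (gdist o z.2) ^ 2 * ξ z) ≤
      Real.sin (gdist o z.2) ^ α * |u z| ^ p * ξ z + S z := by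
    intro z hz
    have hb1 := hbound z hz
    set τ := timeDeriv ξ z
    set L := sphLaplacian (slice ξ z.1) z.2 + lam / Real.sin (gdist o z.2) ^ 2 * ξ z
    have hs : 0 ≤ Real.sin (gdist o z.2) := by rw [sin_gdist]; exact Real.sqrt_nonneg _
    have hw0 : 0 ≤ Real.sin (gdist o z.2) ^ α * ξ z :=
      mul_nonneg (Real.rpow_nonneg hs _) (hξ.nonneg z hz)
    set w := Real.sin (gdist o z.2) ^ α * ξ z with hwdef
    have h1 : -(u z * τ) - u z * L ≤ |u z| * (|τ| + |L|) := by
      have e1 := neg_abs_le (u z * τ)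
      have e2 := neg_abs_le (u z * L)
      rw [abs_mul] at e1 e2
      linarith
    have h2 : |u z| * (|τ| + |L|) ≤ (w ^ (1 / p) * |u z|) * b z := by
      calc |u z| * (|τ| + |L|) ≤ |u z| * (b z * w ^ (1 / p)) := by gcongr
        _ = _ := by ring
    have hwp : 0 ≤ w ^ (1 / p) * |u z| := by positivity
    have h3 := Real.young_inequality_of_nonneg hwp (hb z hz) hpq
    have h4 : (w ^ (1 / p) * |u z|) ^ p = w * |u z| ^ p := by
      rw [Real.mul_rpow (by positivity) (abs_nonneg _), ← Real.rpow_mul hw0,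
        one_div_mul_cancel hp0.ne', Real.rpow_one]
    have h5 : w * |u z| ^ p / p ≤ w * |u z| ^ p :=
      div_le_self (by positivity) hp.le
    have h6 : b z ^ q / q ≤ b z ^ q := div_le_self (Real.rpow_nonneg (hb z hz) _) hq.le
    have h7 := hbS z hz
    rw [h4] at h3
    calc _ ≤ w * |u z| ^ p + S z := by linarith
      _ = _ := by rw [hwdef]; ring
  have hint : ∫ z in Q o δ, (-(u z * timeDeriv ξ z) - u z * (sphLaplacian (slice ξ z.1) z.2
      + lam / Real.sin (gdist o z.2) ^ 2 * ξ z)) ∂(spaceTimeMeasure N) ≤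
      ∫ z in Q o δ, (Real.sin (gdist o z.2) ^ α * |u z| ^ p * ξ z + S z) ∂(spaceTimeMeasure N) :=
    setIntegral_mono_on (hUτn.sub hUL) (hA.add hS) hQ hpt
  rw [integral_add hA hS, integral_sub hUτn hUL, integral_neg] at hint
  linarith

end WeakInequality

/-! ### Estimates for the elliptic error and the time integrals. -/

section NonexistenceEstimates

variable {N : ℕ}

theorem sinSq_nonneg (o x : Sph N) : 0 ≤ 1 - (inner ℝ (o : Amb N) (x : Amb N)) ^ 2 := by
  rw [← sin_gdist_sq]; positivity

theorem exists_integral_shell_le (N : ℕ) : ∃ C : ℝ, 0 < C ∧ ∀ (o : Sph N) (ℓ : ℝ), 0 ≤ ℓ →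
    Integrable ({x : Sph N | Real.exp (-ℓ) ≤ 1 - (inner ℝ (o : Amb N) (x : Amb N)) ^ 2}.indicator
      fun x => (1 - (inner ℝ (o : Amb N) (x : Amb N)) ^ 2) ^ (-(N : ℝ) / 2)) (sphMeasure N) ∧
    ∫ x, {x : Sph N | Real.exp (-ℓ) ≤ 1 - (inner ℝ (o : Amb N) (x : Amb N)) ^ 2}.indicator
      (fun x => (1 - (inner ℝ (o : Amb N) (x : Amb N)) ^ 2) ^ (-(N : ℝ) / 2)) x ∂(sphMeasure N)
      ≤ C * (1 + ℓ) := by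
  obtain ⟨C, hC, h⟩ := lintegral_sinSq_rpow_le N
  refine ⟨C, hC, fun o ℓ hℓ => ?_⟩
  have hms := measurableSet_sinSq_ge o (Real.exp (-ℓ))
  have hmeas : Measurable fun x : Sph N =>
      (1 - (inner ℝ (o : Amb N) (x : Amb N)) ^ 2) ^ (-(N : ℝ) / 2) :=
    (measurable_const.sub ((measurable_inner_sph o).pow_const 2)).pow_const _
  have hnn : ∀ x : Sph N, 0 ≤ (1 - (inner ℝ (o : Amb N) (x : Amb N)) ^ 2) ^ (-(N : ℝ) / 2) :=
    fun x => Real.rpow_nonneg (sinSq_nonneg o x) _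
  have hle := h o ℓ hℓ
  have hint : IntegrableOn (fun x : Sph N =>
      (1 - (inner ℝ (o : Amb N) (x : Amb N)) ^ 2) ^ (-(N : ℝ) / 2))
      {x : Sph N | Real.exp (-ℓ) ≤ 1 - (inner ℝ (o : Amb N) (x : Amb N)) ^ 2} (sphMeasure N) := by
    refine ⟨hmeas.aestronglyMeasurable, ?_⟩
    rw [hasFiniteIntegral_iff_ofReal (Eventually.of_forall hnn)]
    exact hle.trans_lt ENNReal.ofReal_lt_top
  refine ⟨(integrable_indicator_iff hms).mpr hint, ?_⟩
  rw [integral_indicator hms, integral_eq_lintegral_of_nonneg_ae (Eventually.of_forall hnn)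
    hmeas.aestronglyMeasurable]
  exact ENNReal.toReal_le_of_le_ofReal (by positivity) hle

variable {lam m c₁ c₀ : ℝ} {φ φ₁ φ₂ I k k₁ k₂ : ℝ → ℝ}

/-- `I` tends to infinity at the pole because it dominates `-log s`; hence `k(I)` vanishes near the
pole and the test function has compact support. -/
theorem RadialData.exists_le_I (h : RadialData N lam m c₁ c₀ φ φ₁ φ₂ I)
    (hmN : 2 * m ≤ (N : ℝ) - 2) (A : ℝ) :
    ∃ e, -1 < e ∧ e ≤ c₀ ∧ ∀ c ∈ Ioo (-1) e, A ≤ I c := by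
  obtain ⟨C, hC, hlog⟩ := h.neg_log_le hmN
  refine ⟨min c₀ (-1 + Real.exp (-(C * (1 + A))) / 2),
    lt_min h.c₀_mem.1 (by linarith [Real.exp_pos (-(C * (1 + A)))]), min_le_left _ _,
    fun c hc => ?_⟩
  have h1 := hlog c ⟨hc.1, hc.2.le.trans (min_le_left _ _)⟩
  have hσ := one_sub_sq_pos h.c₁_neg ⟨hc.1, (hc.2.trans_le (min_le_left _ _)).trans h.c₀_mem.2⟩
  have h2 : 1 - c ^ 2 ≤ Real.exp (-(C * (1 + A))) := by
    have := hc.2.trans_le (min_le_right _ _)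
    nlinarith [hc.1]
  have h3 := Real.log_le_log hσ h2
  rw [Real.log_exp] at h3
  have h4 : C * (1 + A) ≤ C * (1 + I c) := by linarith
  have := le_of_mul_le_mul_left h4 hC
  linarith

/-- The heart of the exponent count: after extracting the `1/p` power of the weighted test function,
the remaining weight, raised to the power `q`, is the borderline `s^(-N/2)`. -/
theorem RadialData.laplacian_bound (h : RadialData N lam m c₁ c₀ φ φ₁ φ₂ I)
    {p q μ α C R : ℝ} (hp : 1 < p) (hpq : 1 / p + 1 / q = 1)
    (hμm : μ = ((N : ℝ) - 2) / 2 - m) (hα : α + 2 ≤ (p - 1) * m)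
    (rc : RadialCutoff p μ C R c₀ I k k₁ k₂) {c : ℝ} (hc : c ∈ Ioc (-1) c₀) :
    (1 - c ^ 2) ^ (1 - (N : ℝ)) * (φ c ^ 3)⁻¹ * |k₂ (I c)| ≤
      16 * (C / R) * ((1 - c ^ 2) ^ (-(N : ℝ) / 2)) ^ (1 / q) *
        ((1 - c ^ 2) ^ (α / 2) * (φ c * k (I c))) ^ (1 / p) := by
  have hcJ : c ∈ Ioo (-1) c₁ := ⟨hc.1, hc.2.trans_lt h.c₀_mem.2⟩
  have hσ := one_sub_sq_pos h.c₁_neg hcJ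
  have hσ1 : 1 - c ^ 2 ≤ 1 := by nlinarith [sq_nonneg c]
  have hφ := h.φ_pos hcJ
  have hφle := h.le_φ c hcJ
  have hk0 := rc.nonneg _ (h.I_nonneg c hc)
  have hk2 := rc.deriv₂_le c hc
  set σ := 1 - c ^ 2 with hσdef
  have hp0 : 0 < p := by linarith
  rw [Real.mul_rpow (by positivity) (by positivity), Real.mul_rpow hφ.le hk0,
    ← Real.rpow_mul hσ.le, ← Real.rpow_mul hσ.le]
  set K := k (I c) ^ (1 / p)
  have hq : 1 / q = 1 - 1 / p := by linarith
  have hX := Real.rpow_pos_of_pos hσ (-(μ * (1 + 1 / p)))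
  -- the lower bound for the profile
  have h1 : σ ^ (-m / 2 * (3 + 1 / p)) / 16 ≤ φ c ^ 3 * φ c ^ (1 / p) := by
    have e1 : φ c ^ 3 * φ c ^ (1 / p) = φ c ^ (3 + 1 / p) := by
      rw [Real.rpow_add hφ]; norm_cast
    rw [e1]
    have h2 : (2 : ℝ) ^ (3 + 1 / p) ≤ 16 := by
      calc (2 : ℝ) ^ (3 + 1 / p) ≤ 2 ^ (4 : ℝ) := by
            apply Real.rpow_le_rpow_of_exponent_le (by norm_num)
            have : 1 / p ≤ 1 := by rw [div_le_one hp0]; exact hp.le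
            linarith
        _ = 16 := by norm_num
    calc σ ^ (-m / 2 * (3 + 1 / p)) / 16 ≤ σ ^ (-m / 2 * (3 + 1 / p)) / 2 ^ (3 + 1 / p) := by
          gcongr
      _ = (σ ^ (-m / 2) / 2) ^ (3 + 1 / p) := by
          rw [Real.div_rpow (by positivity) (by norm_num), ← Real.rpow_mul hσ.le]
      _ ≤ _ := Real.rpow_le_rpow (by positivity) hφle (by positivity)
  -- The exponents on the right add up to `1 - N - ((p-1)m - (α+2))/(2p)`, so `hα` is exactly what
  -- is needed for `σ ≤ 1`.
  have h3 : σ ^ (1 - (N : ℝ)) ≤ σ ^ (-(N : ℝ) / 2 * (1 / q)) * σ ^ (α / 2 * (1 / p)) *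
      σ ^ (-(μ * (1 + 1 / p))) * σ ^ (-m / 2 * (3 + 1 / p)) := by
    rw [← Real.rpow_add hσ, ← Real.rpow_add hσ, ← Real.rpow_add hσ]
    apply Real.rpow_le_rpow_of_exponent_ge hσ hσ1
    rw [hq, hμm]
    have e1 : -(N : ℝ) / 2 * (1 - 1 / p) + α / 2 * (1 / p) +
        -((((N : ℝ) - 2) / 2 - m) * (1 + 1 / p)) + -m / 2 * (3 + 1 / p) =
        1 - (N : ℝ) - ((p - 1) * m - (α + 2)) / (2 * p) := by
      field_simp; ring
    rw [e1]
    have : 0 ≤ ((p - 1) * m - (α + 2)) / (2 * p) := div_nonneg (by linarith) (by linarith)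
    linarith
  set A := σ ^ (-(N : ℝ) / 2 * (1 / q))
  set A' := σ ^ (α / 2 * (1 / p))
  set Y := σ ^ (-m / 2 * (3 + 1 / p))
  set Z := σ ^ (-(μ * (1 + 1 / p)))
  have hA : 0 < A := Real.rpow_pos_of_pos hσ _
  have hA' : 0 < A' := Real.rpow_pos_of_pos hσ _
  have hF : 0 < φ c ^ (1 / p) := Real.rpow_pos_of_pos hφ _
  have hF3 : 0 < φ c ^ 3 := pow_pos hφ 3
  calc σ ^ (1 - (N : ℝ)) * (φ c ^ 3)⁻¹ * |k₂ (I c)|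
      ≤ (A * A' * Z * Y) * (φ c ^ 3)⁻¹ * |k₂ (I c)| := by gcongr
    _ ≤ (A * A' * Z * (16 * (φ c ^ 3 * φ c ^ (1 / p)))) * (φ c ^ 3)⁻¹ * |k₂ (I c)| := by
        gcongr; linarith
    _ = 16 * A * A' * φ c ^ (1 / p) * (|k₂ (I c)| * Z) := by field_simp
    _ ≤ 16 * A * A' * φ c ^ (1 / p) * (C / R * K) := by gcongr
    _ = _ := by ring

theorem le_integral_timeProfile {p B : ℝ} {E E₁ : ℝ → ℝ} (hE : TimeProfile p B E E₁) {T : ℝ}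
    (hT : 0 < T) : T ≤ ∫ t in Ioi (0 : ℝ), E (t / T) := by
  have hc : Continuous fun t => E (t / T) := hE.continuous.comp (by fun_prop)
  have hz : ∀ t, t ∉ Icc T (4 * T) → E (t / T) = 0 := fun t ht =>
    hE.eq_zero _ fun h => ht ⟨by simpa using (le_div_iff₀ hT).mp h.1, (div_le_iff₀ hT).mp h.2⟩
  have hint : Integrable fun t => E (t / T) :=
    hc.integrable_of_hasCompactSupport (HasCompactSupport.intro isCompact_Icc hz)
  have hsub : Icc (2 * T) (3 * T) ⊆ Ioi (0 : ℝ) := fun t ht =>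
    (show 0 < 2 * T by positivity).trans_le ht.1
  have h1 : ∫ t in Icc (2 * T) (3 * T), E (t / T) = T := by
    rw [setIntegral_congr_fun measurableSet_Icc (g := fun _ => (1 : ℝ)) fun t ht =>
      hE.eq_one _ ⟨(le_div_iff₀ hT).mpr ht.1, (div_le_iff₀ hT).mpr ht.2⟩]
    simp only [integral_const, MeasurableSet.univ, measureReal_restrict_apply, univ_inter,
      Real.volume_real_Icc, smul_eq_mul, mul_one]
    rw [max_eq_left (by linarith)]
    ring
  refine h1.symm.le.trans ?_
  exact setIntegral_mono_set hint.integrableOn (Eventually.of_forall fun t => hE.nonneg _)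
    hsub.eventuallyLE

theorem add_rpow_le_two_rpow_mul {a b q : ℝ} (ha : 0 ≤ a) (hb : 0 ≤ b) (hq : 0 ≤ q) :
    (a + b) ^ q ≤ 2 ^ q * (a ^ q + b ^ q) := by
  have hab : a + b ≤ 2 * max a b := by linarith [le_max_left a b, le_max_right a b]
  have hm : 0 ≤ max a b := ha.trans (le_max_left _ _)
  calc (a + b) ^ q ≤ (2 * max a b) ^ q := Real.rpow_le_rpow (by positivity) hab hq
    _ = 2 ^ q * max a b ^ q := Real.mul_rpow two_pos.le hm
    _ ≤ 2 ^ q * (a ^ q + b ^ q) := by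
      gcongr
      rcases max_choice a b with h | h <;> rw [h]
      · linarith [Real.rpow_nonneg hb q]
      · linarith [Real.rpow_nonneg ha q]

/-- The error lives on a time interval of length `3T`, while the source is weighted by at least `T`
(`le_integral_timeProfile`); the ratio does not depend on `T`. -/
theorem integral_timeSlab_mul {o : Sph N} {δ T : ℝ} (hT : 0 < T) (s : Sph N → ℝ)
    (hs : Integrable s (sphMeasure N)) (hs0 : ∀ x, 0 ≤ s x) :
    IntegrableOn (fun z : ℝ × Sph N => (Icc T (4 * T)).indicator (fun _ => (1 : ℝ)) z.1 * s z.2)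
      (Q o δ) (spaceTimeMeasure N) ∧
    ∫ z in Q o δ, (Icc T (4 * T)).indicator (fun _ => (1 : ℝ)) z.1 * s z.2 ∂(spaceTimeMeasure N)
      ≤ 3 * T * ∫ x, s x ∂(sphMeasure N) := by
  have hQ : (spaceTimeMeasure N).restrict (Q o δ) =
      (volume.restrict (Ioi (0 : ℝ))).prod ((sphMeasure N).restrict (OmegaBar o δ)) := by
    rw [spaceTimeMeasure, Q, Measure.prod_restrict]
  have hind : Integrable ((Icc T (4 * T)).indicator fun _ => (1 : ℝ)) :=
    (integrable_indicator_iff measurableSet_Icc).mpr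
      (integrableOn_const isCompact_Icc.measure_lt_top.ne)
  have hval : ∫ t in Ioi (0 : ℝ), (Icc T (4 * T)).indicator (fun _ => (1 : ℝ)) t ≤ 3 * T := by
    refine (setIntegral_le_integral hind (Eventually.of_forall fun t =>
      indicator_nonneg (fun _ _ => zero_le_one) t)).trans (le_of_eq ?_)
    rw [integral_indicator measurableSet_Icc]
    simp only [integral_const, MeasurableSet.univ, measureReal_restrict_apply, univ_inter,
      Real.volume_real_Icc, smul_eq_mul, mul_one]
    rw [max_eq_left (by linarith)]
    ring
  refine ⟨?_, ?_⟩
  · rw [IntegrableOn, hQ]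
    exact hind.integrableOn.mul_prod hs.integrableOn
  · rw [hQ, integral_prod_mul]
    have h1 : ∫ x in OmegaBar o δ, s x ∂(sphMeasure N) ≤ ∫ x, s x ∂(sphMeasure N) :=
      setIntegral_le_integral hs (Eventually.of_forall hs0)
    have h2 : 0 ≤ ∫ x in OmegaBar o δ, s x ∂(sphMeasure N) := integral_nonneg hs0
    exact mul_le_mul hval h1 h2 (by positivity)

end NonexistenceEstimates

/-! ### The integral estimate for the source at scale `R`. -/

section Nonexistence

variable {N : ℕ} {lam m c₁ : ℝ} {φ φ₁ φ₂ I k k₁ k₂ : ℝ → ℝ}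

theorem lpLocOn_one_integrableOn {X : Type*} [TopologicalSpace X] [MeasurableSpace X]
    {f : X → ℝ} {A K : Set X} {ν : Measure X} (hf : LpLocOn f 1 A ν) (hK : IsCompact K)
    (hKA : K ⊆ A) : IntegrableOn f K ν := by
  have := hf K hK hKA
  rw [ENNReal.ofReal_one, memLp_one_iff_integrable] at this
  exact this

/-- The test function estimate: a weak solution bounds the weighted mean of the source. -/
theorem IsWeakSolution.integral_source_mul_le {o : Sph N} {δ α p q μ C R D : ℝ} {f : Sph N → ℝ}
    {u : ℝ × Sph N → ℝ} (hu : IsWeakSolution o δ lam α p f u) (hpq : p.HolderConjugate q)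
    (hδ0 : 0 ≤ δ) (hδπ : δ < Real.pi)
    (h : RadialData N lam m c₁ (Real.cos δ) φ φ₁ φ₂ I) (hmN : 2 * m ≤ (N : ℝ) - 2)
    (hμm : μ = ((N : ℝ) - 2) / 2 - m) (hα : α + 2 ≤ (p - 1) * m) (hC : 0 < C) (hR : 1 ≤ R)
    (rc : RadialCutoff p μ C R (Real.cos δ) I k k₁ k₂)
    (hD : ∀ ℓ, 0 ≤ ℓ →
      Integrable ({x : Sph N | Real.exp (-ℓ) ≤ 1 - (inner ℝ (o : Amb N) (x : Amb N)) ^ 2}.indicator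
      fun x => (1 - (inner ℝ (o : Amb N) (x : Amb N)) ^ 2) ^ (-(N : ℝ) / 2)) (sphMeasure N) ∧
    ∫ x, {x : Sph N | Real.exp (-ℓ) ≤ 1 - (inner ℝ (o : Amb N) (x : Amb N)) ^ 2}.indicator
      (fun x => (1 - (inner ℝ (o : Amb N) (x : Amb N)) ^ 2) ^ (-(N : ℝ) / 2)) x ∂(sphMeasure N)
      ≤ D * (1 + ℓ))
    (hf : LpLocOn f 1 (OmegaBar o δ) (sphMeasure N))
    (hf0 : ∀ᵐ x ∂((sphMeasure N).restrict (OmegaBar o δ)), 0 ≤ f x) :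
    IntegrableOn (fun x => f x * zonal o (fun c => φ c * k (I c)) x) (OmegaBar o δ)
      (sphMeasure N) ∧
    ∫ x in OmegaBar o δ, f x * zonal o (fun c => φ c * k (I c)) x ∂(sphMeasure N) ≤
      3 * 2 ^ q * ((16 * (C / R)) ^ q * (D * (1 + C * R))) := by
  have hp := hpq.lt
  have hq := hpq.symm.lt
  have hp0 : 0 < p := by linarith
  have hq0 : 0 < q := by linarith
  have hR0 : 0 < R := by linarith
  have hpq1 : 1 / p + 1 / q = 1 := by simpa using hpq.inv_add_inv_eq_one
  set c₀ := Real.cos δ with hc₀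
  set H : ℝ → ℝ := fun c => φ c * k (I c) with hH
  obtain ⟨A, hA⟩ := rc.eventually_zero
  obtain ⟨e, he, hec, heI⟩ := h.exists_le_I hmN A
  have hkC := rc.contDiff
  have hk₂c : Continuous k₂ := by
    have h1 : k₁ = deriv k := funext fun t => (rc.hasDerivAt t).deriv.symm
    have h2 : k₂ = deriv (deriv k) := funext fun t => by
      rw [← h1]; exact (rc.hasDerivAt₁ t).deriv.symm
    have h3 := (contDiff_succ_iff_deriv (n := 1)).mp (show ContDiff ℝ (1 + 1) k by
      rw [one_add_one_eq_two]; exact hkC)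
    rw [h2]
    exact h3.2.2.continuous_deriv le_rfl
  have hHC : ContDiffOn ℝ 2 H (Ioo (-1) c₁) :=
    h.contDiffOn_φ.mul (hkC.comp_contDiffOn h.contDiffOn_I)
  have hJ : ∀ c ∈ Ioc (-1) c₀, c ∈ Ioo (-1) c₁ := fun c hc => ⟨hc.1, hc.2.trans_lt h.c₀_mem.2⟩
  have hHnn : ∀ c ∈ Ioc (-1) c₀, 0 ≤ H c := fun c hc =>
    mul_nonneg (h.φ_pos (hJ c hc)).le (rc.nonneg _ (h.I_nonneg c hc))
  have hkz : ∀ c ∈ Ioo (-1) e, k (I c) = 0 := fun c hc => hA _ (heI c hc)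
  have hHe : ∀ c ∈ Ioo (-1) e, H c = 0 := fun c hc => by simp only [hH]; rw [hkz c hc, mul_zero]
  -- Where `k(I) = 0`, the bound of `k₂` by the power `1/p` of `k` forces `k₂` to vanish as well.
  have hk₂z : ∀ c ∈ Ioo (-1) e, k₂ (I c) = 0 := by
    intro c hc
    have hc' : c ∈ Ioc (-1) c₀ := ⟨hc.1, hc.2.le.trans hec⟩
    have h1 := rc.deriv₂_le c hc'
    rw [hkz c hc, Real.zero_rpow (by positivity), mul_zero] at h1
    have h2 := Real.rpow_pos_of_pos (one_sub_sq_pos h.c₁_neg (hJ c hc')) (-(μ * (1 + 1 / p)))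
    have h3 : |k₂ (I c)| ≤ 0 := by
      by_contra! hcon
      have := mul_pos hcon h2
      linarith
    exact abs_nonpos_iff.mp h3
  have hk0 : k (I c₀) = 0 := by rw [h.I_c₀]; exact rc.eq_self 0 (by simpa using hR0.le)
  have hH0 : H c₀ = 0 := by simp only [hH]; rw [hk0, mul_zero]
  have hHd := h.hasDerivAt_mul_comp rc.hasDerivAt h.c₀_mem
  have hcosπ : ∀ x : Sph N, x ∈ OmegaBar o δ ↔ inner ℝ (o : Amb N) (x : Amb N) ∈ Ioc (-1) c₀ :=
    fun x => mem_omegaBar_iff hδ0 hδπ.le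
  -- integrability of the weighted source
  have hKx := isCompact_latitudes o e c₀
  have hKxsub : {x : Sph N | inner ℝ (o : Amb N) (x : Amb N) ∈ Icc e c₀} ⊆ OmegaBar o δ :=
    fun x hx => (hcosπ x).mpr ⟨he.trans_le hx.1, hx.2⟩
  have hIccJ : Icc e c₀ ⊆ Ioo (-1) c₁ := fun c hc => hJ c ⟨he.trans_le hc.1, hc.2⟩
  have hzone : ∀ {g : ℝ → ℝ}, ContinuousOn g (Ioo (-1) c₁) → ContinuousOn (zonal o g)
      {x : Sph N | inner ℝ (o : Amb N) (x : Amb N) ∈ Icc e c₀} := fun hg =>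
    hg.comp (continuous_inner_sph o).continuousOn fun x hx => hIccJ hx
  have hfint : IntegrableOn (fun x => f x * zonal o H x) (OmegaBar o δ) (sphMeasure N) := by
    refine integrableOn_mul_of_compactSupport hKx (measurableSet_omegaBar o δ)
      (lpLocOn_one_integrableOn hf hKx hKxsub) (hzone hHC.continuousOn) fun x hx => ?_
    have h1 := (hcosπ x).mp hx.1
    exact hHe _ ⟨h1.1, by by_contra! hcon; exact hx.2 ⟨hcon, h1.2⟩⟩
  refine ⟨hfint, ?_⟩
  have hfnn : 0 ≤ ∫ x in OmegaBar o δ, f x * zonal o H x ∂(sphMeasure N) := by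
    refine integral_nonneg_of_ae ?_
    filter_upwards [hf0, ae_restrict_mem (measurableSet_omegaBar o δ)] with x hx hxm
    exact mul_nonneg hx (hHnn _ ((hcosπ x).mp hxm))
  obtain ⟨B, E, E₁, hE⟩ := exists_timeProfile hp
  have hB := hE.B_pos
  -- a constant bounding the time derivative term
  obtain ⟨M, hM0, hM⟩ : ∃ M : ℝ, 0 ≤ M ∧ ∀ c ∈ Ioc (-1) c₀,
      B * H c ≤ M * ((1 - c ^ 2) ^ (α / 2) * H c) ^ (1 / p) := by
    have hcont : ContinuousOn (fun c => B * (H c ^ (1 / q) / (1 - c ^ 2) ^ (α / 2 * (1 / p))))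
        (Icc e c₀) := by
      refine continuousOn_const.mul (ContinuousOn.div
        ((hHC.continuousOn.mono hIccJ).rpow_const fun c _ => Or.inr (by positivity))
        (ContinuousOn.rpow_const (by fun_prop) fun c hc =>
          Or.inl (one_sub_sq_pos h.c₁_neg (hIccJ hc)).ne') fun c hc => ?_)
      exact (Real.rpow_pos_of_pos (one_sub_sq_pos h.c₁_neg (hIccJ hc)) _).ne'
    obtain ⟨M, hM⟩ := isCompact_Icc.exists_bound_of_continuousOn hcont
    refine ⟨max M 0, le_max_right _ _, fun c hc => ?_⟩
    by_cases hce : c < e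
    · rw [hHe c ⟨hc.1, hce⟩, mul_zero, mul_zero, Real.zero_rpow (by positivity), mul_zero]
    · have hcI : c ∈ Icc e c₀ := ⟨not_lt.mp hce, hc.2⟩
      have hσ := one_sub_sq_pos h.c₁_neg (hIccJ hcI)
      have hX := Real.rpow_pos_of_pos hσ (α / 2 * (1 / p))
      have h1 := (le_abs_self _).trans ((hM c hcI).trans (le_max_left M 0))
      have hHc := hHnn c hc
      rw [Real.mul_rpow (by positivity) hHc, ← Real.rpow_mul hσ.le]
      have h2 : H c = H c ^ (1 / q) * H c ^ (1 / p) := by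
        rw [← Real.rpow_add_of_nonneg hHc (by positivity) (by positivity), add_comm, hpq1,
          Real.rpow_one]
      have h3 : B * H c ^ (1 / q) ≤ max M 0 * (1 - c ^ 2) ^ (α / 2 * (1 / p)) := by
        rw [← mul_div_assoc, div_le_iff₀ hX] at h1
        exact h1
      have h4 : 0 ≤ H c ^ (1 / p) := by positivity
      calc B * H c = (B * H c ^ (1 / q)) * H c ^ (1 / p) := by rw [mul_assoc, ← h2]
        _ ≤ (max M 0 * (1 - c ^ 2) ^ (α / 2 * (1 / p))) * H c ^ (1 / p) := by gcongr
        _ = _ := by ring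
  set m₀ : ℝ := (sphMeasure N).real univ
  set sh : Sph N → ℝ := {x : Sph N | Real.exp (-(C * R)) ≤ 1 - (inner ℝ (o : Amb N) (x : Amb N)) ^ 2}.indicator
      fun x => (1 - (inner ℝ (o : Amb N) (x : Amb N)) ^ 2) ^ (-(N : ℝ) / 2) with hsh
  obtain ⟨hshint, hshle⟩ := hD (C * R) (by positivity)
  have hsh0 : ∀ x, 0 ≤ sh x := fun x =>
    indicator_nonneg (fun x _ => Real.rpow_nonneg (sinSq_nonneg o x) _) x
  have key : ∀ T : ℝ, 0 < T → ∫ x in OmegaBar o δ, f x * zonal o H x ∂(sphMeasure N) ≤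
      3 * (2 ^ q * ((M / T) ^ q * m₀ + (16 * (C / R)) ^ q * (D * (1 + C * R)))) := by
    intro T hT
    -- At `c₀` one has `I = 0`, `k 0 = 0` and `k₁ 0 = 1`, so the slope of `H` is `φ I' < 0`.
    have hξ := isTestFunction_zonalTest o hE hT hδ0 hδπ h.c₀_mem.2 hHC he hHe hHnn hH0 hHd (by
      rw [hk0, h.I_c₀, rc.deriv_zero, mul_zero, zero_add, one_mul]
      have h1 := h.φ_pos h.c₀_mem
      have h2 := one_sub_sq_pos h.c₁_neg h.c₀_mem
      have : 0 ≤ φ c₀ * ((1 - c₀ ^ 2) ^ (-(N : ℝ) / 2) / φ c₀ ^ 2) := by positivity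
      linarith)
    have hC12 := isC12On_zonalTest o hE.hasDerivAt hE.continuous_deriv T isOpen_Ioo hHC
    set K : Set (ℝ × Sph N) :=
      Icc T (4 * T) ×ˢ {x : Sph N | inner ℝ (o : Amb N) (x : Amb N) ∈ Icc e c₀} with hKdef
    have hK : IsCompact K := isCompact_Icc.prod hKx
    have hKQ : K ⊆ Q o δ := fun z hz => ⟨hT.trans_le hz.1.1, hKxsub hz.2⟩
    have hKU : K ⊆ univ ×ˢ {x : Sph N | inner ℝ (o : Amb N) (x : Amb N) ∈ Ioo (-1) c₁} :=
      fun z hz => ⟨mem_univ _, hIccJ hz.2⟩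
    have hQJ : ∀ z ∈ Q o δ, inner ℝ (o : Amb N) (z.2 : Amb N) ∈ Ioc (-1) c₀ := fun z hz =>
      (hcosπ z.2).mp hz.2
    have htime : ∀ t, t ∉ Icc T (4 * T) → E (t / T) = 0 := fun t ht =>
      hE.eq_zero _ fun h => ht ⟨by simpa using (le_div_iff₀ hT).mp h.1, (div_le_iff₀ hT).mp h.2⟩
    have htime₁ : ∀ t, t ∉ Icc T (4 * T) → E₁ (t / T) = 0 := fun t ht => by
      have := hE.deriv_le (t / T)
      rw [htime t ht, Real.zero_rpow (by positivity), mul_zero] at this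
      exact abs_nonpos_iff.mp this
    have hlow : ∀ z ∈ Q o δ \ K, z.1 ∈ Icc T (4 * T) →
        inner ℝ (o : Amb N) (z.2 : Amb N) ∈ Ioo (-1) e := fun z hz ht =>
      ⟨(hQJ z hz.1).1, by by_contra! hcon; exact hz.2 ⟨ht, hcon, (hQJ z hz.1).2⟩⟩
    -- the elliptic term
    set Λ : ℝ → ℝ := fun c => (1 - c ^ 2) ^ (1 - (N : ℝ)) * (φ c ^ 3)⁻¹ * k₂ (I c) with hΛ
    have hΛc : ContinuousOn Λ (Ioo (-1) c₁) := by
      refine ContinuousOn.mul (ContinuousOn.mul (ContinuousOn.rpow_const (by fun_prop) fun c hc =>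
        Or.inl (one_sub_sq_pos h.c₁_neg hc).ne') (ContinuousOn.inv₀
        (h.contDiffOn_φ.continuousOn.pow 3) fun c hc => (pow_pos (h.φ_pos hc) 3).ne'))
        (hk₂c.comp_continuousOn h.continuousOn_I)
    have hLeq : ∀ z ∈ Q o δ, sphLaplacian (slice (zonalTest o E T H) z.1) z.2
        + lam / Real.sin (gdist o z.2) ^ 2 * zonalTest o E T H z = E (z.1 / T) * zonal o Λ z.2 := by
      intro z hz
      have hcJ := hJ _ (hQJ z hz)
      rw [slice_zonalTest, sphLaplacian_const_mul _ _ _ (contDiffAt_homExt_zonal o z.2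
        (hHC.contDiffAt (isOpen_Ioo.mem_nhds hcJ))), sin_gdist_sq]
      have h1 := h.sphLaplacian_mul_comp hkC rc.hasDerivAt rc.hasDerivAt₁ o z.2 rfl hcJ
      simp only [zonalTest, zonal, hΛ, hH] at h1 ⊢
      rw [← h1]
      ring
    have hτeq := timeDeriv_zonalTest o hE.hasDerivAt T H
    have hweq : ∀ x : Sph N, Real.sin (gdist o x) ^ α =
        (1 - (inner ℝ (o : Amb N) (x : Amb N)) ^ 2) ^ (α / 2) := fun x => sin_gdist_rpow o x α
    have hzξ : ∀ z ∈ Q o δ \ K, zonalTest o E T H z = 0 := by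
      intro z hz
      simp only [zonalTest, zonal]
      by_cases ht : z.1 ∈ Icc T (4 * T)
      · rw [hHe _ (hlow z hz ht), mul_zero]
      · rw [htime _ ht, zero_mul]
    -- The Young majorant: `M / T` comes from the time derivative, the other summand from
    -- `RadialData.laplacian_bound` restricted to `s ≥ e^(-CR)`.
    set b : ℝ × Sph N → ℝ := fun z => (Icc T (4 * T)).indicator (fun _ => (1 : ℝ)) z.1 *
      (M / T + 16 * (C / R) * sh z.2 ^ (1 / q)) with hb
    set s : Sph N → ℝ := fun x => 2 ^ q * ((M / T) ^ q + (16 * (C / R)) ^ q * sh x) with hs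
    have hs0 : ∀ x, 0 ≤ s x := fun x => by
      have := hsh0 x
      simp only [hs]; positivity
    have hsint : Integrable s (sphMeasure N) :=
      ((integrable_const _).add (hshint.const_mul _)).const_mul _
    obtain ⟨hSint, hSle⟩ := integral_timeSlab_mul (o := o) (δ := δ) hT s hsint hs0
    have hmain := hu.integral_source_le hpq hξ hK hKQ ?_ ?_ ?_ hzξ ?_ ?_ (b := b)
      (S := fun z => (Icc T (4 * T)).indicator (fun _ => (1 : ℝ)) z.1 * s z.2) ?_ ?_ hSint ?_
    · -- evaluation of both sides
      have hlhs : ∫ z in Q o δ, f z.2 * zonalTest o E T H z ∂(spaceTimeMeasure N) =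
          (∫ t in Ioi (0 : ℝ), E (t / T)) *
            ∫ x in OmegaBar o δ, f x * zonal o H x ∂(sphMeasure N) := by
        rw [← integral_prod_mul, Measure.prod_restrict]
        refine integral_congr_ae (Eventually.of_forall fun z => ?_)
        simp only [zonalTest]; ring
      have hsval : ∫ x, s x ∂(sphMeasure N) ≤
          2 ^ q * ((M / T) ^ q * m₀ + (16 * (C / R)) ^ q * (D * (1 + C * R))) := by
        simp only [hs]
        rw [integral_const_mul, integral_add (integrable_const _) (hshint.const_mul _),
          integral_const_mul, integral_const, smul_eq_mul, mul_comm ((sphMeasure N).real univ)]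
        gcongr
      rw [hlhs] at hmain
      have h1 := mul_le_mul_of_nonneg_right (le_integral_timeProfile hE hT) hfnn
      have h2 : 3 * T * ∫ x, s x ∂(sphMeasure N) ≤ 3 * T *
          (2 ^ q * ((M / T) ^ q * m₀ + (16 * (C / R)) ^ q * (D * (1 + C * R)))) := by gcongr
      have h3 := (h1.trans hmain).trans (hSle.trans h2)
      refine le_of_mul_le_mul_left (h3.trans (le_of_eq ?_)) hT
      ring
    · refine ContinuousOn.mul ?_ (hC12.cont.mono hKU)
      simp only [hweq]
      have hsc : ContinuousOn (fun c : ℝ => (1 - c ^ 2) ^ (α / 2)) (Ioo (-1) c₁) :=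
        ContinuousOn.rpow_const (by fun_prop) fun c hc =>
          Or.inl (one_sub_sq_pos h.c₁_neg hc).ne'
      exact (hzone hsc).comp continuous_snd.continuousOn fun z hz => hz.2
    · exact hC12.cont_time.mono hKU
    · refine ContinuousOn.congr ?_ fun z hz => hLeq z (hKQ hz)
      have hEz : Continuous fun z : ℝ × Sph N => E (z.1 / T) :=
        hE.continuous.comp (by fun_prop)
      exact hEz.continuousOn.mul ((hzone hΛc).comp continuous_snd.continuousOn fun z hz => hz.2)
    · intro z hz
      rw [hτeq]
      by_cases ht : z.1 ∈ Icc T (4 * T)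
      · simp only [zonal]; rw [hHe _ (hlow z hz ht), mul_zero]
      · rw [htime₁ _ ht, zero_div, zero_mul]
    · intro z hz
      rw [hLeq z hz.1]
      by_cases ht : z.1 ∈ Icc T (4 * T)
      · simp only [zonal, hΛ]; rw [hk₂z _ (hlow z hz ht), mul_zero, mul_zero]
      · rw [htime _ ht, zero_mul]
    · intro z _
      have := hsh0 z.2
      exact mul_nonneg (indicator_nonneg (fun _ _ => zero_le_one) _) (by positivity)
    · intro z _
      have hz0 := hsh0 z.2
      by_cases ht : z.1 ∈ Icc T (4 * T)
      · simp only [hb, hs, indicator_of_mem ht, one_mul]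
        refine (add_rpow_le_two_rpow_mul (by positivity) (by positivity) hq0.le).trans
          (le_of_eq ?_)
        rw [Real.mul_rpow (by positivity) (by positivity), ← Real.rpow_mul hz0,
          one_div_mul_cancel hq0.ne', Real.rpow_one]
      · simp only [hb, indicator_of_notMem ht, zero_mul]
        rw [Real.zero_rpow hq0.ne']
    · intro z hz
      have hcz := hQJ z hz
      rw [hLeq z hz, hτeq, hweq]
      by_cases ht : z.1 ∈ Icc T (4 * T)
      · simp only [hb, indicator_of_mem ht, one_mul, zonalTest, zonal]
        set c : ℝ := inner ℝ (o : Amb N) (z.2 : Amb N) with hcdef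
        have hσ := one_sub_sq_pos h.c₁_neg (hJ c hcz)
        have hEn := hE.nonneg (z.1 / T)
        have hHn := hHnn c hcz
        have hEroot : E (z.1 / T) ≤ E (z.1 / T) ^ (1 / p) := by
          have h1 := Real.rpow_le_rpow_of_exponent_ge' hEn (hE.le_one (z.1 / T))
            (show 0 ≤ 1 / p by positivity)
            (show 1 / p ≤ 1 by rw [div_le_one (by linarith)]; exact hp.le)
          rwa [Real.rpow_one] at h1
        have hE1 := hE.deriv_le (z.1 / T)
        have hMc := hM c hcz
        have hLc := h.laplacian_bound hp hpq1 hμm hα rc hcz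
        have hfac : ((1 - c ^ 2) ^ (α / 2) * (E (z.1 / T) * H c)) ^ (1 / p) =
            E (z.1 / T) ^ (1 / p) * ((1 - c ^ 2) ^ (α / 2) * H c) ^ (1 / p) := by
          rw [← Real.mul_rpow hEn (by positivity)]; congr 1; ring
        rw [hfac]
        set Ep := E (z.1 / T) ^ (1 / p)
        set G := ((1 - c ^ 2) ^ (α / 2) * H c) ^ (1 / p) with hG
        have hEp : 0 ≤ Ep := hEn.trans hEroot
        have hG0 : 0 ≤ G := by positivity
        have ht1 : |E₁ (z.1 / T) / T * H c| ≤ M / T * (Ep * G) := by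
          rw [abs_mul, abs_div, abs_of_pos hT, abs_of_nonneg hHn]
          calc |E₁ (z.1 / T)| / T * H c ≤ (B * Ep) / T * H c := by gcongr
            _ = Ep / T * (B * H c) := by ring
            _ ≤ Ep / T * (M * G) := by gcongr
            _ = _ := by ring
        have hΛb : |Λ c| ≤ 16 * (C / R) * sh z.2 ^ (1 / q) * G := by
          by_cases h0 : k₂ (I c) = 0
          · have hz0 := hsh0 z.2
            simp only [hΛ, h0, mul_zero, abs_zero]
            positivity
          · have hsupp := rc.support c hcz h0
            have hmem : z.2 ∈ {x : Sph N |
                Real.exp (-(C * R)) ≤ 1 - (inner ℝ (o : Amb N) (x : Amb N)) ^ 2} := by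
              change Real.exp (-(C * R)) ≤ 1 - c ^ 2
              rw [← Real.exp_log hσ]
              exact Real.exp_le_exp.mpr (by linarith)
            simp only [hsh, indicator_of_mem hmem]
            have hφ := h.φ_pos (hJ c hcz)
            simp only [hΛ]
            rw [abs_mul, abs_of_pos (by positivity)]
            exact hLc
        have ht2 : |E (z.1 / T) * Λ c| ≤ 16 * (C / R) * sh z.2 ^ (1 / q) * (Ep * G) := by
          rw [abs_mul, abs_of_nonneg hEn]
          calc E (z.1 / T) * |Λ c| ≤ Ep * (16 * (C / R) * sh z.2 ^ (1 / q) * G) := by gcongr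
            _ = _ := by ring
        calc _ ≤ M / T * (Ep * G) + 16 * (C / R) * sh z.2 ^ (1 / q) * (Ep * G) :=
              add_le_add ht1 ht2
          _ = _ := by ring
      · simp only [hb, indicator_of_notMem ht, zero_mul, htime _ ht, htime₁ _ ht, zero_div,
          abs_zero, add_zero, le_refl]
  -- `M` depends on the cutoff, hence on `R`; letting `T → ∞` with `R` fixed removes it.
  have hlim : Tendsto (fun T : ℝ =>
      3 * (2 ^ q * ((M / T) ^ q * m₀ + (16 * (C / R)) ^ q * (D * (1 + C * R))))) atTop
      (𝓝 (3 * (2 ^ q * (0 ^ q * m₀ + (16 * (C / R)) ^ q * (D * (1 + C * R)))))) := by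
    have h1 : Tendsto (fun T : ℝ => M / T) atTop (𝓝 0) := tendsto_const_nhds.div_atTop tendsto_id
    have h2 := h1.rpow_const (p := q) (Or.inr hq0.le)
    exact (((h2.mul_const m₀).add_const _).const_mul _).const_mul _
  have hfin := ge_of_tendsto hlim ((eventually_gt_atTop 0).mono key)
  rw [Real.zero_rpow hq0.ne', zero_mul, zero_add] at hfin
  linarith

end Nonexistence

/-- The gain `R^(-q)` beats the linear growth of the shell integral precisely because `q > 1`. -/
theorem tendsto_cutoff_bound {q : ℝ} (hq : 1 < q) (C D : ℝ) (hC : 0 < C) :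
    Tendsto (fun R : ℝ => 3 * 2 ^ q * ((16 * (C / R)) ^ q * (D * (1 + C * R)))) atTop (𝓝 0) := by
  have h1 : Tendsto (fun R : ℝ => R ^ (-q)) atTop (𝓝 0) := tendsto_rpow_neg_atTop (by linarith)
  have h2 : Tendsto (fun R : ℝ => R ^ (-(q - 1))) atTop (𝓝 0) :=
    tendsto_rpow_neg_atTop (by linarith)
  have h3 := ((h1.const_mul (3 * 2 ^ q * (16 * C) ^ q * D)).add
    (h2.const_mul (3 * 2 ^ q * (16 * C) ^ q * D * C)))
  simp only [mul_zero, add_zero] at h3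
  refine h3.congr' ?_
  filter_upwards [eventually_gt_atTop 0] with R hR
  have h4 : R ^ (-(q - 1)) = R ^ (-q) * R := by
    rw [show -(q - 1) = -q + 1 by ring, Real.rpow_add hR, Real.rpow_one]
  have h5 : (16 * (C / R)) ^ q = (16 * C) ^ q * R ^ (-q) := by
    rw [← mul_div_assoc, Real.div_rpow (by positivity) hR.le, Real.rpow_neg hR.le, div_eq_mul_inv]
  rw [h4, h5]
  ring

/-! ### Vanishing of the source as `R → ∞`. -/

section Nonexistence

variable {N : ℕ} {lam m c₁ : ℝ} {φ φ₁ φ₂ I : ℝ → ℝ}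

/-- The source of a weak solution vanishes wherever the primitive `I` is bounded. -/
theorem IsWeakSolution.source_ae_eq_zero_of_lt {o : Sph N} {δ α p : ℝ} {f : Sph N → ℝ}
    {u : ℝ × Sph N → ℝ} (hu : IsWeakSolution o δ lam α p f u) (hp : 1 < p)
    (hδ0 : 0 ≤ δ) (hδπ : δ < Real.pi)
    (h : RadialData N lam m c₁ (Real.cos δ) φ φ₁ φ₂ I) (hmN : 2 * m ≤ (N : ℝ) - 2)
    (hα : α + 2 ≤ (p - 1) * m)
    (hf : LpLocOn f 1 (OmegaBar o δ) (sphMeasure N))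
    (hf0 : ∀ᵐ x ∂((sphMeasure N).restrict (OmegaBar o δ)), 0 ≤ f x) (A : ℝ) :
    ∀ᵐ x : Sph N ∂((sphMeasure N).restrict (OmegaBar o δ)),
      I (inner ℝ (o : Amb N) (x : Amb N)) < A → f x = 0 := by
  obtain ⟨q, hpq⟩ : ∃ q, p.HolderConjugate q := ⟨_, Real.HolderConjugate.conjExponent hp⟩
  obtain ⟨C, hC, hcut⟩ := h.exists_radialCutoff hp
    (μ := ((N : ℝ) - 2) / 2 - m) (by linarith) rfl
  obtain ⟨D, -, hD⟩ := exists_integral_shell_le N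
  have hmem : ∀ x : Sph N, x ∈ OmegaBar o δ ↔
      inner ℝ (o : Amb N) (x : Amb N) ∈ Ioc (-1) (Real.cos δ) :=
    fun x => mem_omegaBar_iff hδ0 hδπ.le
  have hJ : ∀ c ∈ Ioc (-1) (Real.cos δ), c ∈ Ioo (-1) c₁ :=
    fun c hc => ⟨hc.1, hc.2.trans_lt h.c₀_mem.2⟩
  set S : Set (Sph N) :=
    {x | inner ℝ (o : Amb N) (x : Amb N) ∈ Ioo (-1) c₁ ∩ I ⁻¹' Iio A} with hS
  have hSm : MeasurableSet S :=
    ((h.continuousOn_I.isOpen_inter_preimage isOpen_Ioo isOpen_Iio).preimage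
      (continuous_inner_sph o)).measurableSet
  have hAm := measurableSet_omegaBar o δ
  set F : Sph N → ℝ := fun x => f x * zonal o (fun c => φ c * I c) x with hF
  have hFnn : ∀ᵐ x ∂((sphMeasure N).restrict (OmegaBar o δ ∩ S)), 0 ≤ F x := by
    filter_upwards [ae_restrict_of_ae_restrict_of_subset inter_subset_left hf0,
      ae_restrict_mem (hAm.inter hSm)] with x hx hxm
    have h1 := (hmem x).mp hxm.1
    exact mul_nonneg hx (mul_nonneg (h.φ_pos (hJ _ h1)).le (h.I_nonneg _ h1))
  -- For `R ≥ A` the cutoff is the identity on `S`, so the integral on the left no longer depends on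
  -- `R`.
  have hbound : ∀ R : ℝ, max A 1 ≤ R → IntegrableOn F (OmegaBar o δ ∩ S) (sphMeasure N) ∧
      ∫ x in OmegaBar o δ ∩ S, F x ∂(sphMeasure N) ≤
        3 * 2 ^ q * ((16 * (C / R)) ^ q * (D * (1 + C * R))) := by
    intro R hR
    have hR1 : 1 ≤ R := (le_max_right _ _).trans hR
    obtain ⟨k, k₁, k₂, rc⟩ := hcut R hR1
    obtain ⟨hint, hle⟩ := hu.integral_source_mul_le hpq hδ0 hδπ h hmN rfl hα hC hR1 rc (hD o) hf hf0
    have heq : EqOn (fun x => f x * zonal o (fun c => φ c * k (I c)) x) F (OmegaBar o δ ∩ S) := by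
      intro x hx
      have h1 := h.I_nonneg _ ((hmem x).mp hx.1)
      have h2 : I (inner ℝ (o : Amb N) (x : Amb N)) < A := hx.2.2
      have h3 : k (I (inner ℝ (o : Amb N) (x : Amb N))) = I (inner ℝ (o : Amb N) (x : Amb N)) :=
        rc.eq_self _ (by rw [abs_of_nonneg h1]; exact h2.le.trans ((le_max_left _ _).trans hR))
      simp only [hF, zonal, h3]
    refine ⟨(hint.mono_set inter_subset_left).congr_fun heq (hAm.inter hSm), ?_⟩
    rw [← setIntegral_congr_fun (hAm.inter hSm) heq]
    refine (setIntegral_mono_set hint ?_ inter_subset_left.eventuallyLE).trans hle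
    filter_upwards [hf0, ae_restrict_mem hAm] with x hx hxm
    have h1 := (hmem x).mp hxm
    exact mul_nonneg hx (mul_nonneg (h.φ_pos (hJ _ h1)).le (rc.nonneg _ (h.I_nonneg _ h1)))
  have hle0 : ∫ x in OmegaBar o δ ∩ S, F x ∂(sphMeasure N) ≤ 0 :=
    ge_of_tendsto (tendsto_cutoff_bound hpq.symm.lt C D hC)
      ((eventually_ge_atTop (max A 1)).mono fun R hR => (hbound R hR).2)
  have hF0 := (setIntegral_eq_zero_iff_of_nonneg_ae hFnn (hbound _ le_rfl).1).mp
    (le_antisymm hle0 (integral_nonneg_of_ae hFnn))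
  -- The weight `φ I` vanishes only on `Γ_δ`, which is a null set.
  have hc₀ : sphMeasure N {x : Sph N | inner ℝ (o : Amb N) (x : Amb N) = Real.cos δ} = 0 :=
    sphMeasure_latitude_eq_zero o h.c₀_mem.1 (h.c₀_mem.2.trans h.c₁_neg)
  have hne : ∀ᵐ x : Sph N ∂(sphMeasure N), inner ℝ (o : Amb N) (x : Amb N) ≠ Real.cos δ := by
    rw [ae_iff]
    simpa using hc₀
  rw [ae_restrict_iff' hAm]
  have hF0' := (ae_restrict_iff' (hAm.inter hSm)).mp hF0
  filter_upwards [hF0', hne] with x hx hxne hxA hxI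
  have h1 := (hmem x).mp hxA
  have h2 : f x * (φ (inner ℝ (o : Amb N) (x : Amb N)) * I (inner ℝ (o : Amb N) (x : Amb N))) = 0 :=
    hx ⟨hxA, hJ _ h1, hxI⟩
  have h3 := h.φ_pos (hJ _ h1)
  have h4 := h.I_pos _ ⟨h1.1, h1.2.lt_of_ne hxne⟩
  exact (mul_eq_zero.mp h2).resolve_right (mul_pos h3 h4).ne'

theorem RadialData.noWeakSolution {o : Sph N} {δ α p : ℝ} (hp : 1 < p)
    (hδ0 : 0 ≤ δ) (hδπ : δ < Real.pi)
    (h : RadialData N lam m c₁ (Real.cos δ) φ φ₁ φ₂ I) (hmN : 2 * m ≤ (N : ℝ) - 2)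
    (hα : α + 2 ≤ (p - 1) * m) : NoWeakSolution o δ lam α p := by
  rintro f hf hf0 hne ⟨u, hu⟩
  refine hne ?_
  have key := ae_all_iff.mpr fun n : ℕ =>
    hu.source_ae_eq_zero_of_lt hp hδ0 hδπ h hmN hα hf hf0 (n : ℝ)
  filter_upwards [key] with x hx
  obtain ⟨n, hn⟩ := exists_nat_gt (I (inner ℝ (o : Amb N) (x : Amb N)))
  exact hx n hn

end Nonexistence

/-- The threshold is `arccos c₁`, with `c₁` given by the radius of the Frobenius solution, so it
involves neither `α` nor `p`. A single inequality covers supercritical and critical exponents. -/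
theorem exists_forall_noWeakSolution {N : ℕ} {lam : ℝ} (hN : 3 ≤ N) (hlam_pos : 0 < lam)
    (hlam_le : lam ≤ lamStar N) :
    ∃ a : ℝ, 0 ≤ a ∧ a < Real.pi ∧ ∀ δ : ℝ, a < δ → δ < Real.pi → ∀ (o : Sph N) (α p : ℝ),
      1 < p → α + 2 ≤ (p - 1) * lamN N lam → NoWeakSolution o δ lam α p := by
  have hmN : 2 * lamN N lam ≤ (N : ℝ) - 2 := by
    have := lamN_le (N := N) (lam := lam)
    linarith
  obtain ⟨c₁, hc₁, hc₁', hdata⟩ := exists_radialData (lamN_pos hN hlam_pos).le hmN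
    (lamN_root hlam_le)
  have hlt : Real.arccos c₁ < Real.pi := by
    rw [← Real.arccos_neg_one]
    exact Real.strictAntiOn_arccos ⟨le_rfl, by norm_num⟩ ⟨hc₁.le, by linarith⟩ hc₁
  refine ⟨Real.arccos c₁, Real.arccos_nonneg _, hlt, fun δ hδ hδπ o α p hp hα => ?_⟩
  have hδ0 : 0 ≤ δ := (Real.arccos_nonneg c₁).trans hδ.le
  have h1 : Real.cos δ < c₁ := by
    conv_rhs => rw [← Real.cos_arccos hc₁.le (by linarith)]
    exact Real.strictAntiOn_cos ⟨Real.arccos_nonneg _, hlt.le⟩ ⟨hδ0, hδπ.le⟩ hδ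
  have h2 : -1 < Real.cos δ := by
    rw [← Real.cos_pi]
    exact Real.strictAntiOn_cos ⟨hδ0, hδπ.le⟩ ⟨Real.pi_pos.le, le_rfl⟩ hδπ
  obtain ⟨φ, φ₁, φ₂, I, h⟩ := hdata _ ⟨h2, h1⟩
  exact h.noWeakSolution hp hδ0 hδπ hmN hα

end HardySphere

end

theorem theorem1p2 (N : ℕ) (hN : 3 ≤ N) (lam : ℝ) (hlam_pos : 0 < lam)
    (hlam_le : lam ≤ HardySphere.lamStar N) :
    (∃ a : ℝ, 0 ≤ a ∧ a < Real.pi ∧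
      ∀ δ : ℝ, a < δ → δ < Real.pi → ∀ (o : HardySphere.Sph N) (α p : ℝ),
        (max 1 (1 + (α + 2) / HardySphere.lamN N lam) < p →
          HardySphere.NoWeakSolution o δ lam α p) ∧
        (α ≤ -2 → 1 < p → HardySphere.NoWeakSolution o δ lam α p) ∧
        ((-2 < α ∧ lam < HardySphere.lamStar N) ∨
            (-2 < α ∧ α < ((N : ℝ) - 6) / 2 ∧ lam = HardySphere.lamStar N) →
          p = 1 + (α + 2) / HardySphere.lamN N lam →
          HardySphere.NoWeakSolution o δ lam α p)) ∧
    (∀ α p : ℝ, -2 < α → 1 < p → p < 1 + (α + 2) / HardySphere.lamN N lam →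
      ∃ b : ℝ, 0 ≤ b ∧ b < Real.pi ∧
        ∀ δ : ℝ, b < δ → δ < Real.pi → ∀ o : HardySphere.Sph N,
          ∃ (f : HardySphere.Sph N → ℝ) (u : ℝ × HardySphere.Sph N → ℝ),
            ContinuousOn f (HardySphere.OmegaBar o δ) ∧
            (∀ x ∈ HardySphere.OmegaBar o δ, 0 < f x) ∧
            HardySphere.IsClassicalSolution o δ lam α p f u ∧
            (∀ z ∈ HardySphere.Q o δ, 0 < u z) ∧
            ∃ (ε : ℝ) (g : ℝ → ℝ), 0 < ε ∧ HardySphere.IsProfile N lam α p g ∧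
              ∀ z ∈ HardySphere.Q o δ,
                u z = (1 - Real.exp (-z.1) / 2) * (ε * g (HardySphere.gdist o z.2))) := by
  have hm := HardySphere.lamN_pos hN hlam_pos
  refine ⟨?_, fun α p hα hp hp' => ?_⟩
  -- Multiplying by `λ_N > 0` brings each case to `α + 2 ≤ (p - 1) λ_N`: strict above the critical
  -- exponent, an equality at it, and immediate for `α ≤ -2`.
  · obtain ⟨a, ha, haπ, h⟩ := HardySphere.exists_forall_noWeakSolution hN hlam_pos hlam_le
    refine ⟨a, ha, haπ, fun δ hδ hδπ o α p => ⟨fun hp => ?_, fun hα hp => ?_, fun hα hp => ?_⟩⟩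
    · have h1 := (le_max_right _ _).trans_lt hp
      refine h δ hδ hδπ o α p ((le_max_left _ _).trans_lt hp) ?_
      rw [← div_le_iff₀ hm]
      linarith
    · exact h δ hδ hδπ o α p hp (by nlinarith)
    · have h2 : -2 < α := by rcases hα with h | h <;> exact h.1
      have h3 : 0 < (α + 2) / HardySphere.lamN N lam := div_pos (by linarith) hm
      refine h δ hδ hδπ o α p (by linarith) ?_
      rw [← div_le_iff₀ hm]
      linarith
  · rcases hlam_le.lt_or_eq with hlam | hlam
    · exact HardySphere.exists_classicalSolution_of_lt hN hlam_pos hlam hp hp'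
    · exact HardySphere.exists_classicalSolution_of_eq hN hlam_pos hlam hp hp'
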